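/- Let $M=(\mathcal S,\mathcal A,P,r,\gamma,\rho)$ be a discounted Markov decision process with finite state space $\mathcal S\neq\emptyset$, finite action space $\mathcal A$ with $|\mathcal A|\ge 2$, rewards $|r(s,a)|\le \mathcal R_{\max}$ with $\mathcal R_{\max}>0$, discount $\gamma\in[0,1)$ and initial distribution $\rho$ with $\rho(s)>0$ for all $s$. For a policy $\pi$ let $J(\pi)=\mathbb E\big[\sum_{t\ge0}\gamma^t r(s_t,a_t)\big]$ be the expected return. For $\theta\in\mathbb R^{|\mathcal S||\mathcal A|}$ let $\pi_\theta(a\mid s)=e^{\theta_{s,a}}/\sum_{a'}e^{\theta_{s,a'}}$ be the softmax tabular policy, and write $J(\theta)=J(\pi_\theta)$, $J^*=\sup_\theta J(\theta)$. Let $B(\theta)=\frac1{|\mathcal S|}\sum_s \mathrm{KL}(\mathrm{Unif}_{\mathcal A},\pi_\theta(\cdot\mid s))$, let $L_\lambda(\theta)=J(\theta)-\lambda B(\theta)$ be the log-barrier regularized objective, and $L_\lambda^*=\sup_\theta L_\lambda(\theta)$. Let $\pi^*$ be an optimal policy, $d_{\rho,s}(\pi^*)=(1-\gamma)\sum_{t\ge0}\gamma^t\,\mathbb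 P_{\pi^*}(s_t=s)$, and $D^*=\max_s d_{\rho,s}(\pi^*)/\rho(s)$. Fix an initial $\theta_0$ and $\epsilon\in(0,1)$. Vanilla policy gradient with constant step size $\eta$, batch size $m$ and horizon $H$ is $\theta_{t+1}=\theta_t+\eta\,\widehat\nabla_m L_\lambda(\theta_t)$ with $$\widehat\nabla_m L_\lambda(\theta)=\widehat\nabla_m J(\theta)+\frac{\lambda}{|\mathcal A||\mathcal S|}\sum_{s,a}\nabla_\theta\log\pi_\theta(a\mid s),$$ where $\widehat\nabla_m J(\theta_t)$ is computed from $m$ fresh independent trajectories of length $H$ of $\pi_{\theta_t}$ and is either the REINFORCE estimator $\frac1m\sum_{i=1}^m\big(\sum_{t=0}^{H-1}\gamma^t r(s^i_t,a^i_t)\big)\sum_{t'=0}^{H-1}\nabla_\theta\log\pi_\theta(a^i_{t'}\mid s^i_{t'})$ or the GPOMDP estimator $\frac1m\sum_{i=1}^m\sum_{t=0}^{H-1}\gamma^t r(s^i_t,a^i_t)\sum_{k=0}^{t}\nabla_\theta\log\pi_\theta(a^i_k\mid s^i_k)$. Put $$\lambda=\frac{(1-\gamma)\epsilon}{2D^*},\qquad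 L=\frac{\mathcal R_{\max}}{(1-\gamma)^2}\Big(2-\frac1{|\mathcal A|}\Big)+\frac{\lambda}{|\mathcal S|},\qquad \nu=2\Big(1-\frac1{|\mathcal A|}\Big)\Big(V+\frac{\lambda^2}{|\mathcal S|}\Big),$$ where $V=\frac{H\mathcal R_{\max}^2}{(1-\gamma)^2}$ for REINFORCE and $V=\frac{\mathcal R_{\max}^2}{(1-\gamma)^3}$ for GPOMDP, and $$\ell=\log\frac{2}{(1-\gamma)\epsilon},\qquad \eta=\frac{(1-\gamma)^3\epsilon^3 m}{2L\nu},\qquad \delta_0=L_\lambda^*-L_\lambda(\theta_0),\qquad \Delta_0=J^*-J(\theta_0)+B(\theta_0).$$ Then there are a universal constant $c>0$ and a constant $K>0$, depending only on $|\mathcal S|$, $|\mathcal A|$, $\mathcal R_{\max}$ and an upper bound on $D^*$ (in particular not on $\gamma$, $\epsilon$, $m$, $H$, $T$, $\theta_0$), such that for all integers $m$, $H$ with $$1\le m\le\max\Big\{1,\frac{2\nu}{(1-\gamma)^3\epsilon^3}\Big\},\qquad H\ge \frac{c\,\ell}{1-\gamma},$$ the following hold for both estimators. (1) For every $T\ge1$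 with $Tm\ge\dfrac{8\delta_0L\nu}{(1-\gamma)^6\epsilon^6}$, $$J^*-\frac1T\sum_{t=0}^{T-1}\mathbb E[J(\theta_t)]\le K\epsilon .$$ (2) If moreover $H\le\kappa\,\ell/(1-\gamma)$ for some $\kappa\ge1$, then the upper end of the batch range satisfies $$\frac{2\mathcal R_{\max}^2}{(1-\gamma)^6\epsilon^3}\le\frac{2\nu}{(1-\gamma)^3\epsilon^3}\le\frac{K\kappa\,\ell}{(1-\gamma)^6\epsilon^3},$$ the step size satisfies $\dfrac{(1-\gamma)^8\epsilon^3}{K\kappa\,\ell}\le\eta\le K$, the required total number of samples satisfies $$\frac{8\delta_0L\nu}{(1-\gamma)^6\epsilon^6}\cdot H\le\frac{K\kappa^2\ell^2\,\Delta_0}{(1-\gamma)^{12}\epsilon^6},$$ and there is $T\ge1$ satisfying the condition in (1) with $$Tm\times H\le\frac{K\kappa^2\ell^2(1+\Delta_0)}{(1-\gamma)^{12}\epsilon^6}=\widetilde{\mathcal O}\Big(\frac1{(1-\gamma)^{12}\epsilon^6}\Big).$$ -/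

import Mathlib

open MeasureTheory ProbabilityTheory

namespace PolicyGradient

/-- An infinite-horizon discounted Markov decision process with state space `S` and action space
`A`: transition probabilities `P s a`, rewards `r s a`, discount factor `γ ∈ [0, 1)` and initial
state distribution `ρ`. -/
structure MDP (S A : Type*) where
  P : S → A → PMF S
  r : S → A → ℝ
  γ : ℝ
  ρ : PMF S
  γ_nonneg : 0 ≤ γ
  γ_lt_one : γ < 1

/-- A (stationary, randomized) policy. -/
abbrev Policy (S A : Type*) := S → PMF A

/-- The parameter space `ℝ^(|S||A|)` with the Euclidean norm. -/
abbrev Param (S A : Type*) := EuclideanSpace ℝ (S × A)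

/-- The two stochastic policy gradient estimators. -/
inductive Estimator
  | reinforce
  | gpomdp

noncomputable section

section Trajectories

variable {S A : Type*} [Fintype S] [MeasurableSpace S] [MeasurableSingletonClass S]
  [Fintype A] [MeasurableSpace A] [MeasurableSingletonClass A]

/-- The law of the state-action pair `(s, a)` with `s ∼ p` and `a ∼ π(· | s)`. -/
def stateAction (p : PMF S) (π : Policy S A) : PMF (S × A) :=
  p.bind fun s => (π s).map fun a => (s, a)

/-- The transition kernel from the state-action pairs up to time `n` to the pair at time `n + 1`:
`s_{n+1} ∼ P(· | s_n, a_n)`, `a_{n+1} ∼ π(· | s_{n+1})`. -/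
def stepKernel (M : MDP S A) (π : Policy S A) (n : ℕ) :
    Kernel ((i : Finset.Iic n) → (fun _ : ℕ => S × A) i) (S × A) :=
  (Kernel.ofFunOfCountable fun x : S × A => (stateAction (M.P x.1 x.2) π).toMeasure).comap
    (fun h => h ⟨n, Finset.mem_Iic.2 le_rfl⟩) (measurable_pi_apply _)

instance (M : MDP S A) (π : Policy S A) (n : ℕ) : IsMarkovKernel (stepKernel M π n) := by
  have : IsMarkovKernel (Kernel.ofFunOfCountable fun x : S × A =>
      (stateAction (M.P x.1 x.2) π).toMeasure) :=
    ⟨fun x => PMF.toMeasure.isProbabilityMeasure (stateAction (M.P x.1 x.2) π)⟩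
  unfold stepKernel
  infer_instance

/-- The law `p(τ | π)` of an infinite trajectory `τ = (s_0, a_0, s_1, a_1, …)`. -/
def trajLaw (M : MDP S A) (π : Policy S A) : Measure (ℕ → S × A) :=
  Kernel.trajMeasure (X := fun _ => S × A) (stateAction M.ρ π).toMeasure (stepKernel M π)

instance (M : MDP S A) (π : Policy S A) : IsProbabilityMeasure (trajLaw M π) := by
  have := PMF.toMeasure.isProbabilityMeasure (stateAction M.ρ π)
  unfold trajLaw
  infer_instance

/-- The expected return `J(π) = E_τ [∑ γ^t r(s_t, a_t)]` of a policy. -/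
def policyReturn (M : MDP S A) (π : Policy S A) : ℝ :=
  ∫ τ, ∑' t : ℕ, M.γ ^ t * M.r (τ t).1 (τ t).2 ∂(trajLaw M π)

/-- `π` is an optimal policy. -/
def IsOptimalPolicy (M : MDP S A) (π : Policy S A) : Prop :=
  ∀ π' : Policy S A, policyReturn M π' ≤ policyReturn M π

/-- The discounted state visitation distribution
`d_ρ(π)(s) = (1 - γ) ∑ γ^t ℙ(s_t = s)`. -/
def visitation (M : MDP S A) (π : Policy S A) (s : S) : ℝ :=
  (1 - M.γ) * ∑' t : ℕ, M.γ ^ t * (trajLaw M π).real {τ | (τ t).1 = s}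

/-- The distribution mismatch coefficient `max_s d_ρ(π)(s) / ρ(s)`. -/
def mismatch (M : MDP S A) (π : Policy S A) : ℝ :=
  ⨆ s : S, visitation M π s / (M.ρ s).toReal

/-- The joint law of `m` independent trajectories of `π`, each truncated to its first `H`
state-action pairs. -/
def batchLaw (M : MDP S A) (π : Policy S A) (m H : ℕ) : PMF (Fin m → Fin H → S × A) :=
  have : IsProbabilityMeasure ((Measure.pi fun _ : Fin m => trajLaw M π).map
      fun (τ : Fin m → ℕ → S × A) (i : Fin m) (t : Fin H) => τ i t) :=
    Measure.isProbabilityMeasure_map (Measurable.aemeasurable (measurable_pi_lambda _ fun i =>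
      measurable_pi_lambda _ fun t => (measurable_pi_apply (t : ℕ)).comp (measurable_pi_apply i)))
  ((Measure.pi fun _ : Fin m => trajLaw M π).map
    fun (τ : Fin m → ℕ → S × A) (i : Fin m) (t : Fin H) => τ i t).toPMF

end Trajectories

section Softmax

variable {S A : Type*} [Fintype S] [Fintype A] [Nonempty A]

/-- The softmax probability `π_θ(a | s) = exp θ_{s,a} / ∑_{a'} exp θ_{s,a'}`. -/
def softmaxProb (θ : Param S A) (s : S) (a : A) : ℝ :=
  Real.exp (θ (s, a)) / ∑ a' : A, Real.exp (θ (s, a'))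

/-- The softmax tabular policy `π_θ`. -/
def softmaxPolicy (θ : Param S A) : Policy S A := fun s =>
  PMF.ofFintype (fun a => ENNReal.ofReal (softmaxProb θ s a)) (by
    have hpos : 0 < ∑ a' : A, Real.exp (θ (s, a')) :=
      Finset.sum_pos (fun a _ => Real.exp_pos _) Finset.univ_nonempty
    simp only [softmaxProb]
    rw [← ENNReal.ofReal_sum_of_nonneg
      (fun a _ => div_nonneg (Real.exp_pos _).le hpos.le), ← Finset.sum_div, div_self hpos.ne', ENNReal.ofReal_one])

/-- The score `∇_θ log π_θ(a | s)`. -/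
def score (θ : Param S A) (s : S) (a : A) : Param S A :=
  gradient (fun ϑ : Param S A => Real.log (softmaxProb ϑ s a)) θ

/-- `E_{s ∼ Unif_S} [KL(Unif_A, π_θ(· | s))]`. -/
def barrier (θ : Param S A) : ℝ :=
  (1 / (Fintype.card S : ℝ)) * ∑ s : S, ∑ a : A,
    (1 / (Fintype.card A : ℝ)) * Real.log ((1 / (Fintype.card A : ℝ)) / softmaxProb θ s a)

/-- The REINFORCE and GPOMDP estimators `∇̂_m J(θ)` computed on the batch `b` of `m` trajectories
truncated at horizon `H`. -/
def gradEstimate (M : MDP S A) (e : Estimator) {m H : ℕ} (θ : Param S A)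
    (b : Fin m → Fin H → S × A) : Param S A :=
  match e with
  | .reinforce => (1 / (m : ℝ)) • ∑ i : Fin m,
      (∑ t : Fin H, M.γ ^ (t : ℕ) * M.r (b i t).1 (b i t).2) •
        ∑ t' : Fin H, score θ (b i t').1 (b i t').2
  | .gpomdp => (1 / (m : ℝ)) • ∑ i : Fin m, ∑ t : Fin H,
      (M.γ ^ (t : ℕ) * M.r (b i t).1 (b i t).2) •
        ∑ k ∈ Finset.Iic t, score θ (b i k).1 (b i k).2

/-- The estimator `∇̂_m L_λ(θ)` of the gradient of the log-barrier regularized objective. -/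
def regGradEstimate (M : MDP S A) (e : Estimator) (lam : ℝ) {m H : ℕ} (θ : Param S A)
    (b : Fin m → Fin H → S × A) : Param S A :=
  gradEstimate M e θ b +
    (lam / ((Fintype.card A : ℝ) * (Fintype.card S : ℝ))) • ∑ s : S, ∑ a : A, score θ s a

/-- The smoothness constant `L` of `L_λ`. -/
def smoothConst (S A : Type*) [Fintype S] [Fintype A] (γ Rmax lam : ℝ) : ℝ :=
  Rmax / (1 - γ) ^ 2 * (2 - 1 / (Fintype.card A : ℝ)) + lam / (Fintype.card S : ℝ)

/-- The variance constant `ν` of the estimator of the gradient of `L_λ`. -/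
def varConst (S A : Type*) [Fintype S] [Fintype A] (e : Estimator) (H : ℕ) (γ Rmax lam : ℝ) : ℝ :=
  match e with
  | .reinforce => 2 * (1 - 1 / (Fintype.card A : ℝ)) *
      ((H : ℝ) * Rmax ^ 2 / (1 - γ) ^ 2 + lam ^ 2 / (Fintype.card S : ℝ))
  | .gpomdp => 2 * (1 - 1 / (Fintype.card A : ℝ)) *
      (Rmax ^ 2 / (1 - γ) ^ 3 + lam ^ 2 / (Fintype.card S : ℝ))

variable [MeasurableSpace S] [MeasurableSingletonClass S]
  [MeasurableSpace A] [MeasurableSingletonClass A]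

/-- `J(θ) = J(π_θ)`. -/
def softmaxReturn (M : MDP S A) (θ : Param S A) : ℝ := policyReturn M (softmaxPolicy θ)

/-- The optimal expected return `J^* = sup_θ J(θ)`. -/
def optReturn (M : MDP S A) : ℝ := ⨆ θ : Param S A, softmaxReturn M θ

/-- The log-barrier regularized objective
`L_λ(θ) = J(θ) - λ E_{s ∼ Unif_S} [KL(Unif_A, π_θ(· | s))]`. -/
def regReturn (M : MDP S A) (lam : ℝ) (θ : Param S A) : ℝ :=
  softmaxReturn M θ - lam * barrier θ

/-- `L_λ^* = sup_θ L_λ(θ)`. -/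
def optRegReturn (M : MDP S A) (lam : ℝ) : ℝ := ⨆ θ : Param S A, regReturn M lam θ

/-- The law of the iterate `θ_t` of vanilla policy gradient
`θ_{t+1} = θ_t + η ∇̂_m L_λ(θ_t)`, where a fresh batch of `m` independent trajectories of length `H`
is sampled from `π_{θ_t}` at every iteration. -/
def iterateLaw (M : MDP S A) (e : Estimator) (lam η : ℝ) (m H : ℕ) (θ₀ : Param S A) :
    ℕ → PMF (Param S A)
  | 0 => PMF.pure θ₀
  | t + 1 => (iterateLaw M e lam η m H θ₀ t).bind fun θ =>
      (batchLaw M (softmaxPolicy θ) m H).map fun b => θ + η • regGradEstimate M e lam θ b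

/-- The expected return `E[J(θ_t)]` of the `t`-th iterate, whose law has finite support. -/
def expectedReturn (M : MDP S A) (e : Estimator) (lam η : ℝ) (m H : ℕ) (θ₀ : Param S A)
    (t : ℕ) : ℝ :=
  ∑' θ : Param S A, (iterateLaw M e lam η m H θ₀ t θ).toReal * softmaxReturn M θ

/-- The average regret `J^* - (1/T) ∑_{t < T} E[J(θ_t)]`. -/
def averageRegret (M : MDP S A) (e : Estimator) (lam η : ℝ) (m H : ℕ) (θ₀ : Param S A)
    (T : ℕ) : ℝ :=
  optReturn M - (1 / (T : ℝ)) * ∑ t ∈ Finset.range T, expectedReturn M e lam η m H θ₀ t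

end Softmax

end

end PolicyGradient

set_option linter.unusedSectionVars false

namespace PolicyGradient

noncomputable section

/-! Stochastic gradient ascent on a smooth objective reaches small gradients on average, and the log
barrier makes small gradients imply near-optimality. Write g = 1 - γ.

Smoothness: the time-t reward depends on θ only through the law of the first t + 1 pairs, whose
probabilities are products of fixed dynamics and softmax factors. For such a family the Fisher
identity E[l²] = E[w] (`IsScoreFamily.sum_score_sq`) bounds the second derivative of any bounded
expectation along a line. Summing γ^t (t + 1) = 1/g² makes L_λ smooth with a constant at most L
(`regReturn_taylor_le`). The same identity bounds the second moments of both estimators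
(`sum_prefixProb_norm_pathEstimate_sq_le`); their common mean misses the true gradient only by a
truncation error exponentially small in gH.

Gradient domination: if ‖∇L_λ‖ ≤ λ/(2|S||A|), every coordinate bounds an advantage by λ/(|S|ρ(s)),
and the performance difference lemma gives a gap of at most λD*/g = ε/2
(`policyReturn_sub_le_of_norm_regGrad_le`). When the gradient is larger, the trivial gap 2R/g is at
most 2R/g times (‖∇L_λ‖/threshold)². Adding both cases bounds the regret pointwise by ε/2 plus a
constant times ‖∇L_λ‖²/(g³ε²) (`optReturn_sub_le`). It therefore suffices that the average of
E‖∇L_λ‖² be of order g³ε³. The step size and the condition on Tm make the noise and optimization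
terms each at most g³ε³/2, and the horizon makes the squared bias at most R²g³ε³
(`averageRegret_le_of_step_size`).

The one batch size outside this argument, m = 1 above 2ν/(g³ε³), forces R²/g to be so small that the
trivial bound is already O(ε). The size estimates are arithmetic (`parameter_sizes`). -/

lemma stateAction_apply {S A : Type*} (p : PMF S) (π : Policy S A) (x : S × A) :
    stateAction p π x = p x.1 * π x.1 x.2 := by
  classical
  obtain ⟨s, a⟩ := x
  simp only [stateAction, PMF.bind_apply, PMF.map_apply]
  rw [tsum_eq_single s]
  · rw [tsum_eq_single a]
    · simp
    · intro b hb
      simp [hb.symm]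
  · intro t ht
    simp [ht.symm]

/-! ### Laws of finite trajectory prefixes, discounted sums and visitation distributions -/

section Prefix

variable {S A : Type*} [Fintype S] [MeasurableSpace S] [MeasurableSingletonClass S]
  [Fintype A] [MeasurableSpace A] [MeasurableSingletonClass A]

/-- The one-step transition probability between state-action pairs. -/
def stepProb (M : MDP S A) (π : Policy S A) (x y : S × A) : ℝ :=
  (M.P x.1 x.2 y.1).toReal * (π y.1 y.2).toReal

/-- The law of the first n + 2 coordinates is the composition-product of the law of the first n + 1
with the step kernel; this is that identity evaluated on B × {y}. It is the only place where the
kernel construction is used beyond time 0. -/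
lemma trajLaw_succ_real (M : MDP S A) (π : Policy S A) (n : ℕ)
    (B : Set ((i : Finset.Iic n) → S × A)) (y : S × A) :
    (trajLaw M π).real {σ | Preorder.frestrictLe (π := fun _ => S × A) n σ ∈ B ∧ σ (n + 1) = y} =
      ∫ σ in {σ | Preorder.frestrictLe (π := fun _ => S × A) n σ ∈ B},
        stepProb M π (σ n) y ∂(trajLaw M π) := by
  have := PMF.toMeasure.isProbabilityMeasure (stateAction M.ρ π)
  have hB : MeasurableSet B := (Set.toFinite B).measurableSet
  have key := Kernel.map_frestrictLe_trajMeasure_compProd_eq_map_trajMeasure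
    (X := fun _ => S × A) (μ₀ := (stateAction M.ρ π).toMeasure) (κ := stepKernel M π) (a := n)
  have h1 := congrArg (fun μ => μ (B ×ˢ {y})) key
  rw [Measure.compProd_apply_prod hB (measurableSet_singleton y),
    Measure.map_apply (by fun_prop) (hB.prod (measurableSet_singleton y)),
    setLIntegral_map hB (Kernel.measurable_coe _ (measurableSet_singleton y)) (by fun_prop)] at h1
  have h2 : ∀ σ : ℕ → S × A, (stepKernel M π n) (Preorder.frestrictLe n σ) {y} =
      ENNReal.ofReal (stepProb M π (σ n) y) := by
    intro σ
    change (stateAction (M.P (σ n).1 (σ n).2) π).toMeasure {y} = _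
    rw [PMF.toMeasure_apply_singleton _ _ (measurableSet_singleton y), stateAction_apply, stepProb,
      ← ENNReal.toReal_mul, ENNReal.ofReal_toReal]
    exact ENNReal.mul_ne_top (PMF.apply_ne_top _ _) (PMF.apply_ne_top _ _)
  simp only [h2] at h1
  rw [integral_eq_lintegral_of_nonneg_ae]
  · rw [Measure.real]
    congr 1
    exact h1.symm
  · exact Filter.Eventually.of_forall fun σ => mul_nonneg ENNReal.toReal_nonneg ENNReal.toReal_nonneg
  · exact ((measurable_of_finite (fun x => stepProb M π x y)).comp
      (measurable_pi_apply n)).aestronglyMeasurable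

lemma trajLaw_zero_real (M : MDP S A) (π : Policy S A) (y : S × A) :
    (trajLaw M π).real {σ | σ 0 = y} = (M.ρ y.1).toReal * (π y.1 y.2).toReal := by
  have := PMF.toMeasure.isProbabilityMeasure (stateAction M.ρ π)
  have hmap : (trajLaw M π).map (fun σ => σ 0) = (stateAction M.ρ π).toMeasure := by
    have h0 : (fun σ : ℕ → S × A => σ 0) =
      (fun g : (i : Finset.Iic 0) → S × A => g ⟨0, by simp⟩) ∘ Preorder.frestrictLe (π := fun _ => S × A) 0 := rfl
    rw [h0, ← Measure.map_map (by fun_prop) (by fun_prop), trajLaw, Kernel.trajMeasure,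
      Measure.map_comp _ _ (by fun_prop), Kernel.traj_map_frestrictLe, Kernel.partialTraj_self,
      Measure.id_comp, Measure.map_map (by fun_prop) (by fun_prop)]
    exact Measure.map_id
  have : (trajLaw M π).real {σ | σ 0 = y} = ((trajLaw M π).map (fun σ => σ 0)).real {y} := by
    rw [map_measureReal_apply (by fun_prop) (measurableSet_singleton y)]
    rfl
  rw [this, hmap, Measure.real, PMF.toMeasure_apply_singleton _ _ (measurableSet_singleton y),
    stateAction_apply, ENNReal.toReal_mul]

lemma frestrictLe_mem_iff (n : ℕ) (τ σ : ℕ → S × A) :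
    Preorder.frestrictLe (π := fun _ => S × A) n σ ∈
      ({Preorder.frestrictLe n τ} : Set ((i : Finset.Iic n) → S × A)) ↔
      ∀ k < n + 1, σ k = τ k := by
  rw [Set.mem_singleton_iff, funext_iff]
  constructor
  · intro h k hk
    exact h ⟨k, Finset.mem_Iic.2 (Nat.lt_succ_iff.1 hk)⟩
  · rintro h ⟨k, hk⟩
    exact h k (Nat.lt_succ_iff.2 (Finset.mem_Iic.1 hk))

/-- The policy-independent factor of the probability of the `k`-th step of a trajectory. -/
def dynamicsProb (M : MDP S A) (τ : ℕ → S × A) : ℕ → ℝ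
  | 0 => (M.ρ (τ 0).1).toReal
  | k + 1 => (M.P (τ k).1 (τ k).2 (τ (k + 1)).1).toReal

lemma dynamicsProb_nonneg (M : MDP S A) (τ : ℕ → S × A) (k : ℕ) : 0 ≤ dynamicsProb M τ k := by
  cases k <;> exact ENNReal.toReal_nonneg

lemma trajLaw_real_prefix (M : MDP S A) (π : Policy S A) (τ : ℕ → S × A) (n : ℕ) :
    (trajLaw M π).real {σ | ∀ k < n, σ k = τ k} =
      ∏ k ∈ Finset.range n, dynamicsProb M τ k * (π (τ k).1 (τ k).2).toReal := by
  induction n with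
  | zero => simp
  | succ n ih =>
    rw [Finset.prod_range_succ]
    cases n with
    | zero => simpa [dynamicsProb] using trajLaw_zero_real M π (τ 0)
    | succ n =>
      rw [← ih]
      have h := trajLaw_succ_real M π n {Preorder.frestrictLe n τ} (τ (n + 1))
      simp only [frestrictLe_mem_iff] at h
      have hset : {σ : ℕ → S × A | ∀ k < n + 1 + 1, σ k = τ k} =
          {σ | (∀ k < n + 1, σ k = τ k) ∧ σ (n + 1) = τ (n + 1)} := by
        ext σ
        simp only [Set.mem_ofPred_eq]
        constructor
        · exact fun h => ⟨fun k hk => h k (by omega), h _ (by omega)⟩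
        · rintro ⟨h1, h2⟩ k hk
          rcases Nat.lt_succ_iff_lt_or_eq.1 hk with hk | rfl
          · exact h1 k hk
          · exact h2
      have hmeas : MeasurableSet {σ : ℕ → S × A | ∀ k < n + 1, σ k = τ k} := by
        have : {σ : ℕ → S × A | ∀ k < n + 1, σ k = τ k} =
            Preorder.frestrictLe (π := fun _ => S × A) n ⁻¹' {Preorder.frestrictLe n τ} := by
          ext σ
          exact (frestrictLe_mem_iff n τ σ).symm
        rw [this]
        exact measurableSet_preimage (by fun_prop) (measurableSet_singleton _)
      -- On the prefix event σ n = τ n, so the transition probability is constant there and factors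
      -- out.
      rw [hset, h, setIntegral_congr_fun (g := fun _ => stepProb M π (τ n) (τ (n + 1))) hmeas
        (fun σ hσ => by
          have h3 : σ n = τ n := hσ n (Nat.lt_succ_self n)
          simp only [h3]), setIntegral_const, smul_eq_mul]
      rfl

variable [Nonempty S] [Nonempty A]

/-- Extension of a finite trajectory to an infinite one. -/
def extendPath {n : ℕ} (h : Fin n → S × A) (k : ℕ) : S × A :=
  -- The default beyond n never matters: `dynamicsWeight` only reads times below n.
  if hk : k < n then h ⟨k, hk⟩ else Classical.arbitrary _

/-- The policy-independent factor of the probability of a finite trajectory. -/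
def dynamicsWeight (M : MDP S A) {n : ℕ} (h : Fin n → S × A) : ℝ :=
  ∏ k : Fin n, dynamicsProb M (extendPath h) k

/-- The probability that a trajectory starts with the finite trajectory `h`. -/
def prefixProb (M : MDP S A) (π : Policy S A) {n : ℕ} (h : Fin n → S × A) : ℝ :=
  dynamicsWeight M h * ∏ k, (π (h k).1 (h k).2).toReal

lemma dynamicsWeight_nonneg (M : MDP S A) {n : ℕ} (h : Fin n → S × A) :
    0 ≤ dynamicsWeight M h :=
  Finset.prod_nonneg fun _ _ => dynamicsProb_nonneg _ _ _

lemma prefixProb_nonneg (M : MDP S A) (π : Policy S A) {n : ℕ} (h : Fin n → S × A) :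
    0 ≤ prefixProb M π h :=
  mul_nonneg (dynamicsWeight_nonneg M h) (Finset.prod_nonneg fun _ _ => ENNReal.toReal_nonneg)

lemma trajLaw_real_eq_prefixProb (M : MDP S A) (π : Policy S A) {n : ℕ} (h : Fin n → S × A) :
    (trajLaw M π).real {σ | (fun k : Fin n => σ k) = h} = prefixProb M π h := by
  have hset : {σ : ℕ → S × A | (fun k : Fin n => σ k) = h} =
      {σ | ∀ k < n, σ k = extendPath h k} := by
    ext σ
    simp only [Set.mem_ofPred_eq, funext_iff]
    constructor
    · intro hσ k hk
      simpa [extendPath, hk] using hσ ⟨k, hk⟩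
    · intro hσ k
      simpa [extendPath] using hσ k k.2
  rw [hset, trajLaw_real_prefix, Finset.prod_range, prefixProb, dynamicsWeight,
    ← Finset.prod_mul_distrib]
  refine Finset.prod_congr rfl fun k _ => ?_
  have : extendPath h k = h k := by simp [extendPath]
  rw [this]

/-- Expectations become finite sums, so that differentiation in θ can be done term by term. -/
lemma integral_prefix (M : MDP S A) (π : Policy S A) {n : ℕ} (F : (Fin n → S × A) → ℝ) :
    ∫ σ, F (fun k : Fin n => σ k) ∂(trajLaw M π) = ∑ h, prefixProb M π h * F h := by
  classical
  have hm : Measurable fun (σ : ℕ → S × A) (k : Fin n) => σ k :=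
    measurable_pi_lambda _ fun k => measurable_pi_apply _
  have : IsProbabilityMeasure ((trajLaw M π).map fun (σ : ℕ → S × A) (k : Fin n) => σ k) :=
    Measure.isProbabilityMeasure_map hm.aemeasurable
  rw [← integral_map (φ := fun (σ : ℕ → S × A) (k : Fin n) => σ k) (f := F) hm.aemeasurable
    (measurable_of_finite F).aestronglyMeasurable, integral_fintype .of_finite]
  refine Finset.sum_congr rfl fun h _ => ?_
  rw [map_measureReal_apply hm (measurableSet_singleton h), ← trajLaw_real_eq_prefixProb, smul_eq_mul]
  rfl

lemma sum_prefixProb (M : MDP S A) (π : Policy S A) (n : ℕ) :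
    ∑ h : Fin n → S × A, prefixProb M π h = 1 := by
  have := integral_prefix M π (fun _ : Fin n → S × A => (1 : ℝ))
  simpa using this.symm

/-- Consistency of the prefix laws is free: both sums are the same integral against the infinite
trajectory law. -/
lemma sum_prefixProb_castLE (M : MDP S A) (π : Policy S A) {n N : ℕ} (hn : n ≤ N)
    (F : (Fin n → S × A) → ℝ) :
    ∑ h : Fin N → S × A, prefixProb M π h * F (fun k => h (Fin.castLE hn k)) =
      ∑ h, prefixProb M π h * F h :=
  (integral_prefix M π (fun h : Fin N → S × A => F (fun k => h (Fin.castLE hn k)))).symm.trans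
    (integral_prefix M π F)

lemma batchLaw_apply (M : MDP S A) (π : Policy S A) {m H : ℕ} (b : Fin m → Fin H → S × A) :
    (batchLaw M π m H b).toReal = ∏ i, prefixProb M π (b i) := by
  have hm : Measurable fun (τ : Fin m → ℕ → S × A) (i : Fin m) (t : Fin H) => τ i t :=
    measurable_pi_lambda _ fun i =>
      measurable_pi_lambda _ fun t => (measurable_pi_apply (t : ℕ)).comp (measurable_pi_apply i)
  rw [batchLaw, Measure.toPMF_apply, Measure.map_apply hm (measurableSet_singleton b)]
  have : (fun (τ : Fin m → ℕ → S × A) (i : Fin m) (t : Fin H) => τ i t) ⁻¹' {b} =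
      Set.univ.pi fun i => {σ : ℕ → S × A | (fun t : Fin H => σ t) = b i} := by
    ext τ
    simp [funext_iff, Set.mem_pi]
  rw [this, Measure.pi_pi, ENNReal.toReal_prod]
  exact Finset.prod_congr rfl fun i _ => trajLaw_real_eq_prefixProb M π (b i)

/-- The probability that the `t`-th state-action pair of a trajectory is `x`. -/
def pairProb (M : MDP S A) (π : Policy S A) (t : ℕ) (x : S × A) : ℝ :=
  (trajLaw M π).real {σ | σ t = x}

/-- The probability that the `t`-th state of a trajectory is `s`. -/
def stateProb (M : MDP S A) (π : Policy S A) (t : ℕ) (s : S) : ℝ :=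
  (trajLaw M π).real {σ | (σ t).1 = s}

lemma integral_pair (M : MDP S A) (π : Policy S A) (t : ℕ) (f : S × A → ℝ) :
    ∫ σ, f (σ t) ∂(trajLaw M π) = ∑ x, pairProb M π t x * f x := by
  have hm : Measurable fun σ : ℕ → S × A => σ t := measurable_pi_apply _
  have : IsProbabilityMeasure ((trajLaw M π).map fun σ : ℕ → S × A => σ t) :=
    Measure.isProbabilityMeasure_map hm.aemeasurable
  rw [← integral_map (φ := fun σ : ℕ → S × A => σ t) (f := f) hm.aemeasurable
    (measurable_of_finite f).aestronglyMeasurable, integral_fintype .of_finite]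
  refine Finset.sum_congr rfl fun x _ => ?_
  rw [map_measureReal_apply hm (measurableSet_singleton x), smul_eq_mul]
  rfl

lemma sum_pairProb_mul_eq_prefix (M : MDP S A) (π : Policy S A) (t : ℕ) (f : S × A → ℝ) :
    ∑ x, pairProb M π t x * f x =
      ∑ h : Fin (t + 1) → S × A, prefixProb M π h * f (h (Fin.last t)) :=
  (integral_pair M π t f).symm.trans
    (integral_prefix M π fun h : Fin (t + 1) → S × A => f (h (Fin.last t)))

lemma pairProb_nonneg (M : MDP S A) (π : Policy S A) (t : ℕ) (x : S × A) :
    0 ≤ pairProb M π t x := measureReal_nonneg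

lemma sum_pairProb (M : MDP S A) (π : Policy S A) (t : ℕ) : ∑ x, pairProb M π t x = 1 := by
  have := integral_pair M π t (fun _ => (1 : ℝ))
  simpa using this.symm

lemma pairProb_succ (M : MDP S A) (π : Policy S A) (t : ℕ) (y : S × A) :
    pairProb M π (t + 1) y = ∑ x, pairProb M π t x * stepProb M π x y := by
  have h := trajLaw_succ_real M π t Set.univ y
  simp only [Set.mem_univ, true_and] at h
  rw [pairProb, h, ← integral_pair M π t (fun x => stepProb M π x y)]
  simp

lemma sum_policy (π : Policy S A) (s : S) : ∑ a, (π s a).toReal = 1 := by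
  rw [← ENNReal.toReal_sum fun a _ => PMF.apply_ne_top _ _, ← tsum_fintype (L := .unconditional _),
    PMF.tsum_coe, ENNReal.toReal_one]

lemma stateProb_eq_sum (M : MDP S A) (π : Policy S A) (t : ℕ) (s : S) :
    stateProb M π t s = ∑ a, pairProb M π t (s, a) := by
  classical
  have h := integral_pair M π t (fun x => if x.1 = s then (1 : ℝ) else 0)
  have h1 : ∫ σ, (if (σ t).1 = s then (1 : ℝ) else 0) ∂(trajLaw M π) = stateProb M π t s := by
    have hmeas : MeasurableSet {σ : ℕ → S × A | (σ t).1 = s} :=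
      (measurable_fst.comp (measurable_pi_apply t)) (measurableSet_singleton s)
    rw [stateProb, ← integral_indicator_one hmeas]
    refine integral_congr_ae (Filter.Eventually.of_forall fun σ => ?_)
    simp [Set.indicator_apply]
  rw [← h1, h, Fintype.sum_prod_type]
  rw [Finset.sum_eq_single s]
  · simp
  · intro s' _ hs
    simp [hs]
  · simp

lemma pairProb_zero_eq (M : MDP S A) (π : Policy S A) (y : S × A) :
    pairProb M π 0 y = (M.ρ y.1).toReal * (π y.1 y.2).toReal := trajLaw_zero_real M π y

lemma stateProb_zero (M : MDP S A) (π : Policy S A) (s : S) :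
    stateProb M π 0 s = (M.ρ s).toReal := by
  simp [stateProb_eq_sum, pairProb_zero_eq, ← Finset.mul_sum, sum_policy]

lemma stateProb_succ (M : MDP S A) (π : Policy S A) (t : ℕ) (s : S) :
    stateProb M π (t + 1) s = ∑ x, pairProb M π t x * (M.P x.1 x.2 s).toReal := by
  simp only [stateProb_eq_sum, pairProb_succ, stepProb]
  rw [Finset.sum_comm]
  refine Finset.sum_congr rfl fun x _ => ?_
  rw [← Finset.mul_sum, ← Finset.mul_sum, sum_policy, mul_one]

/-- At every time the action is drawn from π given the current state alone; this is what lets a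
discounted sum be rewritten through the state visitation distribution. -/
lemma pairProb_eq (M : MDP S A) (π : Policy S A) (t : ℕ) (y : S × A) :
    pairProb M π t y = stateProb M π t y.1 * (π y.1 y.2).toReal := by
  cases t with
  | zero => rw [pairProb_zero_eq, stateProb_zero]
  | succ t =>
    rw [pairProb_succ, stateProb_succ, Finset.sum_mul]
    exact Finset.sum_congr rfl fun x _ => by rw [stepProb]; ring

lemma stateProb_nonneg (M : MDP S A) (π : Policy S A) (t : ℕ) (s : S) :
    0 ≤ stateProb M π t s := measureReal_nonneg

lemma stateProb_le_one (M : MDP S A) (π : Policy S A) (t : ℕ) (s : S) :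
    stateProb M π t s ≤ 1 := measureReal_le_one

lemma abs_sum_pairProb_mul_le (M : MDP S A) (π : Policy S A) (t : ℕ) {f : S × A → ℝ} {R : ℝ}
    (hf : ∀ x, |f x| ≤ R) : |∑ x, pairProb M π t x * f x| ≤ R := by
  refine (Finset.abs_sum_le_sum_abs _ _).trans ?_
  calc ∑ x, |pairProb M π t x * f x| ≤ ∑ x, pairProb M π t x * R := by
        refine Finset.sum_le_sum fun x _ => ?_
        rw [abs_mul, abs_of_nonneg (pairProb_nonneg M π t x)]
        exact mul_le_mul_of_nonneg_left (hf x) (pairProb_nonneg M π t x)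
    _ = R := by rw [← Finset.sum_mul, sum_pairProb, one_mul]

/-- The expected discounted sum of `f (s_t, a_t)`. -/
def discountedSum (M : MDP S A) (π : Policy S A) (f : S × A → ℝ) : ℝ :=
  ∑' t : ℕ, M.γ ^ t * ∑ x, pairProb M π t x * f x

lemma summable_pow_mul_of_abs_le {γ : ℝ} (h0 : 0 ≤ γ) (h1 : γ < 1) {u : ℕ → ℝ} {R : ℝ}
    (hu : ∀ t, |u t| ≤ R) : Summable fun t => γ ^ t * u t := by
  refine Summable.of_norm_bounded ((summable_geometric_of_lt_one h0 h1).mul_right R) fun t => ?_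
  rw [norm_mul, Real.norm_eq_abs, Real.norm_eq_abs, abs_of_nonneg (pow_nonneg h0 t)]
  exact mul_le_mul_of_nonneg_left (hu t) (pow_nonneg h0 t)

lemma exists_abs_le {ι : Type*} [Finite ι] (f : ι → ℝ) : ∃ R, 0 ≤ R ∧ ∀ x, |f x| ≤ R := by
  obtain ⟨R, hR⟩ := (Set.finite_range fun x => |f x|).bddAbove
  exact ⟨max R 0, le_max_right _ _, fun x => (hR ⟨x, rfl⟩).trans (le_max_left _ _)⟩

lemma hasSum_discountedSum (M : MDP S A) (π : Policy S A) (f : S × A → ℝ) :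
    HasSum (fun t : ℕ => M.γ ^ t * ∑ x, pairProb M π t x * f x) (discountedSum M π f) := by
  obtain ⟨R, -, hR⟩ := exists_abs_le f
  exact (summable_pow_mul_of_abs_le M.γ_nonneg M.γ_lt_one
    fun t => abs_sum_pairProb_mul_le M π t hR).hasSum

lemma policyReturn_eq (M : MDP S A) (π : Policy S A) :
    policyReturn M π = discountedSum M π fun x => M.r x.1 x.2 := by
  obtain ⟨R, hR0, hR⟩ := exists_abs_le fun x : S × A => M.r x.1 x.2
  have hmeas : ∀ t : ℕ, Measurable fun σ : ℕ → S × A => M.γ ^ t * M.r (σ t).1 (σ t).2 := fun t =>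
    ((measurable_of_finite fun x : S × A => M.r x.1 x.2).comp
      (measurable_pi_apply t)).const_mul (M.γ ^ t)
  have hbd : ∀ (t : ℕ) (σ : ℕ → S × A), ‖M.γ ^ t * M.r (σ t).1 (σ t).2‖ ≤ M.γ ^ t * R := by
    intro t σ
    rw [norm_mul, Real.norm_eq_abs, Real.norm_eq_abs, abs_of_nonneg (pow_nonneg M.γ_nonneg t)]
    exact mul_le_mul_of_nonneg_left (hR (σ t)) (pow_nonneg M.γ_nonneg t)
  have hint : ∀ t : ℕ, Integrable (fun σ : ℕ → S × A => M.γ ^ t * M.r (σ t).1 (σ t).2)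
      (trajLaw M π) := fun t =>
    Integrable.of_bound (hmeas t).aestronglyMeasurable _ (Filter.Eventually.of_forall (hbd t))
  have hsum := hasSum_integral_of_summable_integral_norm hint (by
    refine Summable.of_nonneg_of_le (fun t => integral_nonneg fun σ => norm_nonneg _) (fun t => ?_)
      ((summable_geometric_of_lt_one M.γ_nonneg M.γ_lt_one).mul_right R)
    calc ∫ σ, ‖M.γ ^ t * M.r (σ t).1 (σ t).2‖ ∂(trajLaw M π)
        ≤ ∫ _, M.γ ^ t * R ∂(trajLaw M π) :=
          integral_mono (hint t).norm (integrable_const _) (hbd t)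
      _ = M.γ ^ t * R := by simp)
  rw [policyReturn, ← hsum.tsum_eq, discountedSum]
  refine tsum_congr fun t => ?_
  rw [integral_const_mul, integral_pair M π t fun x => M.r x.1 x.2]

lemma visitation_eq_stateProb (M : MDP S A) (π : Policy S A) (s : S) :
    visitation M π s = (1 - M.γ) * ∑' t : ℕ, M.γ ^ t * stateProb M π t s := rfl

lemma summable_stateProb (M : MDP S A) (π : Policy S A) (s : S) :
    Summable fun t : ℕ => M.γ ^ t * stateProb M π t s :=
  summable_pow_mul_of_abs_le M.γ_nonneg M.γ_lt_one fun t =>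
    (abs_of_nonneg (stateProb_nonneg M π t s)).trans_le (stateProb_le_one M π t s)

lemma discountedSum_eq_visitation (M : MDP S A) (π : Policy S A) (f : S × A → ℝ) :
    (1 - M.γ) * discountedSum M π f =
      ∑ s, visitation M π s * ∑ a, (π s a).toReal * f (s, a) := by
  have h : ∀ s, HasSum (fun t : ℕ => M.γ ^ t * stateProb M π t s * ∑ a, (π s a).toReal * f (s, a))
      ((∑' t : ℕ, M.γ ^ t * stateProb M π t s) * ∑ a, (π s a).toReal * f (s, a)) := fun s =>
    (summable_stateProb M π s).hasSum.mul_right _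
  have h2 := hasSum_sum (s := Finset.univ) fun s _ => h s
  have h3 : discountedSum M π f =
      ∑ s, (∑' t : ℕ, M.γ ^ t * stateProb M π t s) * ∑ a, (π s a).toReal * f (s, a) := by
    rw [← h2.tsum_eq, discountedSum]
    refine tsum_congr fun t => ?_
    rw [Fintype.sum_prod_type, Finset.mul_sum]
    refine Finset.sum_congr rfl fun s _ => ?_
    simp only [pairProb_eq, Finset.mul_sum]
    exact Finset.sum_congr rfl fun a _ => by ring
  rw [h3, Finset.mul_sum]
  exact Finset.sum_congr rfl fun s _ => by rw [visitation_eq_stateProb]; ring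

lemma visitation_nonneg (M : MDP S A) (π : Policy S A) (s : S) : 0 ≤ visitation M π s :=
  mul_nonneg (sub_nonneg.2 M.γ_lt_one.le) (tsum_nonneg fun t =>
    mul_nonneg (pow_nonneg M.γ_nonneg t) (stateProb_nonneg M π t s))

/-- The flow equation of the discounted visitation distribution. -/
lemma visitation_flow (M : MDP S A) (π : Policy S A) (s : S) :
    visitation M π s = (1 - M.γ) * (M.ρ s).toReal +
      M.γ * ∑ s', visitation M π s' * ∑ a, (π s' a).toReal * (M.P s' a s).toReal := by
  -- The flow term is the discounted sum of next-state probabilities, i.e. the visitation series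
  -- with its time-0 term split off and the index shifted.
  rw [← discountedSum_eq_visitation M π fun x => (M.P x.1 x.2 s).toReal, visitation_eq_stateProb,
    (summable_stateProb M π s).tsum_eq_zero_add, stateProb_zero, discountedSum]
  simp only [stateProb_succ, pow_succ', mul_assoc, tsum_mul_left]
  ring

/-- The time-0 contribution alone. This is how full support of ρ gives every state a visitation
bounded below uniformly in the policy. -/
lemma le_visitation (M : MDP S A) (π : Policy S A) (s : S) :
    (1 - M.γ) * (M.ρ s).toReal ≤ visitation M π s := by
  rw [visitation_flow]
  refine le_add_of_nonneg_right (mul_nonneg M.γ_nonneg (Finset.sum_nonneg fun s' _ =>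
    mul_nonneg (visitation_nonneg M π s') (Finset.sum_nonneg fun a _ =>
      mul_nonneg ENNReal.toReal_nonneg ENNReal.toReal_nonneg)))

lemma discountedSum_const (M : MDP S A) (π : Policy S A) (c : ℝ) :
    (1 - M.γ) * discountedSum M π (fun _ => c) = c := by
  have h : (1 - M.γ) ≠ 0 := (sub_pos.2 M.γ_lt_one).ne'
  simp only [discountedSum, ← Finset.sum_mul, sum_pairProb, one_mul, tsum_mul_right,
    tsum_geometric_of_lt_one M.γ_nonneg M.γ_lt_one]
  field_simp

lemma sum_visitation (M : MDP S A) (π : Policy S A) : ∑ s, visitation M π s = 1 := by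
  have := discountedSum_eq_visitation M π fun _ => (1 : ℝ)
  simpa [discountedSum_const, sum_policy] using this.symm

end Prefix

/-! ### Softmax derivatives along lines, and variance bounds -/

section Softmax

variable {S A : Type*} [Fintype S] [Fintype A] [Nonempty A]

lemma sum_exp_pos (θ : Param S A) (s : S) : 0 < ∑ a, Real.exp (θ (s, a)) :=
  Finset.sum_pos (fun _ _ => Real.exp_pos _) Finset.univ_nonempty

lemma softmaxProb_pos (θ : Param S A) (s : S) (a : A) : 0 < softmaxProb θ s a :=
  div_pos (Real.exp_pos _) (sum_exp_pos θ s)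

lemma sum_softmaxProb (θ : Param S A) (s : S) : ∑ a, softmaxProb θ s a = 1 := by
  simp only [softmaxProb]
  rw [← Finset.sum_div, div_self (sum_exp_pos θ s).ne']

lemma softmaxPolicy_toReal (θ : Param S A) (s : S) (a : A) :
    (softmaxPolicy θ s a).toReal = softmaxProb θ s a := by
  simp [softmaxPolicy, ENNReal.toReal_ofReal (softmaxProb_pos θ s a).le]

/-- The mean of the direction `v` at state `s` under the softmax policy. -/
def softmaxMean (θ v : Param S A) (s : S) : ℝ := ∑ a, softmaxProb θ s a * v (s, a)

/-- The variance of the direction `v` at state `s` under the softmax policy. -/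
def softmaxVar (θ v : Param S A) (s : S) : ℝ :=
  ∑ a, softmaxProb θ s a * (v (s, a) - softmaxMean θ v s) ^ 2

lemma log_softmaxProb (θ : Param S A) (s : S) (a : A) :
    Real.log (softmaxProb θ s a) = θ (s, a) - Real.log (∑ b, Real.exp (θ (s, b))) := by
  rw [softmaxProb, Real.log_div (Real.exp_pos _).ne' (sum_exp_pos θ s).ne', Real.log_exp]

lemma hasFDerivAt_log_softmaxProb (θ : Param S A) (s : S) (a : A) :
    HasFDerivAt (fun ϑ : Param S A => Real.log (softmaxProb ϑ s a))
      ((EuclideanSpace.proj (s, a) : Param S A →L[ℝ] ℝ) -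
        ∑ b, softmaxProb θ s b • (EuclideanSpace.proj (s, b) : Param S A →L[ℝ] ℝ)) θ := by
  have hp : ∀ x : S × A, HasFDerivAt (fun ϑ : Param S A => ϑ x)
      (EuclideanSpace.proj x : Param S A →L[ℝ] ℝ) θ := fun x =>
    (EuclideanSpace.proj x : Param S A →L[ℝ] ℝ).hasFDerivAt
  have hs : HasFDerivAt (fun ϑ : Param S A => ∑ b, Real.exp (ϑ (s, b)))
      (∑ b, Real.exp (θ (s, b)) • (EuclideanSpace.proj (s, b) : Param S A →L[ℝ] ℝ)) θ :=
    HasFDerivAt.fun_sum fun b _ => (hp (s, b)).exp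
  have h := (hp (s, a)).fun_sub (hs.log (sum_exp_pos θ s).ne')
  simp only [log_softmaxProb]
  refine h.congr_fderiv ?_
  congr 1
  rw [Finset.smul_sum]
  refine Finset.sum_congr rfl fun b _ => ?_
  rw [smul_smul, softmaxProb, div_eq_inv_mul]

lemma inner_score (θ v : Param S A) (s : S) (a : A) :
    inner ℝ (score θ s a) v = v (s, a) - softmaxMean θ v s := by
  rw [score, gradient, InnerProductSpace.toDual_symm_apply,
    (hasFDerivAt_log_softmaxProb θ s a).fderiv]
  simp [softmaxMean]

lemma hasDerivAt_line (θ v : Param S A) (x : ℝ) :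
    HasDerivAt (fun y : ℝ => θ + y • v) v x := by
  simpa using ((hasDerivAt_id x).smul_const v).const_add θ

lemma hasDerivAt_log_softmaxProb (θ v : Param S A) (s : S) (a : A) (x : ℝ) :
    HasDerivAt (fun y : ℝ => Real.log (softmaxProb (θ + y • v) s a))
      (v (s, a) - softmaxMean (θ + x • v) v s) x := by
  have h := (hasFDerivAt_log_softmaxProb (θ + x • v) s a).comp_hasDerivAt x (hasDerivAt_line θ v x)
  refine h.congr_deriv ?_
  simp [softmaxMean]

lemma hasDerivAt_softmaxProb (θ v : Param S A) (s : S) (a : A) (x : ℝ) :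
    HasDerivAt (fun y : ℝ => softmaxProb (θ + y • v) s a)
      (softmaxProb (θ + x • v) s a * (v (s, a) - softmaxMean (θ + x • v) v s)) x := by
  have h := (hasDerivAt_log_softmaxProb θ v s a x).exp
  simpa only [Real.exp_log (softmaxProb_pos _ s a)] using h

lemma softmaxVar_eq (θ v : Param S A) (s : S) :
    softmaxVar θ v s = ∑ a, softmaxProb θ s a * v (s, a) ^ 2 - softmaxMean θ v s ^ 2 := by
  have h : ∀ a, softmaxProb θ s a * (v (s, a) - softmaxMean θ v s) ^ 2 =
      softmaxProb θ s a * v (s, a) ^ 2 - 2 * softmaxMean θ v s * (softmaxProb θ s a * v (s, a)) +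
        softmaxMean θ v s ^ 2 * softmaxProb θ s a := fun a => by ring
  simp only [softmaxVar, h, Finset.sum_add_distrib, Finset.sum_sub_distrib, ← Finset.mul_sum,
    sum_softmaxProb]
  rw [show ∑ a, softmaxProb θ s a * v (s, a) = softmaxMean θ v s from rfl]
  ring

/-- As in any exponential family, the derivative of the mean in its own direction is the variance.
-/
lemma hasDerivAt_softmaxMean (θ v : Param S A) (s : S) (x : ℝ) :
    HasDerivAt (fun y : ℝ => softmaxMean (θ + y • v) v s) (softmaxVar (θ + x • v) v s) x := by
  have h := HasDerivAt.fun_sum (u := Finset.univ) fun a _ =>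
    (hasDerivAt_softmaxProb θ v s a x).mul_const (v (s, a))
  refine h.congr_deriv ?_
  rw [softmaxVar_eq, pow_two (softmaxMean _ _ _)]
  nth_rw 2 [softmaxMean]
  rw [Finset.sum_mul, ← Finset.sum_sub_distrib]
  exact Finset.sum_congr rfl fun a _ => by ring

lemma softmaxVar_nonneg (θ v : Param S A) (s : S) : 0 ≤ softmaxVar θ v s :=
  Finset.sum_nonneg fun a _ => mul_nonneg (softmaxProb_pos θ s a).le (sq_nonneg _)

lemma softmaxVar_le_sum (θ v : Param S A) (s : S) :
    softmaxVar θ v s ≤ ∑ a, softmaxProb θ s a * v (s, a) ^ 2 := by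
  rw [softmaxVar_eq]
  linarith [sq_nonneg (softmaxMean θ v s)]

/-- Twice the variance is the mean of (v_a - v_b)² over independent pairs. The diagonal vanishes, (x
- y)² ≤ 2x² + 2y² off it, and the resulting weights 4p(1 - p) are at most 1. The factor 1/2 gained
over `softmaxVar_le_sum` feeds the smoothness constants. -/
lemma softmaxVar_le (θ v : Param S A) (s : S) :
    softmaxVar θ v s ≤ (∑ a, v (s, a) ^ 2) / 2 := by
  classical
  have hp := fun a => (softmaxProb_pos θ s a).le
  have h1 : 2 * softmaxVar θ v s = ∑ a, ∑ b,
      softmaxProb θ s a * softmaxProb θ s b * (v (s, a) - v (s, b)) ^ 2 := by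
    have h : ∀ a b, softmaxProb θ s a * softmaxProb θ s b * (v (s, a) - v (s, b)) ^ 2 =
        softmaxProb θ s a * v (s, a) ^ 2 * softmaxProb θ s b +
        softmaxProb θ s a * (softmaxProb θ s b * v (s, b) ^ 2) -
        2 * (softmaxProb θ s a * v (s, a)) * (softmaxProb θ s b * v (s, b)) := fun a b => by ring
    simp only [h, Finset.sum_add_distrib, Finset.sum_sub_distrib, ← Finset.mul_sum,
      ← Finset.sum_mul, sum_softmaxProb, softmaxVar_eq]
    rw [show ∑ a, softmaxProb θ s a * v (s, a) = softmaxMean θ v s from rfl]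
    ring
  have h2 : ∑ a, ∑ b, softmaxProb θ s a * softmaxProb θ s b * (v (s, a) - v (s, b)) ^ 2 ≤
      ∑ a, ∑ b, if a = b then 0 else softmaxProb θ s a * softmaxProb θ s b *
        (2 * v (s, a) ^ 2 + 2 * v (s, b) ^ 2) := by
    refine Finset.sum_le_sum fun a _ => Finset.sum_le_sum fun b _ => ?_
    split_ifs with hab
    · simp [hab]
    · refine mul_le_mul_of_nonneg_left ?_ (mul_nonneg (hp a) (hp b))
      nlinarith [sq_nonneg (v (s, a) + v (s, b))]
  have h3 : ∑ a, ∑ b, (if a = b then 0 else softmaxProb θ s a * softmaxProb θ s b *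
        (2 * v (s, a) ^ 2 + 2 * v (s, b) ^ 2)) =
      ∑ a, 4 * (softmaxProb θ s a * (1 - softmaxProb θ s a)) * v (s, a) ^ 2 := by
    have e1 : ∀ a b, (if a = b then 0 else softmaxProb θ s a * softmaxProb θ s b *
        (2 * v (s, a) ^ 2 + 2 * v (s, b) ^ 2)) =
        2 * (softmaxProb θ s a * v (s, a) ^ 2) * softmaxProb θ s b +
        2 * (softmaxProb θ s a * (softmaxProb θ s b * v (s, b) ^ 2)) -
        if a = b then 4 * softmaxProb θ s a ^ 2 * v (s, a) ^ 2 else 0 := by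
      intro a b
      split_ifs with hab
      · subst hab; ring
      · ring
    simp only [e1, Finset.sum_sub_distrib, Finset.sum_add_distrib, ← Finset.mul_sum,
      ← Finset.sum_mul, sum_softmaxProb, Finset.sum_ite_eq, Finset.mem_univ, if_true]
    rw [Finset.mul_sum]
    simp only [mul_one, one_mul, Finset.mul_sum]
    rw [← Finset.sum_add_distrib, ← Finset.sum_sub_distrib]
    exact Finset.sum_congr rfl fun a _ => by ring
  have h4 : ∑ a, 4 * (softmaxProb θ s a * (1 - softmaxProb θ s a)) * v (s, a) ^ 2 ≤
      ∑ a, v (s, a) ^ 2 := by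
    refine Finset.sum_le_sum fun a _ => ?_
    refine mul_le_of_le_one_left (sq_nonneg _) ?_
    nlinarith [sq_nonneg (2 * softmaxProb θ s a - 1)]
  linarith

lemma norm_sq_eq_sum (v : Param S A) : ‖v‖ ^ 2 = ∑ s, ∑ a, v (s, a) ^ 2 := by
  rw [EuclideanSpace.real_norm_sq_eq, Fintype.sum_prod_type]

lemma softmaxVar_le_norm (θ v : Param S A) (s : S) : softmaxVar θ v s ≤ ‖v‖ ^ 2 / 2 := by
  refine (softmaxVar_le θ v s).trans ?_
  rw [norm_sq_eq_sum]
  have := Finset.single_le_sum (f := fun s => ∑ a, v (s, a) ^ 2)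
    (fun s _ => Finset.sum_nonneg fun a _ => sq_nonneg (v (s, a))) (Finset.mem_univ s)
  simp only at this
  linarith

end Softmax

/-! ### Second-order Taylor bounds and the Fisher information identity -/

section Taylor

/-- A second-order Taylor bound. -/
lemma le_taylor_of_second_deriv_le {f f' f'' : ℝ → ℝ} {C : ℝ}
    (hf : ∀ x, HasDerivAt f (f' x) x) (hf' : ∀ x, HasDerivAt f' (f'' x) x)
    (hC : ∀ x, f'' x ≤ C) : f 1 ≤ f 0 + f' 0 + C / 2 := by
  have h1 : Monotone fun x => C * x - f' x := by
    have hd : ∀ x, HasDerivAt (fun x => C * x - f' x) (C - f'' x) x := fun x => by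
      simpa using ((hasDerivAt_id x).const_mul C).fun_sub (hf' x)
    refine monotone_of_deriv_nonneg (fun x => (hd x).differentiableAt) fun x => ?_
    rw [(hd x).deriv]
    linarith [hC x]
  have hd : ∀ x, HasDerivAt (fun x => f' 0 * x + C * x ^ 2 / 2 - f x) (f' 0 + C * x - f' x) x := by
    intro x
    have := (((hasDerivAt_id x).const_mul (f' 0)).add
      ((((hasDerivAt_id x).pow 2).const_mul C).div_const 2)).sub (hf x)
    refine this.congr_deriv ?_
    simp
    ring
  have h2 : MonotoneOn (fun x => f' 0 * x + C * x ^ 2 / 2 - f x) (Set.Icc 0 1) := by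
    refine monotoneOn_of_deriv_nonneg (convex_Icc 0 1)
      (fun x _ => (hd x).continuousAt.continuousWithinAt)
      (fun x _ => (hd x).differentiableAt.differentiableWithinAt) fun x hx => ?_
    rw [interior_Icc] at hx
    rw [(hd x).deriv]
    have := h1 hx.1.le
    simp only at this
    linarith
  have := h2 (Set.left_mem_Icc.2 zero_le_one) (Set.right_mem_Icc.2 zero_le_one) zero_le_one
  simp only at this
  linarith

lemma abs_taylor_le_of_abs_second_deriv_le {f f' f'' : ℝ → ℝ} {C : ℝ}
    (hf : ∀ x, HasDerivAt f (f' x) x) (hf' : ∀ x, HasDerivAt f' (f'' x) x)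
    (hC : ∀ x, |f'' x| ≤ C) : |f 1 - f 0 - f' 0| ≤ C / 2 := by
  have h1 := le_taylor_of_second_deriv_le hf hf' fun x => (abs_le.1 (hC x)).2
  have h2 := le_taylor_of_second_deriv_le (f := fun x => -f x) (f' := fun x => -f' x)
    (f'' := fun x => -f'' x) (fun x => (hf x).neg) (fun x => (hf' x).neg)
    fun x => by linarith [(abs_le.1 (hC x)).1]
  rw [abs_le]
  constructor <;> linarith

/-- A family of probability vectors with log-derivative `l` whose derivative is `-w`. -/
structure IsScoreFamily {ι : Type*} [Fintype ι] (p l w : ι → ℝ → ℝ) : Prop where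
  nonneg : ∀ i x, 0 ≤ p i x
  sum_eq_one : ∀ x, ∑ i, p i x = 1
  deriv_p : ∀ i x, HasDerivAt (p i) (p i x * l i x) x
  deriv_l : ∀ i x, HasDerivAt (l i) (-w i x) x

namespace IsScoreFamily

variable {ι : Type*} [Fintype ι] {p l w : ι → ℝ → ℝ}

lemma deriv_sum (h : IsScoreFamily p l w) (F : ι → ℝ) (x : ℝ) :
    HasDerivAt (fun y => ∑ i, p i y * F i) (∑ i, p i x * l i x * F i) x :=
  HasDerivAt.fun_sum fun i _ => (h.deriv_p i x).mul_const (F i)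

lemma deriv_deriv_sum (h : IsScoreFamily p l w) (F : ι → ℝ) (x : ℝ) :
    HasDerivAt (fun y => ∑ i, p i y * l i y * F i)
      (∑ i, p i x * (l i x ^ 2 - w i x) * F i) x := by
  refine (HasDerivAt.fun_sum (u := Finset.univ) fun i _ =>
    ((h.deriv_p i x).mul (h.deriv_l i x)).mul_const (F i)).congr_deriv ?_
  exact Finset.sum_congr rfl fun i _ => by ring

lemma sum_score (h : IsScoreFamily p l w) (x : ℝ) : ∑ i, p i x * l i x = 0 := by
  have h1 := h.deriv_sum (fun _ => 1) x
  simp only [mul_one, h.sum_eq_one] at h1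
  exact h1.unique (hasDerivAt_const x (1 : ℝ))

/-- The Fisher information identity: differentiate the constant sum of the p_i twice. -/
lemma sum_score_sq (h : IsScoreFamily p l w) (x : ℝ) :
    ∑ i, p i x * l i x ^ 2 = ∑ i, p i x * w i x := by
  have h1 := h.deriv_deriv_sum (fun _ => 1) x
  simp only [mul_one, h.sum_score] at h1
  have h2 := h1.unique (hasDerivAt_const x (0 : ℝ))
  simp only [mul_sub, Finset.sum_sub_distrib] at h2
  linarith

lemma sum_score_sq_le (h : IsScoreFamily p l w) {x W : ℝ} (hw : ∀ i, w i x ≤ W) :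
    ∑ i, p i x * l i x ^ 2 ≤ W := by
  rw [h.sum_score_sq]
  calc ∑ i, p i x * w i x ≤ ∑ i, p i x * W :=
        Finset.sum_le_sum fun i _ => mul_le_mul_of_nonneg_left (hw i) (h.nonneg i x)
    _ = W := by rw [← Finset.sum_mul, h.sum_eq_one, one_mul]

/-- The second derivative is E[(l² - w)F]. Since w ≥ 0 it is at most R(E[l²] + E[w]) = 2R·E[w] ≤
2RW, without any pointwise bound on l. -/
lemma abs_taylor_le (h : IsScoreFamily p l w) {W R : ℝ} (hw0 : ∀ i x, 0 ≤ w i x)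
    (hw : ∀ i x, w i x ≤ W) {F : ι → ℝ} (hF : ∀ i, |F i| ≤ R) :
    |∑ i, p i 1 * F i - ∑ i, p i 0 * F i - ∑ i, p i 0 * l i 0 * F i| ≤ R * W := by
  -- The sign of R is only visible at an index; an empty index type would contradict total mass 1.
  have hR : 0 ≤ R ∨ IsEmpty ι := by
    by_cases hι : Nonempty ι
    · exact Or.inl ((abs_nonneg _).trans (hF hι.some))
    · exact Or.inr (not_nonempty_iff.1 hι)
  rcases hR with hR | hι
  swap
  · have := h.sum_eq_one 0
    simp at this
  have h1 := abs_taylor_le_of_abs_second_deriv_le (h.deriv_sum F) (h.deriv_deriv_sum F)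
    (C := 2 * (R * W)) fun x => by
      refine (Finset.abs_sum_le_sum_abs _ _).trans ?_
      calc ∑ i, |p i x * (l i x ^ 2 - w i x) * F i|
          ≤ ∑ i, (p i x * l i x ^ 2 + p i x * w i x) * R := by
            refine Finset.sum_le_sum fun i _ => ?_
            rw [abs_mul]
            refine mul_le_mul ?_ (hF i) (abs_nonneg _) ?_
            · rw [abs_mul, abs_of_nonneg (h.nonneg i x), ← mul_add]
              refine mul_le_mul_of_nonneg_left ?_ (h.nonneg i x)
              rw [abs_le]
              constructor <;> linarith [sq_nonneg (l i x), hw0 i x]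
            · exact add_nonneg (mul_nonneg (h.nonneg i x) (sq_nonneg _))
                (mul_nonneg (h.nonneg i x) (hw0 i x))
        _ = (∑ i, p i x * l i x ^ 2 + ∑ i, p i x * w i x) * R := by
            rw [← Finset.sum_mul, Finset.sum_add_distrib]
        _ ≤ (W + W) * R := by
            refine mul_le_mul_of_nonneg_right ?_ hR
            have h2 := h.sum_score_sq_le (x := x) fun i => hw i x
            have h3 := h2
            rw [h.sum_score_sq] at h3
            linarith
        _ = 2 * (R * W) := by ring
  linarith

/-- Cauchy–Schwarz in L²(p) gives E|l| ≤ √E[l²], and the Fisher identity bounds E[l²] by W. -/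
lemma abs_sum_score_mul_le (h : IsScoreFamily p l w) {x W R : ℝ} (hR : 0 ≤ R)
    (hw : ∀ i, w i x ≤ W) {F : ι → ℝ} (hF : ∀ i, |F i| ≤ R) :
    |∑ i, p i x * l i x * F i| ≤ R * Real.sqrt W := by
  have h1 : |∑ i, p i x * l i x * F i| ≤ R * ∑ i, p i x * |l i x| := by
    refine (Finset.abs_sum_le_sum_abs _ _).trans ?_
    rw [Finset.mul_sum]
    refine Finset.sum_le_sum fun i _ => ?_
    rw [abs_mul, abs_mul, abs_of_nonneg (h.nonneg i x), mul_comm]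
    exact mul_le_mul_of_nonneg_right (hF i) (mul_nonneg (h.nonneg i x) (abs_nonneg _))
  refine h1.trans (mul_le_mul_of_nonneg_left ?_ hR)
  refine Real.le_sqrt_of_sq_le ?_
  have h3 := Finset.sum_mul_sq_le_sq_mul_sq Finset.univ (fun i => Real.sqrt (p i x))
    fun i => Real.sqrt (p i x) * |l i x|
  have h4 : ∀ i, Real.sqrt (p i x) * (Real.sqrt (p i x) * |l i x|) = p i x * |l i x| := fun i => by
    rw [← mul_assoc, Real.mul_self_sqrt (h.nonneg i x)]
  simp only [h4, mul_pow, Real.sq_sqrt (h.nonneg _ x), sq_abs, h.sum_eq_one, one_mul] at h3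
  exact h3.trans (h.sum_score_sq_le hw)

end IsScoreFamily

end Taylor

/-! ### The series Σ γ^t (t + 1) and its tail -/

section Geometric

lemma hasSum_pow_mul_succ {γ : ℝ} (h0 : 0 ≤ γ) (h1 : γ < 1) :
    HasSum (fun t : ℕ => γ ^ t * ((t : ℝ) + 1)) (1 / (1 - γ) ^ 2) := by
  have h := hasSum_choose_mul_geometric_of_norm_lt_one (𝕜 := ℝ) 1 (r := γ)
    (by rwa [Real.norm_eq_abs, abs_of_nonneg h0])
  have e : (fun t : ℕ => γ ^ t * ((t : ℝ) + 1)) = fun t => ((t + 1).choose 1 : ℝ) * γ ^ t := by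
    funext t
    rw [Nat.choose_one_right]
    push_cast
    ring
  rw [e]
  exact h

lemma hasSum_pow_add_mul_succ {γ : ℝ} (h0 : 0 ≤ γ) (h1 : γ < 1) (H : ℕ) :
    HasSum (fun t : ℕ => γ ^ (t + H) * ((t : ℝ) + H + 1))
      (γ ^ H * (1 / (1 - γ) ^ 2 + H / (1 - γ))) := by
  have h := ((hasSum_pow_mul_succ h0 h1).add
    ((hasSum_geometric_of_lt_one h0 h1).mul_right (H : ℝ))).mul_left (γ ^ H)
  have e : (fun t : ℕ => γ ^ (t + H) * ((t : ℝ) + H + 1)) =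
      fun t : ℕ => γ ^ H * (γ ^ t * ((t : ℝ) + 1) + γ ^ t * H) := by
    funext t
    rw [pow_add]
    ring
  rw [e, div_eq_inv_mul (H : ℝ)]
  exact h

end Geometric

/-! ### Smoothness of the return and of the log barrier -/

section Smoothness

variable {S A : Type*} [Fintype S] [MeasurableSpace S] [MeasurableSingletonClass S]
  [Fintype A] [MeasurableSpace A] [MeasurableSingletonClass A] [Nonempty S] [Nonempty A]

/-- The dynamics factors do not depend on θ, so the log-derivative is a sum of centred softmax
terms, and minus its derivative is a sum of variances depending only on the visited states. -/
lemma isScoreFamily_prefixProb (M : MDP S A) (θ v : Param S A) (n : ℕ) :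
    IsScoreFamily (fun (h : Fin n → S × A) x => prefixProb M (softmaxPolicy (θ + x • v)) h)
      (fun h x => ∑ k, (v (h k) - softmaxMean (θ + x • v) v (h k).1))
      (fun h x => ∑ k, softmaxVar (θ + x • v) v (h k).1) where
  nonneg h x := prefixProb_nonneg _ _ _
  sum_eq_one x := sum_prefixProb _ _ _
  deriv_p h x := by
    have h1 := ((HasDerivAt.fun_sum (u := Finset.univ) fun k _ =>
      hasDerivAt_log_softmaxProb θ v (h k).1 (h k).2 x).exp).const_mul (dynamicsWeight M h)
    have h2 : ∀ y : ℝ, prefixProb M (softmaxPolicy (θ + y • v)) h = dynamicsWeight M h *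
        Real.exp (∑ k, Real.log (softmaxProb (θ + y • v) (h k).1 (h k).2)) := fun y => by
      simp only [prefixProb, softmaxPolicy_toReal, Real.exp_sum, Real.exp_log (softmaxProb_pos _ _ _)]
    simp only [h2]
    refine h1.congr_deriv ?_
    ring
  deriv_l h x := by
    have := HasDerivAt.fun_sum (u := Finset.univ) fun k _ =>
      (hasDerivAt_softmaxMean θ v (h k).1 x).const_sub (v (h k))
    simpa using this

/-- The score of a finite trajectory. -/
def prefixScore (θ : Param S A) {n : ℕ} (h : Fin n → S × A) : Param S A :=
  ∑ k, score θ (h k).1 (h k).2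

/-- The gradient of the expectation of a function of the first `n` state-action pairs. -/
def prefixGrad (M : MDP S A) (θ : Param S A) {n : ℕ} (F : (Fin n → S × A) → ℝ) : Param S A :=
  ∑ h, (prefixProb M (softmaxPolicy θ) h * F h) • prefixScore θ h

lemma inner_prefixScore (θ v : Param S A) {n : ℕ} (h : Fin n → S × A) :
    inner ℝ (prefixScore θ h) v = ∑ k, (v (h k) - softmaxMean θ v (h k).1) := by
  simp only [prefixScore, sum_inner, inner_score]

lemma inner_prefixGrad (M : MDP S A) (θ v : Param S A) {n : ℕ} (F : (Fin n → S × A) → ℝ) :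
    inner ℝ (prefixGrad M θ F) v = ∑ h, prefixProb M (softmaxPolicy θ) h *
      (∑ k, (v (h k) - softmaxMean θ v (h k).1)) * F h := by
  simp only [prefixGrad, sum_inner, real_inner_smul_left, inner_prefixScore]
  exact Finset.sum_congr rfl fun h _ => by ring

lemma sum_softmaxVar_le (θ v : Param S A) {n : ℕ} (h : Fin n → S × A) :
    ∑ k, softmaxVar θ v (h k).1 ≤ n * (‖v‖ ^ 2 / 2) := by
  calc ∑ k, softmaxVar θ v (h k).1 ≤ ∑ _k : Fin n, ‖v‖ ^ 2 / 2 :=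
        Finset.sum_le_sum fun k _ => softmaxVar_le_norm θ v _
    _ = n * (‖v‖ ^ 2 / 2) := by simp

lemma hasDerivAt_prefix (M : MDP S A) (θ v : Param S A) {n : ℕ} (F : (Fin n → S × A) → ℝ) :
    HasDerivAt (fun x : ℝ => ∑ h, prefixProb M (softmaxPolicy (θ + x • v)) h * F h)
      (inner ℝ (prefixGrad M θ F) v) 0 := by
  have := (isScoreFamily_prefixProb M θ v n).deriv_sum F 0
  simp only [zero_smul, add_zero] at this
  rwa [inner_prefixGrad]

lemma abs_prefix_taylor_le (M : MDP S A) (θ v : Param S A) {n : ℕ} {F : (Fin n → S × A) → ℝ}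
    {R : ℝ} (hF : ∀ h, |F h| ≤ R) :
    |∑ h, prefixProb M (softmaxPolicy (θ + v)) h * F h - ∑ h, prefixProb M (softmaxPolicy θ) h * F h -
      inner ℝ (prefixGrad M θ F) v| ≤ R * (n * (‖v‖ ^ 2 / 2)) := by
  have := (isScoreFamily_prefixProb M θ v n).abs_taylor_le
    (fun h x => Finset.sum_nonneg fun k _ => softmaxVar_nonneg _ _ _)
    (fun h x => sum_softmaxVar_le (θ + x • v) v h) hF
  simp only [zero_smul, add_zero, one_smul] at this
  rwa [inner_prefixGrad]

/-- Test the score bound in the direction G of the gradient itself: ‖G‖² ≤ R√(n‖G‖²/2). The root is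
relaxed to n‖G‖ so that the discounted series has the closed form used for the tail. -/
lemma norm_prefixGrad_le (M : MDP S A) (θ : Param S A) {n : ℕ} {F : (Fin n → S × A) → ℝ}
    {R : ℝ} (hR : 0 ≤ R) (hF : ∀ h, |F h| ≤ R) : ‖prefixGrad M θ F‖ ≤ R * n := by
  set G := prefixGrad M θ F with hG
  have h := (isScoreFamily_prefixProb M θ G n).abs_sum_score_mul_le (x := 0) hR
    (fun h => sum_softmaxVar_le (θ + (0 : ℝ) • G) G h) hF
  simp only [zero_smul, add_zero] at h
  rw [← inner_prefixGrad, ← hG, real_inner_self_eq_norm_sq, abs_of_nonneg (sq_nonneg _)] at h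
  have h1 : Real.sqrt (n * (‖G‖ ^ 2 / 2)) ≤ n * ‖G‖ := by
    refine Real.sqrt_le_iff.2 ⟨by positivity, ?_⟩
    rw [mul_pow]
    rcases Nat.eq_zero_or_pos n with rfl | hn
    · simp
    · have : (1 : ℝ) ≤ n := by exact_mod_cast hn
      nlinarith [sq_nonneg ‖G‖, mul_nonneg (sub_nonneg.2 this) (sq_nonneg ‖G‖),
        mul_nonneg (mul_nonneg (sub_nonneg.2 this) (sq_nonneg ‖G‖)) (zero_le_one.trans this)]
  rcases (norm_nonneg G).eq_or_lt with h0 | h0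
  · rw [← h0]; positivity
  · have h2 := h.trans (mul_le_mul_of_nonneg_left h1 hR)
    refine le_of_mul_le_mul_right ?_ h0
    linarith

/-- The gradient of `E[f (s_t, a_t)]`. -/
def pairGrad (M : MDP S A) (f : S × A → ℝ) (θ : Param S A) (t : ℕ) : Param S A :=
  prefixGrad M θ fun h : Fin (t + 1) → S × A => f (h (Fin.last t))

/-- The gradient of the expected discounted sum of `f (s_t, a_t)`. -/
def discountedGrad (M : MDP S A) (f : S × A → ℝ) (θ : Param S A) : Param S A :=
  ∑' t : ℕ, M.γ ^ t • pairGrad M f θ t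

/-- The gradient of the expected discounted sum of `f (s_t, a_t)` truncated at horizon `H`. -/
def truncatedGrad (M : MDP S A) (f : S × A → ℝ) (θ : Param S A) (H : ℕ) : Param S A :=
  ∑ t ∈ Finset.range H, M.γ ^ t • pairGrad M f θ t

lemma norm_pow_smul_pairGrad_le (M : MDP S A) {f : S × A → ℝ} {R : ℝ} (hR : 0 ≤ R)
    (hf : ∀ x, |f x| ≤ R) (θ : Param S A) (t : ℕ) :
    ‖M.γ ^ t • pairGrad M f θ t‖ ≤ M.γ ^ t * ((t : ℝ) + 1) * R := by
  rw [norm_smul, Real.norm_eq_abs, abs_of_nonneg (pow_nonneg M.γ_nonneg t), mul_assoc]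
  refine mul_le_mul_of_nonneg_left ?_ (pow_nonneg M.γ_nonneg t)
  refine (norm_prefixGrad_le M θ hR fun h => hf _).trans (le_of_eq ?_)
  push_cast
  ring

lemma hasSum_discountedGrad (M : MDP S A) (f : S × A → ℝ) (θ : Param S A) :
    HasSum (fun t : ℕ => M.γ ^ t • pairGrad M f θ t) (discountedGrad M f θ) := by
  obtain ⟨R, hR0, hR⟩ := exists_abs_le f
  exact (Summable.of_norm_bounded
    ((hasSum_pow_mul_succ M.γ_nonneg M.γ_lt_one).summable.mul_right R)
    (norm_pow_smul_pairGrad_le M hR0 hR θ)).hasSum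

lemma norm_discountedGrad_sub_truncatedGrad_le (M : MDP S A) {f : S × A → ℝ} {R : ℝ} (hR : 0 ≤ R)
    (hf : ∀ x, |f x| ≤ R) (θ : Param S A) (H : ℕ) :
    ‖discountedGrad M f θ - truncatedGrad M f θ H‖ ≤
      R * (M.γ ^ H * (1 / (1 - M.γ) ^ 2 + H / (1 - M.γ))) := by
  have h1 := (hasSum_discountedGrad M f θ).summable.sum_add_tsum_nat_add H
  have h2 : discountedGrad M f θ - truncatedGrad M f θ H =
      ∑' t : ℕ, M.γ ^ (t + H) • pairGrad M f θ (t + H) := by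
    rw [discountedGrad, truncatedGrad, ← h1]
    abel
  rw [h2]
  refine tsum_of_norm_bounded
    ((hasSum_pow_add_mul_succ M.γ_nonneg M.γ_lt_one H).mul_left R) fun t => ?_
  refine (norm_pow_smul_pairGrad_le M hR hf θ (t + H)).trans (le_of_eq ?_)
  push_cast
  ring

/-- The expected discounted sum of `f (s_t, a_t)` is smooth in the softmax parameter. -/
lemma abs_discountedSum_taylor_le (M : MDP S A) {f : S × A → ℝ} {R : ℝ}
    (hf : ∀ x, |f x| ≤ R) (θ v : Param S A) :
    |discountedSum M (softmaxPolicy (θ + v)) f - discountedSum M (softmaxPolicy θ) f -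
      inner ℝ (discountedGrad M f θ) v| ≤ R / (1 - M.γ) ^ 2 / 2 * ‖v‖ ^ 2 := by
  have h1 := ((hasSum_discountedSum M (softmaxPolicy (θ + v)) f).sub
    (hasSum_discountedSum M (softmaxPolicy θ) f)).sub
    ((hasSum_discountedGrad M f θ).mapL ((innerSL ℝ).flip v))
  simp only [ContinuousLinearMap.flip_apply, innerSL_apply_apply, real_inner_smul_left] at h1
  rw [← h1.tsum_eq, ← Real.norm_eq_abs]
  -- The time-t term involves t + 1 actions, hence a remainder proportional to t + 1; the sum of γ^t
  -- (t + 1) produces 1/(1 - γ)².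
  have h2 := (hasSum_pow_mul_succ M.γ_nonneg M.γ_lt_one).mul_right (R * (‖v‖ ^ 2 / 2))
  refine (tsum_of_norm_bounded h2 fun t => ?_).trans (le_of_eq (by ring))
  rw [← mul_sub, ← mul_sub, norm_mul, Real.norm_eq_abs, Real.norm_eq_abs,
    abs_of_nonneg (pow_nonneg M.γ_nonneg t), mul_assoc]
  refine mul_le_mul_of_nonneg_left ?_ (pow_nonneg M.γ_nonneg t)
  rw [sum_pairProb_mul_eq_prefix, sum_pairProb_mul_eq_prefix]
  refine (abs_prefix_taylor_le M θ v fun h : Fin (t + 1) → S × A => hf (h (Fin.last t))).trans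
    (le_of_eq ?_)
  push_cast
  ring

/-- Turns the quadratic Taylor remainder into a derivative, which avoids differentiating the
infinite discounted series term by term. -/
lemma hasDerivAt_zero_of_abs_le_sq {f : ℝ → ℝ} {c C : ℝ}
    (h : ∀ x, |f x - f 0 - c * x| ≤ C * x ^ 2) : HasDerivAt f c 0 := by
  rw [hasDerivAt_iff_isLittleO]
  have h1 : (fun x : ℝ => f x - f 0 - (x - 0) • c) =O[nhds 0] fun x : ℝ => x ^ 2 := by
    refine Asymptotics.IsBigO.of_bound C (Filter.Eventually.of_forall fun x => ?_)
    rw [Real.norm_eq_abs, Real.norm_eq_abs, abs_of_nonneg (sq_nonneg x), sub_zero, smul_eq_mul,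
      mul_comm x c]
    exact h x
  refine h1.trans_isLittleO ?_
  simpa using Asymptotics.isLittleO_pow_id (𝕜 := ℝ) one_lt_two

lemma hasDerivAt_discountedSum (M : MDP S A) (f : S × A → ℝ) (θ v : Param S A) :
    HasDerivAt (fun x : ℝ => discountedSum M (softmaxPolicy (θ + x • v)) f)
      (inner ℝ (discountedGrad M f θ) v) 0 := by
  obtain ⟨R, hR0, hR⟩ := exists_abs_le f
  refine hasDerivAt_zero_of_abs_le_sq (C := R / (1 - M.γ) ^ 2 / 2 * ‖v‖ ^ 2) fun x => ?_
  have h := abs_discountedSum_taylor_le M hR θ (x • v)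
  rw [real_inner_smul_right, norm_smul, mul_pow, Real.norm_eq_abs, sq_abs] at h
  simp only [zero_smul, add_zero]
  calc _ ≤ _ := le_of_eq (by rw [mul_comm])
    _ ≤ _ := h
    _ = _ := by ring

/-- Gibbs' inequality from log x ≥ 1 - 1/x; the linear bounds sum to zero at each state. -/
lemma barrier_nonneg (θ : Param S A) : 0 ≤ barrier θ := by
  refine mul_nonneg (by positivity) (Finset.sum_nonneg fun s _ => ?_)
  have hN : (0 : ℝ) < Fintype.card A := by exact_mod_cast Fintype.card_pos
  have h : ∀ a, 1 / (Fintype.card A : ℝ) - softmaxProb θ s a ≤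
      1 / (Fintype.card A : ℝ) * Real.log (1 / (Fintype.card A : ℝ) / softmaxProb θ s a) := by
    intro a
    have hp := softmaxProb_pos θ s a
    have h1 := Real.one_sub_inv_le_log_of_pos
      (div_pos (one_div_pos.2 hN) hp)
    have h2 := mul_le_mul_of_nonneg_left h1 (one_div_pos.2 hN).le
    refine le_trans (le_of_eq ?_) h2
    field_simp
  calc (0 : ℝ) = ∑ a, (1 / (Fintype.card A : ℝ) - softmaxProb θ s a) := by
        rw [Finset.sum_sub_distrib, sum_softmaxProb]
        simp
    _ ≤ _ := Finset.sum_le_sum fun a _ => h a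

/-- The gradient of the negative barrier. -/
def barrierGrad (θ : Param S A) : Param S A :=
  (1 / ((Fintype.card A : ℝ) * (Fintype.card S : ℝ))) • ∑ s : S, ∑ a : A, score θ s a

/-- The second derivative is the average over states of the softmax variances. Each state sees only
its own block of v, so the sum over states costs ‖v‖²/2 once rather than |S| times. -/
lemma barrier_le_taylor (θ v : Param S A) :
    barrier (θ + v) ≤ barrier θ - inner ℝ (barrierGrad θ) v +
      1 / (2 * Fintype.card S) / 2 * ‖v‖ ^ 2 := by
  have hN : (0 : ℝ) < Fintype.card A := by exact_mod_cast Fintype.card_pos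
  have hS : (0 : ℝ) < Fintype.card S := by exact_mod_cast Fintype.card_pos
  set N : ℝ := (Fintype.card A : ℝ) with hNdef
  have hb : ∀ ϑ : Param S A, barrier ϑ = (1 / (Fintype.card S : ℝ)) * ∑ s : S, ∑ a : A,
      (1 / N) * (Real.log (1 / N) - Real.log (softmaxProb ϑ s a)) := fun ϑ => by
    simp only [barrier]
    congr 1
    refine Finset.sum_congr rfl fun s _ => Finset.sum_congr rfl fun a _ => ?_
    rw [Real.log_div (one_div_pos.2 hN).ne' (softmaxProb_pos ϑ s a).ne']
  have hd1 : ∀ x : ℝ, HasDerivAt (fun x : ℝ => barrier (θ + x • v))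
      ((1 / (Fintype.card S : ℝ)) * ∑ s : S, ∑ a : A,
        (1 / N) * -(v (s, a) - softmaxMean (θ + x • v) v s)) x := fun x => by
    simp only [hb]
    exact (HasDerivAt.fun_sum fun s _ => HasDerivAt.fun_sum fun a _ =>
      ((hasDerivAt_log_softmaxProb θ v s a x).const_sub (Real.log (1 / N))).const_mul
        (1 / N)).const_mul _
  have hd2 : ∀ x : ℝ, HasDerivAt (fun x : ℝ => (1 / (Fintype.card S : ℝ)) * ∑ s : S, ∑ a : A,
        (1 / N) * -(v (s, a) - softmaxMean (θ + x • v) v s))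
      ((1 / (Fintype.card S : ℝ)) * ∑ s : S, ∑ _a : A,
        (1 / N) * - -softmaxVar (θ + x • v) v s) x := fun x =>
    (HasDerivAt.fun_sum fun s _ => HasDerivAt.fun_sum fun a _ =>
      (((hasDerivAt_softmaxMean θ v s x).const_sub (v (s, a))).fun_neg).const_mul
        (1 / N)).const_mul _
  have h := le_taylor_of_second_deriv_le hd1 hd2 (C := 1 / (2 * Fintype.card S) * ‖v‖ ^ 2)
    fun x => by
      simp only [neg_neg, Finset.sum_const, Finset.card_univ, nsmul_eq_mul]
      have h1 : ∑ s, (N * (1 / N * softmaxVar (θ + x • v) v s)) ≤ ‖v‖ ^ 2 / 2 := by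
        rw [norm_sq_eq_sum, Finset.sum_div]
        refine Finset.sum_le_sum fun s _ => ?_
        rw [← mul_assoc, mul_one_div_cancel hN.ne', one_mul]
        exact softmaxVar_le _ _ _
      calc _ ≤ 1 / (Fintype.card S : ℝ) * (‖v‖ ^ 2 / 2) :=
            mul_le_mul_of_nonneg_left h1 (by positivity)
        _ = _ := by field_simp
  simp only [one_smul, zero_smul, add_zero] at h
  refine h.trans (le_of_eq ?_)
  have h3 : inner ℝ (barrierGrad θ) v = -(1 / (Fintype.card S : ℝ) * ∑ s : S, ∑ a : A,
        (1 / N) * -(v (s, a) - softmaxMean θ v s)) := by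
    simp only [barrierGrad, real_inner_smul_left, sum_inner, inner_score, ← Finset.mul_sum,
      Finset.sum_neg_distrib]
    rw [← hNdef]
    field_simp
  rw [h3]
  ring

/-- The gradient of the regularized objective. -/
def regGrad (M : MDP S A) (lam : ℝ) (θ : Param S A) : Param S A :=
  discountedGrad M (fun x => M.r x.1 x.2) θ + lam • barrierGrad θ

lemma softmaxReturn_eq (M : MDP S A) (θ : Param S A) :
    softmaxReturn M θ = discountedSum M (softmaxPolicy θ) fun x => M.r x.1 x.2 :=
  policyReturn_eq M _

/-- The regularized objective is smooth. -/
lemma regReturn_taylor_le (M : MDP S A) {R lam : ℝ} (hlam : 0 ≤ lam)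
    (hr : ∀ s a, |M.r s a| ≤ R) (θ v : Param S A) :
    regReturn M lam θ + inner ℝ (regGrad M lam θ) v -
      (R / (1 - M.γ) ^ 2 + lam / (2 * Fintype.card S)) / 2 * ‖v‖ ^ 2 ≤ regReturn M lam (θ + v) := by
  have h1 := abs_discountedSum_taylor_le M (fun x : S × A => hr x.1 x.2) θ v
  have h2 := mul_le_mul_of_nonneg_left (barrier_le_taylor θ v) hlam
  rw [regReturn, regReturn, softmaxReturn_eq, softmaxReturn_eq, regGrad, inner_add_left,
    real_inner_smul_left]
  have h3 := (abs_le.1 h1).1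
  have h4 : lam * (1 / (2 * (Fintype.card S : ℝ)) / 2 * ‖v‖ ^ 2) =
    lam / (2 * Fintype.card S) / 2 * ‖v‖ ^ 2 := by ring
  linarith

end Smoothness

/-! ### Performance difference, policy gradient theorem and gradient domination -/

section GradientDomination

variable {S A : Type*} [Fintype S] [MeasurableSpace S] [MeasurableSingletonClass S]
  [Fintype A] [MeasurableSpace A] [MeasurableSingletonClass A] [Nonempty S] [Nonempty A]

lemma sum_pmf_toReal {ι : Type*} [Fintype ι] (p : PMF ι) : ∑ i, (p i).toReal = 1 := by
  rw [← ENNReal.toReal_sum fun i _ => PMF.apply_ne_top _ _, ← tsum_fintype (L := .unconditional _),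
    PMF.tsum_coe, ENNReal.toReal_one]

lemma abs_sum_pmf_mul_le {ι : Type*} [Fintype ι] (p : PMF ι) {f : ι → ℝ} {C : ℝ}
    (hf : ∀ i, |f i| ≤ C) : |∑ i, (p i).toReal * f i| ≤ C := by
  refine (Finset.abs_sum_le_sum_abs _ _).trans ?_
  calc ∑ i, |(p i).toReal * f i| ≤ ∑ i, (p i).toReal * C := by
        refine Finset.sum_le_sum fun i _ => ?_
        rw [abs_mul, abs_of_nonneg ENNReal.toReal_nonneg]
        exact mul_le_mul_of_nonneg_left (hf i) ENNReal.toReal_nonneg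
    _ = C := by rw [← Finset.sum_mul, sum_pmf_toReal, one_mul]

/-- The advantage of the action `a` at the state `s` for the value function `V`. -/
def advantage (M : MDP S A) (V : S → ℝ) (s : S) (a : A) : ℝ :=
  M.r s a + M.γ * ∑ s', (M.P s a s').toReal * V s' - V s

/-- Every policy has a value function. -/
lemma exists_value_function (M : MDP S A) (π : Policy S A) :
    ∃ V : S → ℝ, ∀ s, ∑ a, (π s a).toReal * advantage M V s a = 0 := by
  -- The Bellman evaluation operator, a γ-contraction in sup norm. Only its fixed-point equation is
  -- needed later, not a formula for V along trajectories.
  let T : (S → ℝ) → S → ℝ := fun V s =>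
    ∑ a, (π s a).toReal * (M.r s a + M.γ * ∑ s', (M.P s a s').toReal * V s')
  have hT : ContractingWith ⟨M.γ, M.γ_nonneg⟩ T := by
    refine ⟨by exact_mod_cast M.γ_lt_one, LipschitzWith.of_dist_le_mul fun V W => ?_⟩
    refine (dist_pi_le_iff (mul_nonneg M.γ_nonneg dist_nonneg)).2 fun s => ?_
    have h : T V s - T W s =
        ∑ a, (π s a).toReal * (M.γ * ∑ s', (M.P s a s').toReal * (V s' - W s')) := by
      simp only [T, ← Finset.sum_sub_distrib, mul_sub]
      refine Finset.sum_congr rfl fun a _ => ?_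
      rw [Finset.sum_sub_distrib]
      ring
    rw [Real.dist_eq, h]
    refine abs_sum_pmf_mul_le _ fun a => ?_
    rw [abs_mul, abs_of_nonneg M.γ_nonneg]
    refine mul_le_mul_of_nonneg_left (abs_sum_pmf_mul_le _ fun s' => ?_) M.γ_nonneg
    rw [← Real.dist_eq]
    exact dist_le_pi_dist V W s'
  refine ⟨hT.fixedPoint T, fun s => ?_⟩
  have h := congrFun hT.fixedPoint_isFixedPt s
  simp only [advantage, mul_sub, Finset.sum_sub_distrib, ← Finset.sum_mul, sum_policy, one_mul]
  rw [sub_eq_zero]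
  exact h

/-- Holds for an arbitrary function V, since the flow equation cancels all V terms except the
initial one. Applying it to two policies with the same V and subtracting gives the performance
difference lemma. -/
lemma sum_visitation_advantage (M : MDP S A) (π : Policy S A) (V : S → ℝ) :
    ∑ s, visitation M π s * ∑ a, (π s a).toReal * advantage M V s a =
      (1 - M.γ) * policyReturn M π - (1 - M.γ) * ∑ s, (M.ρ s).toReal * V s := by
  rw [policyReturn_eq, discountedSum_eq_visitation]
  have h1 : ∑ s, visitation M π s * V s = (1 - M.γ) * ∑ s, (M.ρ s).toReal * V s +
      M.γ * ∑ s', visitation M π s' *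
        ∑ a, (π s' a).toReal * ∑ s, (M.P s' a s).toReal * V s := by
    have h2 : ∀ s, visitation M π s * V s = (1 - M.γ) * ((M.ρ s).toReal * V s) +
        M.γ * ∑ s', visitation M π s' * ∑ a, (π s' a).toReal * ((M.P s' a s).toReal * V s) := by
      intro s
      rw [visitation_flow]
      simp only [← mul_assoc, ← Finset.sum_mul]
      ring
    simp only [h2, Finset.sum_add_distrib, ← Finset.mul_sum]
    congr 2
    rw [Finset.sum_comm]
    refine Finset.sum_congr rfl fun s' _ => ?_
    rw [← Finset.mul_sum, Finset.sum_comm]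
    simp only [← Finset.mul_sum]
  have h3 : ∀ s, visitation M π s * ∑ a, (π s a).toReal * advantage M V s a =
      visitation M π s * ∑ a, (π s a).toReal * M.r s a +
      M.γ * (visitation M π s * ∑ a, (π s a).toReal * ∑ s', (M.P s a s').toReal * V s') -
      visitation M π s * V s := by
    intro s
    have h4 : ∑ a, (π s a).toReal * advantage M V s a = ∑ a, (π s a).toReal * M.r s a +
        M.γ * ∑ a, (π s a).toReal * ∑ s', (M.P s a s').toReal * V s' - V s := by
      conv_rhs => rw [← one_mul (V s), ← sum_policy π s]
      rw [Finset.sum_mul, Finset.mul_sum, ← Finset.sum_add_distrib, ← Finset.sum_sub_distrib]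
      exact Finset.sum_congr rfl fun a _ => by rw [advantage]; ring
    rw [h4]
    ring
  simp only [h3, Finset.sum_sub_distrib, Finset.sum_add_distrib, ← Finset.mul_sum, h1]
  ring

/-- The performance difference lemma. -/
lemma performance_difference (M : MDP S A) {π : Policy S A} {V : S → ℝ}
    (hV : ∀ s, ∑ a, (π s a).toReal * advantage M V s a = 0) (π' : Policy S A) :
    (1 - M.γ) * (policyReturn M π' - policyReturn M π) =
      ∑ s, visitation M π' s * ∑ a, (π' s a).toReal * advantage M V s a := by
  have h := sum_visitation_advantage M π V
  simp only [hV, mul_zero, Finset.sum_const_zero] at h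
  rw [sum_visitation_advantage]
  linarith

lemma visitation_eq_discountedSum [DecidableEq S] (M : MDP S A) (π : Policy S A) (s : S) :
    visitation M π s = (1 - M.γ) * discountedSum M π fun x => if x.1 = s then 1 else 0 := by
  rw [discountedSum_eq_visitation, Finset.sum_eq_single s]
  · simp [sum_policy]
  · intro s' _ hs
    simp [hs]
  · simp

/-- The policy gradient theorem. -/
lemma inner_discountedGrad (M : MDP S A) (θ v : Param S A) {V : S → ℝ}
    (hV : ∀ s, ∑ a, softmaxProb θ s a * advantage M V s a = 0) :
    (1 - M.γ) * inner ℝ (discountedGrad M (fun x => M.r x.1 x.2) θ) v =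
      ∑ s, visitation M (softmaxPolicy θ) s *
        ∑ a, softmaxProb θ s a * v (s, a) * advantage M V s a := by
  classical
  have hV' : ∀ s, ∑ a, (softmaxPolicy θ s a).toReal * advantage M V s a = 0 := by
    simpa only [softmaxPolicy_toReal] using hV
  -- V stays frozen at θ while the policy moves. In the performance difference formula the inner
  -- sums vanish at θ, so in the product rule the derivative of the visitation drops out and only
  -- its existence matters.
  have h1 := ((hasDerivAt_discountedSum M (fun x => M.r x.1 x.2) θ v).sub_const
    (policyReturn M (softmaxPolicy θ))).const_mul (1 - M.γ)
  simp only [← policyReturn_eq, performance_difference M hV', softmaxPolicy_toReal] at h1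
  have hd := fun s : S => (hasDerivAt_discountedSum M
    (fun x => if x.1 = s then 1 else 0) θ v).const_mul (1 - M.γ)
  simp only [← visitation_eq_discountedSum] at hd
  have h2 := HasDerivAt.fun_sum (u := Finset.univ) fun s _ => (hd s).fun_mul
    (HasDerivAt.fun_sum (u := Finset.univ) fun a _ =>
      (hasDerivAt_softmaxProb θ v s a 0).mul_const (advantage M V s a))
  rw [h1.unique h2]
  refine Finset.sum_congr rfl fun s _ => ?_
  simp only [zero_smul, add_zero, hV, mul_zero, zero_add]
  congr 1
  have h3 : ∀ a, softmaxProb θ s a * (v (s, a) - softmaxMean θ v s) * advantage M V s a =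
      softmaxProb θ s a * v (s, a) * advantage M V s a -
      softmaxMean θ v s * (softmaxProb θ s a * advantage M V s a) := fun a => by ring
  simp only [h3, Finset.sum_sub_distrib, ← Finset.mul_sum, hV, mul_zero, sub_zero]

lemma inner_barrierGrad_single [DecidableEq S] [DecidableEq A] (θ : Param S A) (s : S) (a : A) :
    inner ℝ (barrierGrad θ) (EuclideanSpace.single (s, a) 1) =
      1 / (Fintype.card S : ℝ) * (1 / (Fintype.card A : ℝ) - softmaxProb θ s a) := by
  have hN : (Fintype.card A : ℝ) ≠ 0 := by exact_mod_cast Fintype.card_ne_zero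
  have h1 : ∀ s' a', (EuclideanSpace.single (s, a) (1 : ℝ) : Param S A) (s', a') =
      if s' = s then (if a' = a then 1 else 0) else 0 := by
    intro s' a'
    simp [Prod.ext_iff, ite_and]
  have h2 : ∀ s', softmaxMean θ (EuclideanSpace.single (s, a) (1 : ℝ)) s' =
      if s' = s then softmaxProb θ s a else 0 := by
    intro s'
    simp only [softmaxMean, h1]
    split_ifs with hs
    · subst hs; simp
    · simp
  simp only [barrierGrad, real_inner_smul_left, sum_inner, inner_score, h1, h2,
    Finset.sum_sub_distrib, Finset.sum_ite_irrel, Finset.sum_const_zero, Finset.sum_ite_eq',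
    Finset.mem_univ, if_true, Finset.sum_const, Finset.card_univ, nsmul_eq_mul]
  field_simp

lemma visitation_le_mismatch (M : MDP S A) (hρ : ∀ s, M.ρ s ≠ 0) (π : Policy S A) (s : S) :
    visitation M π s ≤ mismatch M π * (M.ρ s).toReal := by
  have hpos : 0 < (M.ρ s).toReal := ENNReal.toReal_pos (hρ s) (PMF.apply_ne_top _ _)
  rw [← div_le_iff₀ hpos]
  exact le_ciSup (f := fun s => visitation M π s / (M.ρ s).toReal)
    (Set.finite_range _).bddAbove s

lemma one_le_mismatch (M : MDP S A) (hρ : ∀ s, M.ρ s ≠ 0) (π : Policy S A) :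
    1 ≤ mismatch M π := by
  have h := Finset.sum_le_sum fun s (_ : s ∈ Finset.univ) => visitation_le_mismatch M hρ π s
  rwa [sum_visitation, ← Finset.mul_sum, sum_pmf_toReal, mul_one] at h

/-- Gradient domination for the log-barrier regularized objective. -/
lemma policyReturn_sub_le_of_norm_regGrad_le (M : MDP S A) (hρ : ∀ s, M.ρ s ≠ 0)
    (π : Policy S A) {lam : ℝ} (hlam : 0 < lam) (θ : Param S A)
    (hG : ‖regGrad M lam θ‖ ≤ lam / (2 * Fintype.card S * Fintype.card A)) :
    (1 - M.γ) * (policyReturn M π - softmaxReturn M θ) ≤ lam * mismatch M π := by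
  classical
  have hN : (0 : ℝ) < Fintype.card A := by exact_mod_cast Fintype.card_pos
  have hS : (0 : ℝ) < Fintype.card S := by exact_mod_cast Fintype.card_pos
  have hg : 0 < 1 - M.γ := sub_pos.2 M.γ_lt_one
  obtain ⟨V, hV⟩ := exists_value_function M (softmaxPolicy θ)
  have hV' : ∀ s, ∑ a, softmaxProb θ s a * advantage M V s a = 0 := by
    simpa only [softmaxPolicy_toReal] using hV
  -- Test the gradient on the coordinate (s, a). The barrier contributes λ/|S| · (1/|A| - π(a|s)),
  -- whose constant part exceeds the gradient threshold.
  have hadv : ∀ s a, (M.ρ s).toReal * advantage M V s a ≤ lam / Fintype.card S := by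
    intro s a
    rcases le_or_gt (advantage M V s a) 0 with h0 | h0
    · exact (mul_nonpos_of_nonneg_of_nonpos ENNReal.toReal_nonneg h0).trans (by positivity)
    set e : Param S A := EuclideanSpace.single (s, a) 1 with he
    have h1 : inner ℝ (regGrad M lam θ) e ≤ lam / (2 * Fintype.card S * Fintype.card A) := by
      refine (real_inner_le_norm _ _).trans ?_
      simpa [he] using hG
    have h2 := inner_discountedGrad M θ e hV'
    rw [Finset.sum_eq_single s, Finset.sum_eq_single a] at h2
    · have h3 : e (s, a) = 1 := by simp [he]
      rw [h3, mul_one] at h2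
      rw [regGrad, inner_add_left, real_inner_smul_left, he, inner_barrierGrad_single, ← he] at h1
      set G := inner ℝ (discountedGrad M (fun x => M.r x.1 x.2) θ) e
      have hp := softmaxProb_pos θ s a
      -- The bound is proportional to π(a|s), as is the policy gradient coordinate, so this
      -- probability cancels and no lower bound on it is required.
      have h4 : G ≤ lam / Fintype.card S * softmaxProb θ s a := by
        have h5 : lam * (1 / (Fintype.card S : ℝ) * (1 / (Fintype.card A : ℝ) - softmaxProb θ s a))
          = 2 * (lam / (2 * Fintype.card S * Fintype.card A)) -
            lam / Fintype.card S * softmaxProb θ s a := by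
          field_simp
        have h6 : 0 < lam / (2 * Fintype.card S * Fintype.card A) := by positivity
        linarith
      have h7 := mul_le_mul_of_nonneg_right (le_visitation M (softmaxPolicy θ) s)
        (mul_pos hp h0).le
      have h8 := mul_le_mul_of_nonneg_left h4 hg.le
      have h9 : (1 - M.γ) * softmaxProb θ s a * ((M.ρ s).toReal * advantage M V s a) ≤
          (1 - M.γ) * softmaxProb θ s a * (lam / Fintype.card S) := by
        nlinarith [h7, h8, h2]
      exact le_of_mul_le_mul_left h9 (mul_pos hg hp)
    · intro b _ hb
      have : e (s, b) = 0 := by simp [he, hb]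
      simp [this]
    · simp
    · intro s' _ hs
      have : ∀ b, e (s', b) = 0 := fun b => by simp [he, hs]
      simp [this]
    · simp
  rw [softmaxReturn, performance_difference M hV π]
  calc ∑ s, visitation M π s * ∑ a, (π s a).toReal * advantage M V s a
      ≤ ∑ _s : S, mismatch M π * (lam / Fintype.card S) := by
        refine Finset.sum_le_sum fun s _ => ?_
        have hpos : 0 < (M.ρ s).toReal := ENNReal.toReal_pos (hρ s) (PMF.apply_ne_top _ _)
        have h1 : ∑ a, (π s a).toReal * advantage M V s a ≤
            lam / Fintype.card S / (M.ρ s).toReal := by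
          calc ∑ a, (π s a).toReal * advantage M V s a
              ≤ ∑ a, (π s a).toReal * (lam / Fintype.card S / (M.ρ s).toReal) := by
                refine Finset.sum_le_sum fun a _ => mul_le_mul_of_nonneg_left ?_
                  ENNReal.toReal_nonneg
                rw [le_div_iff₀ hpos, mul_comm]
                exact hadv s a
            _ = _ := by rw [← Finset.sum_mul, sum_policy, one_mul]
        calc visitation M π s * ∑ a, (π s a).toReal * advantage M V s a
            ≤ mismatch M π * (M.ρ s).toReal * (lam / Fintype.card S / (M.ρ s).toReal) :=
              (mul_le_mul_of_nonneg_left h1 (visitation_nonneg M π s)).trans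
                (mul_le_mul_of_nonneg_right (visitation_le_mismatch M hρ π s) (by positivity))
          _ = _ := by field_simp
    _ = lam * mismatch M π := by
        rw [Finset.sum_const, Finset.card_univ, nsmul_eq_mul]
        field_simp

end GradientDomination

/-! ### First and second moments of averages of independent samples -/

section Product

variable {ι : Type*} [Fintype ι] {m : ℕ}

/-- Expand a product of sums in which φ is inserted in the j-th factor only; the other factors are
1. -/
lemma sum_prod_mul_apply {q : ι → ℝ} (hq : ∑ x, q x = 1) (j : Fin m) (φ : ι → ℝ) :
    ∑ b : Fin m → ι, (∏ i, q (b i)) * φ (b j) = ∑ x, q x * φ x := by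
  classical
  have h := Finset.prod_univ_sum (fun _ : Fin m => (Finset.univ : Finset ι))
    fun i x => q x * if i = j then φ x else 1
  rw [Fintype.piFinset_univ] at h
  simp only [Finset.prod_mul_distrib, Finset.prod_ite_eq', Finset.mem_univ, if_true] at h
  rw [← h, Finset.prod_eq_single j]
  · simp
  · intro i _ hi
    simp [hi, hq]
  · simp

lemma sum_prod_mul_apply_mul_apply {q : ι → ℝ} (hq : ∑ x, q x = 1) {j k : Fin m} (hjk : j ≠ k)
    (φ ψ : ι → ℝ) :
    ∑ b : Fin m → ι, (∏ i, q (b i)) * (φ (b j) * ψ (b k)) =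
      (∑ x, q x * φ x) * ∑ x, q x * ψ x := by
  classical
  have h := Finset.prod_univ_sum (fun _ : Fin m => (Finset.univ : Finset ι))
    fun i x => q x * ((if i = j then φ x else 1) * if i = k then ψ x else 1)
  rw [Fintype.piFinset_univ] at h
  simp only [Finset.prod_mul_distrib, Finset.prod_ite_eq', Finset.mem_univ, if_true] at h
  rw [← h, Finset.prod_eq_mul j k hjk]
  · simp [hjk, hjk.symm]
  · intro i _ hi
    simp [hi.1, hi.2, hq]
  · simp
  · simp

variable {E : Type*} [NormedAddCommGroup E] [InnerProductSpace ℝ E]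

lemma sum_prod_smul_apply {q : ι → ℝ} (hq : ∑ x, q x = 1) (j : Fin m) (X : ι → E) :
    ∑ b : Fin m → ι, (∏ i, q (b i)) • X (b j) = ∑ x, q x • X x := by
  refine ext_inner_right ℝ fun v => ?_
  simp only [sum_inner, real_inner_smul_left]
  exact sum_prod_mul_apply hq j fun x => inner ℝ (X x) v

/-- Writing the inner product through indicators of the values b j and b k reduces the vector
statement to the scalar factorization over two distinct coordinates. -/
lemma sum_prod_mul_inner {q : ι → ℝ} (hq : ∑ x, q x = 1) {j k : Fin m} (hjk : j ≠ k) (X : ι → E) :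
    ∑ b : Fin m → ι, (∏ i, q (b i)) * inner ℝ (X (b j)) (X (b k)) = ‖∑ x, q x • X x‖ ^ 2 := by
  classical
  have h1 : ∀ b : Fin m → ι, inner ℝ (X (b j)) (X (b k)) = ∑ x, ∑ y, inner ℝ (X x) (X y) *
      ((if b j = x then 1 else 0) * if b k = y then 1 else 0) := by
    intro b
    simp
  simp only [h1, Finset.mul_sum]
  rw [Finset.sum_comm, ← real_inner_self_eq_norm_sq, sum_inner]
  refine Finset.sum_congr rfl fun x _ => ?_
  rw [Finset.sum_comm, inner_sum]
  refine Finset.sum_congr rfl fun y _ => ?_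
  rw [real_inner_smul_left, real_inner_smul_right]
  have h2 := sum_prod_mul_apply_mul_apply hq hjk (fun z => if z = x then 1 else 0)
    fun z => if z = y then 1 else 0
  simp only [mul_ite, mul_one, mul_zero, Finset.sum_ite_eq', Finset.mem_univ, if_true] at h2
  rw [← mul_assoc, ← h2, Finset.sum_mul]
  refine Finset.sum_congr rfl fun b _ => ?_
  split_ifs <;> ring

lemma sum_prod_eq_one {q : ι → ℝ} (hq : ∑ x, q x = 1) : ∑ b : Fin m → ι, ∏ i, q (b i) = 1 := by
  have h := Finset.prod_univ_sum (fun _ : Fin m => (Finset.univ : Finset ι)) fun _ x => q x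
  rw [Fintype.piFinset_univ] at h
  rw [← h]
  simp [hq]

/-- The mean of a batch average. -/
lemma sum_prod_smul_average {q : ι → ℝ} (hq : ∑ x, q x = 1) (hm : 1 ≤ m) (X : ι → E) :
    ∑ b : Fin m → ι, (∏ i, q (b i)) • ((1 / (m : ℝ)) • ∑ i, X (b i)) = ∑ x, q x • X x := by
  have hm0 : (m : ℝ) ≠ 0 := by positivity
  simp only [smul_comm _ (1 / (m : ℝ))]
  rw [← Finset.smul_sum]
  simp only [Finset.smul_sum (N := E) (s := (Finset.univ : Finset (Fin m)))]
  rw [Finset.sum_comm]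
  simp only [sum_prod_smul_apply hq, Finset.sum_const, Finset.card_univ, Fintype.card_fin]
  rw [← Nat.cast_smul_eq_nsmul ℝ, smul_smul, one_div_mul_cancel hm0, one_smul]

/-- The second moment of a batch average. -/
lemma sum_prod_mul_norm_average_sq_le {q : ι → ℝ} (hq : ∑ x, q x = 1) (hm : 1 ≤ m) (X : ι → E) :
    ∑ b : Fin m → ι, (∏ i, q (b i)) * ‖(1 / (m : ℝ)) • ∑ i, X (b i)‖ ^ 2 ≤
      ‖∑ x, q x • X x‖ ^ 2 + (∑ x, q x * ‖X x‖ ^ 2) / m := by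
  classical
  have hm0 : (0 : ℝ) < m := by positivity
  set μ := ∑ x, q x • X x with hμ
  set σ := ∑ x, q x * ‖X x‖ ^ 2 with hσ
  have h1 : ∀ b : Fin m → ι, (∏ i, q (b i)) * ‖(1 / (m : ℝ)) • ∑ i, X (b i)‖ ^ 2 =
      (1 / (m : ℝ)) ^ 2 * ∑ j, ∑ k, (∏ i, q (b i)) * inner ℝ (X (b j)) (X (b k)) := by
    intro b
    rw [norm_smul, mul_pow, Real.norm_eq_abs, sq_abs, ← real_inner_self_eq_norm_sq, sum_inner]
    simp only [inner_sum, Finset.mul_sum]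
    exact Finset.sum_congr rfl fun j _ => Finset.sum_congr rfl fun k _ => by ring
  simp only [h1, ← Finset.mul_sum]
  have h2 : ∀ j k : Fin m, ∑ b : Fin m → ι, (∏ i, q (b i)) * inner ℝ (X (b j)) (X (b k)) =
      ‖μ‖ ^ 2 + if j = k then σ - ‖μ‖ ^ 2 else 0 := by
    intro j k
    split_ifs with hjk
    · subst hjk
      simp only [real_inner_self_eq_norm_sq]
      rw [sum_prod_mul_apply hq j fun x => ‖X x‖ ^ 2]
      ring
    · rw [sum_prod_mul_inner hq hjk, add_zero]
  have h3 : ∑ b : Fin m → ι, ∑ j, ∑ k, (∏ i, q (b i)) * inner ℝ (X (b j)) (X (b k)) =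
      m * (m * ‖μ‖ ^ 2 + (σ - ‖μ‖ ^ 2)) := by
    rw [Finset.sum_comm]
    have h4 : ∀ j : Fin m, ∑ b : Fin m → ι, ∑ k, (∏ i, q (b i)) * inner ℝ (X (b j)) (X (b k)) =
        m * ‖μ‖ ^ 2 + (σ - ‖μ‖ ^ 2) := by
      intro j
      rw [Finset.sum_comm]
      simp only [h2, Finset.sum_add_distrib, Finset.sum_ite_eq, Finset.mem_univ, if_true,
        Finset.sum_const, Finset.card_univ, Fintype.card_fin, nsmul_eq_mul]
    simp only [h4, Finset.sum_const, Finset.card_univ, Fintype.card_fin, nsmul_eq_mul]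
  simp only [Finset.mul_sum] at h3 ⊢
  simp only [← Finset.mul_sum] at h3 ⊢
  rw [h3]
  have h5 : (1 / (m : ℝ)) ^ 2 * (m * (m * ‖μ‖ ^ 2 + (σ - ‖μ‖ ^ 2))) =
      ‖μ‖ ^ 2 + σ / m - ‖μ‖ ^ 2 / m := by
    field_simp
    ring
  rw [h5]
  -- The exact value has σ - ‖μ‖² in place of σ; discarding -‖μ‖²/m leaves the raw second moment.
  have : 0 ≤ ‖μ‖ ^ 2 / m := by positivity
  linarith

lemma sum_prod_mul_norm_average_add_sq_le {q : ι → ℝ} (hq : ∑ x, q x = 1) (hm : 1 ≤ m) (X : ι → E)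
    (c : E) :
    ∑ b : Fin m → ι, (∏ i, q (b i)) * ‖(1 / (m : ℝ)) • ∑ i, X (b i) + c‖ ^ 2 ≤
      ‖∑ x, q x • X x + c‖ ^ 2 + (∑ x, q x * ‖X x‖ ^ 2) / m := by
  have h1 : ∀ b : Fin m → ι, (∏ i, q (b i)) * ‖(1 / (m : ℝ)) • ∑ i, X (b i) + c‖ ^ 2 =
      (∏ i, q (b i)) * ‖(1 / (m : ℝ)) • ∑ i, X (b i)‖ ^ 2 +
      2 * inner ℝ ((∏ i, q (b i)) • ((1 / (m : ℝ)) • ∑ i, X (b i))) c +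
      (∏ i, q (b i)) * ‖c‖ ^ 2 := by
    intro b
    rw [norm_add_sq_real, real_inner_smul_left _ _ (∏ i, q (b i))]
    ring
  simp only [h1, Finset.sum_add_distrib, ← Finset.mul_sum, ← Finset.sum_mul, ← sum_inner]
  rw [sum_prod_smul_average hq hm, sum_prod_eq_one hq, norm_add_sq_real]
  linarith [sum_prod_mul_norm_average_sq_le hq hm X]

end Product

/-! ### Mean and second moment of REINFORCE and GPOMDP -/

section Estimators

variable {S A : Type*} [Fintype S] [MeasurableSpace S] [MeasurableSingletonClass S]
  [Fintype A] [MeasurableSpace A] [MeasurableSingletonClass A] [Nonempty S] [Nonempty A]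

/-- The gradient estimator computed on one trajectory. -/
def pathEstimate (M : MDP S A) (e : Estimator) {H : ℕ} (θ : Param S A) (h : Fin H → S × A) :
    Param S A :=
  match e with
  | .reinforce => (∑ t : Fin H, M.γ ^ (t : ℕ) * M.r (h t).1 (h t).2) • prefixScore θ h
  | .gpomdp => ∑ t : Fin H, (M.γ ^ (t : ℕ) * M.r (h t).1 (h t).2) •
      ∑ k ∈ Finset.Iic t, score θ (h k).1 (h k).2

lemma gradEstimate_eq (M : MDP S A) (e : Estimator) {m H : ℕ} (θ : Param S A)
    (b : Fin m → Fin H → S × A) :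
    gradEstimate M e θ b = (1 / (m : ℝ)) • ∑ i, pathEstimate M e θ (b i) := by
  cases e <;> rfl

/-- Scores of later actions have mean zero given the past. Here this follows from uniqueness of the
derivative: both vectors differentiate the same function of θ. It is why both estimators have the
same mean. -/
lemma prefixGrad_castLE (M : MDP S A) (θ : Param S A) {n N : ℕ} (hn : n ≤ N)
    (F : (Fin n → S × A) → ℝ) :
    prefixGrad M θ (fun h : Fin N → S × A => F fun k => h (Fin.castLE hn k)) =
      prefixGrad M θ F := by
  refine ext_inner_right ℝ fun v => ?_
  have h1 := hasDerivAt_prefix M θ v (fun h : Fin N → S × A => F fun k => h (Fin.castLE hn k))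
  simp only [sum_prefixProb_castLE M _ hn F] at h1
  exact h1.unique (hasDerivAt_prefix M θ v F)

lemma pairGrad_eq (M : MDP S A) (f : S × A → ℝ) (θ : Param S A) {H : ℕ} (t : Fin H) :
    pairGrad M f θ t = prefixGrad M θ fun h : Fin H → S × A => f (h t) :=
  (prefixGrad_castLE M θ (Nat.succ_le_of_lt t.2) fun h => f (h (Fin.last t))).symm

lemma sum_Iic_score (θ : Param S A) {H : ℕ} (t : Fin H) (h : Fin H → S × A) :
    ∑ k ∈ Finset.Iic t, score θ (h k).1 (h k).2 =
      prefixScore θ fun k : Fin ((t : ℕ) + 1) => h (Fin.castLE (Nat.succ_le_of_lt t.2) k) := by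
  rw [prefixScore]
  symm
  refine Finset.sum_bij (fun k _ => Fin.castLE (Nat.succ_le_of_lt t.2) k) ?_ ?_ ?_ ?_
  · intro k _
    rw [Finset.mem_Iic, Fin.le_def]
    exact Nat.lt_succ_iff.1 k.2
  · intro k _ l _ hkl
    exact Fin.castLE_injective _ hkl
  · intro k hk
    rw [Finset.mem_Iic, Fin.le_def] at hk
    exact ⟨⟨k, Nat.lt_succ_iff.2 hk⟩, Finset.mem_univ _, rfl⟩
  · intro k _
    rfl

/-- The mean of the estimator is the gradient of the truncated return. -/
lemma sum_prefixProb_smul_pathEstimate (M : MDP S A) (e : Estimator) (H : ℕ) (θ : Param S A) :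
    ∑ h : Fin H → S × A, prefixProb M (softmaxPolicy θ) h • pathEstimate M e θ h =
      truncatedGrad M (fun x => M.r x.1 x.2) θ H := by
  rw [truncatedGrad, Finset.sum_range]
  cases e with
  | reinforce =>
    simp only [pairGrad_eq, prefixGrad, pathEstimate, Finset.smul_sum, smul_smul]
    rw [Finset.sum_comm]
    refine Finset.sum_congr rfl fun h _ => ?_
    rw [← Finset.sum_smul, Finset.mul_sum]
    congr 1
    exact Finset.sum_congr rfl fun t _ => by ring
  | gpomdp =>
    simp only [pathEstimate, Finset.smul_sum (s := (Finset.univ : Finset (Fin H)))]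
    rw [Finset.sum_comm]
    refine Finset.sum_congr rfl fun t _ => ?_
    refine ext_inner_right ℝ fun v => ?_
    simp only [sum_Iic_score, pairGrad, prefixGrad, Finset.smul_sum, sum_inner,
      real_inner_smul_left]
    refine (sum_prefixProb_castLE M (softmaxPolicy θ) (Nat.succ_le_of_lt t.2)
      (fun h => M.γ ^ (t : ℕ) * M.r (h (Fin.last t)).1 (h (Fin.last t)).2 *
        inner ℝ (prefixScore θ h) v)).trans ?_
    exact Finset.sum_congr rfl fun h _ => by ring

/-- The trace of the one-step Fisher matrix; bounding each variance by a raw second moment gives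
total mass 1, free of |A|. -/
lemma sum_softmaxVar_single_le [DecidableEq S] [DecidableEq A] (θ : Param S A) (s : S) :
    ∑ i, softmaxVar θ (EuclideanSpace.single i 1) s ≤ 1 := by
  calc ∑ i, softmaxVar θ (EuclideanSpace.single i 1) s
      ≤ ∑ i, ∑ a, softmaxProb θ s a * (EuclideanSpace.single i (1 : ℝ) : Param S A) (s, a) ^ 2 :=
        Finset.sum_le_sum fun i _ => softmaxVar_le_sum θ _ s
    _ = ∑ a, softmaxProb θ s a := by
        rw [Finset.sum_comm]
        refine Finset.sum_congr rfl fun a _ => ?_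
        rw [← Finset.mul_sum]
        simp [Finset.sum_ite_eq]
    _ = 1 := sum_softmaxProb θ s

/-- Expand the norm in coordinates; the Fisher identity replaces each squared sum of scores by a sum
of variances. Cross terms between times disappear, so growth is linear in n instead of quadratic. -/
lemma sum_prefixProb_norm_prefixScore_sq_le (M : MDP S A) (θ : Param S A) (n : ℕ) :
    ∑ h : Fin n → S × A, prefixProb M (softmaxPolicy θ) h * ‖prefixScore θ h‖ ^ 2 ≤ n := by
  classical
  have h1 : ∀ x : Param S A, ‖x‖ ^ 2 = ∑ i, (inner ℝ x (EuclideanSpace.single i 1)) ^ 2 := by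
    intro x
    rw [EuclideanSpace.real_norm_sq_eq]
    simp [EuclideanSpace.inner_single_right]
  have h2 : ∀ i : S × A, ∑ h : Fin n → S × A, prefixProb M (softmaxPolicy θ) h *
      (inner ℝ (prefixScore θ h) (EuclideanSpace.single i 1)) ^ 2 =
      ∑ h : Fin n → S × A, prefixProb M (softmaxPolicy θ) h *
        ∑ k, softmaxVar θ (EuclideanSpace.single i 1) (h k).1 := by
    intro i
    have := (isScoreFamily_prefixProb M θ (EuclideanSpace.single i 1) n).sum_score_sq 0
    simpa only [zero_smul, add_zero, ← inner_prefixScore] using this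
  simp only [h1, Finset.mul_sum]
  rw [Finset.sum_comm]
  simp only [h2]
  rw [Finset.sum_comm]
  calc ∑ h : Fin n → S × A, ∑ i, prefixProb M (softmaxPolicy θ) h *
        ∑ k, softmaxVar θ (EuclideanSpace.single i 1) (h k).1
      ≤ ∑ h : Fin n → S × A, prefixProb M (softmaxPolicy θ) h * n := by
        refine Finset.sum_le_sum fun h _ => ?_
        rw [← Finset.mul_sum, Finset.sum_comm]
        refine mul_le_mul_of_nonneg_left ?_ (prefixProb_nonneg _ _ _)
        calc ∑ k, ∑ i, softmaxVar θ (EuclideanSpace.single i 1) (h k).1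
            ≤ ∑ _k : Fin n, (1 : ℝ) := Finset.sum_le_sum fun k _ => sum_softmaxVar_single_le θ _
          _ = n := by simp
    _ = n := by rw [← Finset.sum_mul, sum_prefixProb, one_mul]

/-- The bound on the second moment of the one-trajectory estimator. -/
def pathVar (e : Estimator) (H : ℕ) (γ R : ℝ) : ℝ :=
  match e with
  | .reinforce => (H : ℝ) * R ^ 2 / (1 - γ) ^ 2
  | .gpomdp => R ^ 2 / (1 - γ) ^ 3

lemma sum_range_pow_le {γ : ℝ} (h0 : 0 ≤ γ) (h1 : γ < 1) (H : ℕ) :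
    ∑ t : Fin H, γ ^ (t : ℕ) ≤ 1 / (1 - γ) := by
  rw [← Finset.sum_range (fun t => γ ^ t), one_div, ← tsum_geometric_of_lt_one h0 h1]
  exact (summable_geometric_of_lt_one h0 h1).sum_le_tsum _ fun t _ => pow_nonneg h0 t

lemma sum_prefixProb_norm_pathEstimate_sq_le (M : MDP S A) (e : Estimator) (H : ℕ) (θ : Param S A)
    {R : ℝ} (hr : ∀ s a, |M.r s a| ≤ R) :
    ∑ h : Fin H → S × A, prefixProb M (softmaxPolicy θ) h * ‖pathEstimate M e θ h‖ ^ 2 ≤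
      pathVar e H M.γ R := by
  have hg : 0 < 1 - M.γ := sub_pos.2 M.γ_lt_one
  have hγ := M.γ_nonneg
  have hR : 0 ≤ R := (abs_nonneg _).trans (hr (Classical.arbitrary S) (Classical.arbitrary A))
  have hsum := sum_range_pow_le M.γ_nonneg M.γ_lt_one H
  have hc : ∀ (h : Fin H → S × A) (t : Fin H), |M.γ ^ (t : ℕ) * M.r (h t).1 (h t).2| ≤
      M.γ ^ (t : ℕ) * R := fun h t => by
    rw [abs_mul, abs_of_nonneg (pow_nonneg hγ _)]
    exact mul_le_mul_of_nonneg_left (hr _ _) (pow_nonneg hγ _)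
  cases e with
  | reinforce =>
    -- The return factor is bounded by R/(1 - γ) on every path, leaving the second moment of the
    -- full score.
    have h1 : ∀ h : Fin H → S × A, ‖pathEstimate M .reinforce θ h‖ ^ 2 ≤
        (R / (1 - M.γ)) ^ 2 * ‖prefixScore θ h‖ ^ 2 := by
      intro h
      rw [pathEstimate, norm_smul, mul_pow]
      refine mul_le_mul_of_nonneg_right (pow_le_pow_left₀ (norm_nonneg _) ?_ 2) (sq_nonneg _)
      refine (norm_sum_le _ _).trans ((Finset.sum_le_sum fun t _ => hc h t).trans ?_)
      rw [← Finset.sum_mul, mul_comm, div_eq_mul_one_div]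
      exact mul_le_mul_of_nonneg_left hsum hR
    calc _ ≤ ∑ h : Fin H → S × A, (R / (1 - M.γ)) ^ 2 *
          (prefixProb M (softmaxPolicy θ) h * ‖prefixScore θ h‖ ^ 2) := by
          refine Finset.sum_le_sum fun h _ => ?_
          rw [mul_left_comm]
          exact mul_le_mul_of_nonneg_left (h1 h) (prefixProb_nonneg _ _ _)
      _ ≤ (R / (1 - M.γ)) ^ 2 * H := by
          rw [← Finset.mul_sum]
          exact mul_le_mul_of_nonneg_left (sum_prefixProb_norm_prefixScore_sq_le M θ H)
            (sq_nonneg _)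
      _ = _ := by rw [pathVar, div_pow]; ring
  | gpomdp =>
    have h1 : ∀ h : Fin H → S × A, ‖pathEstimate M .gpomdp θ h‖ ^ 2 ≤
        R ^ 2 * (1 / (1 - M.γ)) * ∑ t : Fin H, M.γ ^ (t : ℕ) *
          ‖prefixScore θ fun k : Fin ((t : ℕ) + 1) =>
            h (Fin.castLE (Nat.succ_le_of_lt t.2) k)‖ ^ 2 := by
      intro h
      simp only [pathEstimate, sum_Iic_score]
      set Y : Fin H → ℝ := fun t => ‖prefixScore θ fun k : Fin ((t : ℕ) + 1) =>
            h (Fin.castLE (Nat.succ_le_of_lt t.2) k)‖ with hY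
      have h2 : ‖∑ t : Fin H, (M.γ ^ (t : ℕ) * M.r (h t).1 (h t).2) •
          prefixScore θ fun k : Fin ((t : ℕ) + 1) => h (Fin.castLE (Nat.succ_le_of_lt t.2) k)‖ ≤
          R * ∑ t : Fin H, M.γ ^ (t : ℕ) * Y t := by
        refine (norm_sum_le _ _).trans ?_
        rw [Finset.mul_sum]
        refine Finset.sum_le_sum fun t _ => ?_
        rw [norm_smul, Real.norm_eq_abs, ← mul_assoc, mul_comm R]
        exact mul_le_mul_of_nonneg_right (hc h t) (norm_nonneg _)
      -- Cauchy–Schwarz with weights γ^t. Each score of length t + 1 then has second moment at most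
      -- t + 1, so the bound is uniform in H.
      have h3 : (∑ t : Fin H, M.γ ^ (t : ℕ) * Y t) ^ 2 ≤
          (∑ t : Fin H, M.γ ^ (t : ℕ)) * ∑ t : Fin H, M.γ ^ (t : ℕ) * Y t ^ 2 :=
        Finset.sum_sq_le_sum_mul_sum_of_sq_le_mul _ (fun t _ => pow_nonneg hγ _)
          (fun t _ => mul_nonneg (pow_nonneg hγ _) (sq_nonneg _)) fun t _ => le_of_eq (by ring)
      have h4 : 0 ≤ ∑ t : Fin H, M.γ ^ (t : ℕ) * Y t ^ 2 :=
        Finset.sum_nonneg fun t _ => mul_nonneg (pow_nonneg hγ _) (sq_nonneg _)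
      calc _ ≤ (R * ∑ t : Fin H, M.γ ^ (t : ℕ) * Y t) ^ 2 :=
            pow_le_pow_left₀ (norm_nonneg _) h2 2
        _ = R ^ 2 * (∑ t : Fin H, M.γ ^ (t : ℕ) * Y t) ^ 2 := mul_pow _ _ _
        _ ≤ R ^ 2 * ((1 / (1 - M.γ)) * ∑ t : Fin H, M.γ ^ (t : ℕ) * Y t ^ 2) :=
            mul_le_mul_of_nonneg_left (h3.trans (mul_le_mul_of_nonneg_right hsum h4)) (sq_nonneg R)
        _ = _ := (mul_assoc _ _ _).symm
    calc _ ≤ ∑ h : Fin H → S × A, prefixProb M (softmaxPolicy θ) h *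
          (R ^ 2 * (1 / (1 - M.γ)) * ∑ t : Fin H, M.γ ^ (t : ℕ) *
          ‖prefixScore θ fun k : Fin ((t : ℕ) + 1) =>
            h (Fin.castLE (Nat.succ_le_of_lt t.2) k)‖ ^ 2) :=
          Finset.sum_le_sum fun h _ => mul_le_mul_of_nonneg_left (h1 h) (prefixProb_nonneg _ _ _)
      _ = R ^ 2 * (1 / (1 - M.γ)) * ∑ t : Fin H, M.γ ^ (t : ℕ) *
          ∑ h : Fin H → S × A, prefixProb M (softmaxPolicy θ) h *
            ‖prefixScore θ fun k : Fin ((t : ℕ) + 1) =>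
            h (Fin.castLE (Nat.succ_le_of_lt t.2) k)‖ ^ 2 := by
          simp only [Finset.mul_sum]
          rw [Finset.sum_comm]
          exact Finset.sum_congr rfl fun t _ => Finset.sum_congr rfl fun h _ => by ring
      _ ≤ R ^ 2 * (1 / (1 - M.γ)) * (1 / (1 - M.γ) ^ 2) := by
          refine mul_le_mul_of_nonneg_left ?_ (by positivity)
          have h5 := hasSum_pow_mul_succ M.γ_nonneg M.γ_lt_one
          rw [← h5.tsum_eq]
          refine le_trans ?_ (h5.summable.sum_le_tsum (Finset.range H) fun t _ =>
            mul_nonneg (pow_nonneg hγ t) (by positivity))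
          rw [Finset.sum_range]
          refine Finset.sum_le_sum fun t _ => mul_le_mul_of_nonneg_left ?_ (pow_nonneg hγ _)
          rw [sum_prefixProb_castLE M (softmaxPolicy θ) (Nat.succ_le_of_lt t.2)
            fun h => ‖prefixScore θ h‖ ^ 2]
          refine (sum_prefixProb_norm_prefixScore_sq_le M θ _).trans (le_of_eq ?_)
          push_cast
          ring
      _ = _ := by rw [pathVar]; field_simp

lemma regGradEstimate_eq (M : MDP S A) (e : Estimator) (lam : ℝ) {m H : ℕ} (θ : Param S A)
    (b : Fin m → Fin H → S × A) :
    regGradEstimate M e lam θ b =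
      (1 / (m : ℝ)) • ∑ i, pathEstimate M e θ (b i) + lam • barrierGrad θ := by
  rw [regGradEstimate, gradEstimate_eq, barrierGrad, smul_smul, mul_one_div]

/-- The mean of the regularized gradient estimator. -/
def meanEstimate (M : MDP S A) (lam : ℝ) (H : ℕ) (θ : Param S A) : Param S A :=
  truncatedGrad M (fun x => M.r x.1 x.2) θ H + lam • barrierGrad θ

lemma sum_batchLaw (M : MDP S A) (π : Policy S A) (m H : ℕ) :
    ∑ b : Fin m → Fin H → S × A, (batchLaw M π m H b).toReal = 1 := by
  simp only [batchLaw_apply]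
  exact sum_prod_eq_one (sum_prefixProb M π H)

lemma sum_batchLaw_smul_regGradEstimate (M : MDP S A) (e : Estimator) (lam : ℝ) {m : ℕ}
    (hm : 1 ≤ m) (H : ℕ) (θ : Param S A) :
    ∑ b, (batchLaw M (softmaxPolicy θ) m H b).toReal • regGradEstimate M e lam θ b =
      meanEstimate M lam H θ := by
  simp only [regGradEstimate_eq, smul_add _ (_ • _) (lam • _), Finset.sum_add_distrib,
    ← Finset.sum_smul, sum_batchLaw, one_smul]
  simp only [batchLaw_apply]
  rw [sum_prod_smul_average (sum_prefixProb M (softmaxPolicy θ) H) hm (pathEstimate M e θ),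
    sum_prefixProb_smul_pathEstimate, meanEstimate]

lemma sum_batchLaw_norm_regGradEstimate_sq_le (M : MDP S A) (e : Estimator) (lam : ℝ) {m : ℕ}
    (hm : 1 ≤ m) (H : ℕ) (θ : Param S A) {R : ℝ} (hr : ∀ s a, |M.r s a| ≤ R) :
    ∑ b, (batchLaw M (softmaxPolicy θ) m H b).toReal * ‖regGradEstimate M e lam θ b‖ ^ 2 ≤
      ‖meanEstimate M lam H θ‖ ^ 2 + pathVar e H M.γ R / m := by
  simp only [regGradEstimate_eq, batchLaw_apply]
  refine (sum_prod_mul_norm_average_add_sq_le (sum_prefixProb M (softmaxPolicy θ) H) hm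
    (pathEstimate M e θ) _).trans ?_
  rw [sum_prefixProb_smul_pathEstimate, meanEstimate]
  gcongr
  exact sum_prefixProb_norm_pathEstimate_sq_le M e H θ hr

end Estimators

/-! ### Expectations under finitely supported laws -/

section Expectation

variable {α : Type*}

/-- The expectation of a real function under a probability mass function. -/
def pmfExp (p : PMF α) (f : α → ℝ) : ℝ := ∑' a, (p a).toReal * f a

lemma pmfExp_eq_sum {p : PMF α} (hp : p.support.Finite) (f : α → ℝ) :
    pmfExp p f = ∑ a ∈ hp.toFinset, (p a).toReal * f a := by
  refine tsum_eq_sum fun a ha => ?_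
  rw [Set.Finite.mem_toFinset, PMF.mem_support_iff, not_not] at ha
  simp [ha]

lemma pmfExp_const {p : PMF α} (hp : p.support.Finite) (c : ℝ) : pmfExp p (fun _ => c) = c := by
  rw [pmfExp_eq_sum hp, ← Finset.sum_mul, ← ENNReal.toReal_sum fun a _ => PMF.apply_ne_top _ _]
  have h : ∑ a ∈ hp.toFinset, p a = 1 := by
    rw [← PMF.tsum_coe p]
    refine (tsum_eq_sum fun a ha => ?_).symm
    rwa [Set.Finite.mem_toFinset, PMF.mem_support_iff, not_not] at ha
  rw [h, ENNReal.toReal_one, one_mul]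

lemma pmfExp_mono {p : PMF α} (hp : p.support.Finite) {f g : α → ℝ} (h : ∀ a, f a ≤ g a) :
    pmfExp p f ≤ pmfExp p g := by
  rw [pmfExp_eq_sum hp, pmfExp_eq_sum hp]
  exact Finset.sum_le_sum fun a _ => mul_le_mul_of_nonneg_left (h a) ENNReal.toReal_nonneg

lemma pmfExp_add {p : PMF α} (hp : p.support.Finite) (f g : α → ℝ) :
    pmfExp p (fun a => f a + g a) = pmfExp p f + pmfExp p g := by
  simp only [pmfExp_eq_sum hp, mul_add, Finset.sum_add_distrib]

lemma pmfExp_const_mul {p : PMF α} (c : ℝ) (f : α → ℝ) :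
    pmfExp p (fun a => c * f a) = c * pmfExp p f := by
  simp only [pmfExp, ← tsum_mul_left]
  exact tsum_congr fun a => by ring

lemma finite_support_bind_map {β : Type*} [Finite β] {p : PMF α} (hp : p.support.Finite)
    (q : α → PMF β) (g : α → β → α) :
    (p.bind fun a => (q a).map (g a)).support.Finite := by
  rw [PMF.support_bind]
  refine hp.biUnion fun a _ => ?_
  rw [PMF.support_map]
  exact (Set.toFinite _).image _

lemma pmfExp_bind_map {β : Type*} [Fintype β] {p : PMF α} (hp : p.support.Finite)
    (q : α → PMF β) (g : α → β → α) (f : α → ℝ) :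
    pmfExp (p.bind fun a => (q a).map (g a)) f =
      pmfExp p fun a => ∑ b, (q a b).toReal * f (g a b) := by
  classical
  have h1 : ∀ x, ((p.bind fun a => (q a).map (g a)) x).toReal =
      ∑ a ∈ hp.toFinset, ∑ b, if x = g a b then (p a).toReal * (q a b).toReal else 0 := by
    intro x
    have h2 : (p.bind fun a => (q a).map (g a)) x =
        ∑ a ∈ hp.toFinset, p a * ∑ b, if x = g a b then q a b else 0 := by
      rw [PMF.bind_apply, tsum_eq_sum (s := hp.toFinset)]
      · refine Finset.sum_congr rfl fun a _ => ?_
        rw [PMF.map_apply, tsum_fintype]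
      · intro a ha
        rw [Set.Finite.mem_toFinset, PMF.mem_support_iff, not_not] at ha
        simp [ha]
    have hne : ∀ a, (∑ b, if x = g a b then q a b else 0) ≠ ⊤ := fun a =>
      ENNReal.sum_ne_top.2 fun b _ => by
        split_ifs
        · exact PMF.apply_ne_top _ _
        · exact ENNReal.zero_ne_top
    rw [h2, ENNReal.toReal_sum fun a _ => ENNReal.mul_ne_top (PMF.apply_ne_top _ _) (hne a)]
    refine Finset.sum_congr rfl fun a _ => ?_
    rw [ENNReal.toReal_mul, ENNReal.toReal_sum, Finset.mul_sum]
    · refine Finset.sum_congr rfl fun b _ => ?_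
      split_ifs <;> simp
    · intro b _
      split_ifs
      · exact PMF.apply_ne_top _ _
      · exact ENNReal.zero_ne_top
  rw [pmfExp_eq_sum hp, pmfExp]
  have h3 : HasSum (fun x => ((p.bind fun a => (q a).map (g a)) x).toReal * f x)
      (∑ a ∈ hp.toFinset, ∑ b, (p a).toReal * (q a b).toReal * f (g a b)) := by
    simp only [h1, Finset.sum_mul]
    refine hasSum_sum fun a _ => hasSum_sum fun b _ => ?_
    have := hasSum_ite_eq (g a b) ((p a).toReal * (q a b).toReal * f (g a b))
    refine this.congr_fun fun x => ?_
    split_ifs with hx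
    · rw [hx]
    · rw [zero_mul]
  rw [h3.tsum_eq]
  refine Finset.sum_congr rfl fun a _ => ?_
  rw [Finset.mul_sum]
  exact Finset.sum_congr rfl fun b _ => by ring

end Expectation

/-! ### Expected ascent per step and pointwise regret bound -/

section Descent

variable {S A : Type*} [Fintype S] [MeasurableSpace S] [MeasurableSingletonClass S]
  [Fintype A] [MeasurableSpace A] [MeasurableSingletonClass A] [Nonempty S] [Nonempty A]

lemma abs_policyReturn_le (M : MDP S A) (π : Policy S A) {R : ℝ} (hr : ∀ s a, |M.r s a| ≤ R) :
    |policyReturn M π| ≤ R / (1 - M.γ) := by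
  rw [policyReturn_eq, discountedSum, ← Real.norm_eq_abs, div_eq_inv_mul]
  refine tsum_of_norm_bounded
    ((hasSum_geometric_of_lt_one M.γ_nonneg M.γ_lt_one).mul_right R) fun t => ?_
  rw [norm_mul, Real.norm_eq_abs, Real.norm_eq_abs, abs_of_nonneg (pow_nonneg M.γ_nonneg t)]
  exact mul_le_mul_of_nonneg_left (abs_sum_pairProb_mul_le M π t fun x => hr x.1 x.2)
    (pow_nonneg M.γ_nonneg t)

lemma exists_abs_reward_le (M : MDP S A) : ∃ R, ∀ s a, |M.r s a| ≤ R := by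
  obtain ⟨R, -, hR⟩ := exists_abs_le fun x : S × A => M.r x.1 x.2
  exact ⟨R, fun s a => hR (s, a)⟩

lemma bddAbove_softmaxReturn (M : MDP S A) : BddAbove (Set.range (softmaxReturn M)) := by
  obtain ⟨R, hR⟩ := exists_abs_reward_le M
  refine ⟨R / (1 - M.γ), ?_⟩
  rintro _ ⟨θ, rfl⟩
  exact (le_abs_self _).trans (abs_policyReturn_le M _ hR)

lemma softmaxReturn_le_optReturn (M : MDP S A) (θ : Param S A) :
    softmaxReturn M θ ≤ optReturn M :=
  le_ciSup (bddAbove_softmaxReturn M) θ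

lemma regReturn_le_optReturn (M : MDP S A) {lam : ℝ} (hlam : 0 ≤ lam) (θ : Param S A) :
    regReturn M lam θ ≤ optReturn M := by
  have := mul_nonneg hlam (barrier_nonneg θ)
  rw [regReturn]
  linarith [softmaxReturn_le_optReturn M θ]

lemma regReturn_le_optRegReturn (M : MDP S A) {lam : ℝ} (hlam : 0 ≤ lam) (θ : Param S A) :
    regReturn M lam θ ≤ optRegReturn M lam := by
  refine le_ciSup (f := regReturn M lam) ⟨optReturn M, ?_⟩ θ
  rintro _ ⟨ϑ, rfl⟩
  exact regReturn_le_optReturn M hlam ϑ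

lemma optRegReturn_le_optReturn (M : MDP S A) {lam : ℝ} (hlam : 0 ≤ lam) :
    optRegReturn M lam ≤ optReturn M :=
  ciSup_le fun θ => regReturn_le_optReturn M hlam θ

/-- The expected improvement of one step of vanilla policy gradient. -/
lemma regReturn_step_le (M : MDP S A) (e : Estimator) {lam η β R : ℝ} {m : ℕ} (hm : 1 ≤ m) (H : ℕ)
    (hlam : 0 ≤ lam) (hη : 0 ≤ η) (hr : ∀ s a, |M.r s a| ≤ R)
    (hηL : η * (R / (1 - M.γ) ^ 2 + lam / (2 * Fintype.card S)) ≤ 1)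
    (hβ : ∀ θ : Param S A, ‖regGrad M lam θ - meanEstimate M lam H θ‖ ≤ β) (θ : Param S A) :
    regReturn M lam θ + (η / 2 * ‖regGrad M lam θ‖ ^ 2 + -(η / 2 * (β ^ 2 +
      η * (R / (1 - M.γ) ^ 2 + lam / (2 * Fintype.card S)) * (pathVar e H M.γ R / m)))) ≤
      ∑ b, (batchLaw M (softmaxPolicy θ) m H b).toReal *
        regReturn M lam (θ + η • regGradEstimate M e lam θ b) := by
  have hg : 0 < 1 - M.γ := sub_pos.2 M.γ_lt_one
  have hR : 0 ≤ R := (abs_nonneg _).trans (hr (Classical.arbitrary S) (Classical.arbitrary A))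
  set L' := R / (1 - M.γ) ^ 2 + lam / (2 * Fintype.card S) with hL'
  have hL'0 : 0 ≤ L' := by positivity
  set G := regGrad M lam θ
  set μ := meanEstimate M lam H θ with hμ
  set w := fun b => (batchLaw M (softmaxPolicy θ) m H b).toReal with hw
  have h1 : ∑ b, w b * (regReturn M lam θ + inner ℝ G (η • regGradEstimate M e lam θ b) -
      L' / 2 * ‖η • regGradEstimate M e lam θ b‖ ^ 2) ≤
      ∑ b, w b * regReturn M lam (θ + η • regGradEstimate M e lam θ b) :=
    Finset.sum_le_sum fun b _ =>
      mul_le_mul_of_nonneg_left (regReturn_taylor_le M hlam hr θ _) ENNReal.toReal_nonneg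
  have h2 : ∑ b, w b * (regReturn M lam θ + inner ℝ G (η • regGradEstimate M e lam θ b) -
      L' / 2 * ‖η • regGradEstimate M e lam θ b‖ ^ 2) =
      regReturn M lam θ + η * inner ℝ G μ -
      L' / 2 * η ^ 2 * ∑ b, w b * ‖regGradEstimate M e lam θ b‖ ^ 2 := by
    have h3 : ∀ b, w b * (regReturn M lam θ + inner ℝ G (η • regGradEstimate M e lam θ b) -
        L' / 2 * ‖η • regGradEstimate M e lam θ b‖ ^ 2) =
        w b * regReturn M lam θ + η * inner ℝ G (w b • regGradEstimate M e lam θ b) -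
        L' / 2 * η ^ 2 * (w b * ‖regGradEstimate M e lam θ b‖ ^ 2) := by
      intro b
      rw [norm_smul, mul_pow, Real.norm_eq_abs, sq_abs, real_inner_smul_right,
        real_inner_smul_right]
      ring
    simp only [h3, Finset.sum_sub_distrib, Finset.sum_add_distrib, ← Finset.mul_sum,
      ← Finset.sum_mul, ← inner_sum]
    rw [sum_batchLaw, one_mul, sum_batchLaw_smul_regGradEstimate M e lam hm H θ]
  have h4 := sum_batchLaw_norm_regGradEstimate_sq_le M e lam hm H θ hr
  have h5 := mul_le_mul_of_nonneg_left h4 (by positivity : 0 ≤ L' / 2 * η ^ 2)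
  -- Polarization handles the truncation bias G - μ. The quadratic term of the smoothness bound also
  -- contains ‖μ‖², and ηL' ≤ 1 lets the two be dropped together.
  have h6 : 2 * inner ℝ G μ = ‖G‖ ^ 2 + ‖μ‖ ^ 2 - ‖G - μ‖ ^ 2 := by
    rw [norm_sub_sq_real]
    ring
  have h7 : ‖G - μ‖ ^ 2 ≤ β ^ 2 := pow_le_pow_left₀ (norm_nonneg _) (hβ θ) 2
  have h8 : 0 ≤ (1 - η * L') * (η * ‖μ‖ ^ 2) := mul_nonneg (sub_nonneg.2 hηL) (by positivity)
  have h9 : 0 ≤ η * (β ^ 2 - ‖G - μ‖ ^ 2) := mul_nonneg hη (sub_nonneg.2 h7)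
  refine le_trans ?_ h1
  rw [h2]
  have h10 : L' / 2 * η ^ 2 * (‖μ‖ ^ 2 + pathVar e H M.γ R / m) =
    η / 2 * (η * L') * ‖μ‖ ^ 2 + η / 2 * (η * L' * (pathVar e H M.γ R / m)) := by ring
  rw [h10] at h5
  have h11 : η * inner ℝ G μ = η / 2 * (‖G‖ ^ 2 + ‖μ‖ ^ 2 - ‖G - μ‖ ^ 2) := by rw [← h6]; ring
  rw [h11]
  linarith

lemma finite_support_iterateLaw (M : MDP S A) (e : Estimator) (lam η : ℝ) (m H : ℕ)
    (θ₀ : Param S A) (t : ℕ) : (iterateLaw M e lam η m H θ₀ t).support.Finite := by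
  induction t with
  | zero =>
    rw [iterateLaw, PMF.support_pure]
    exact Set.finite_singleton _
  | succ t ih =>
    rw [iterateLaw]
    exact finite_support_bind_map ih _ _

lemma pmfExp_pure (a : Param S A) (f : Param S A → ℝ) : pmfExp (PMF.pure a) f = f a := by
  classical
  rw [pmfExp, tsum_eq_single a]
  · simp
  · intro b hb
    simp [hb]

/-- The average squared norm of the gradient along vanilla policy gradient. -/
lemma sum_pmfExp_norm_regGrad_sq_le (M : MDP S A) (e : Estimator) {lam η β R : ℝ} {m : ℕ}
    (hm : 1 ≤ m) (H : ℕ) (hlam : 0 ≤ lam) (hη : 0 < η) (hr : ∀ s a, |M.r s a| ≤ R)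
    (hηL : η * (R / (1 - M.γ) ^ 2 + lam / (2 * Fintype.card S)) ≤ 1)
    (hβ : ∀ θ : Param S A, ‖regGrad M lam θ - meanEstimate M lam H θ‖ ≤ β) (θ₀ : Param S A)
    (T : ℕ) :
    ∑ t ∈ Finset.range T,
      pmfExp (iterateLaw M e lam η m H θ₀ t) (fun θ => ‖regGrad M lam θ‖ ^ 2) ≤
      2 / η * (optRegReturn M lam - regReturn M lam θ₀) + T * (β ^ 2 +
        η * (R / (1 - M.γ) ^ 2 + lam / (2 * Fintype.card S)) * (pathVar e H M.γ R / m)) := by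
  set c := β ^ 2 + η * (R / (1 - M.γ) ^ 2 + lam / (2 * Fintype.card S)) * (pathVar e H M.γ R / m)
    with hc
  set E := fun (t : ℕ) (f : Param S A → ℝ) => pmfExp (iterateLaw M e lam η m H θ₀ t) f with hE
  have hfin := finite_support_iterateLaw M e lam η m H θ₀
  have hstep : ∀ t, E t (regReturn M lam) + (η / 2 * E t (fun θ => ‖regGrad M lam θ‖ ^ 2) +
      -(η / 2 * c)) ≤ E (t + 1) (regReturn M lam) := by
    intro t
    have h1 : E (t + 1) (regReturn M lam) = E t fun θ =>
        ∑ b, (batchLaw M (softmaxPolicy θ) m H b).toReal *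
          regReturn M lam (θ + η • regGradEstimate M e lam θ b) := by
      simp only [hE]
      rw [iterateLaw, pmfExp_bind_map (hfin t)]
    rw [h1]
    refine le_trans (le_of_eq ?_) (pmfExp_mono (hfin t)
      fun θ => regReturn_step_le M e hm H hlam hη.le hr hηL hβ θ)
    rw [pmfExp_add (hfin t), pmfExp_add (hfin t), pmfExp_const_mul, pmfExp_const (hfin t)]
  -- The one-step gains telescope; noise and bias cost η/2 · c at each iteration.
  have htel : ∀ T : ℕ, η / 2 * ∑ t ∈ Finset.range T, E t (fun θ => ‖regGrad M lam θ‖ ^ 2) ≤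
      E T (regReturn M lam) - regReturn M lam θ₀ + T * (η / 2 * c) := by
    intro T
    induction T with
    | zero =>
      have : E 0 (regReturn M lam) = regReturn M lam θ₀ := pmfExp_pure _ _
      simp [this]
    | succ T ih =>
      rw [Finset.sum_range_succ, mul_add]
      push_cast
      linarith [hstep T]
  have hT : E T (regReturn M lam) ≤ optRegReturn M lam := by
    refine (pmfExp_mono (hfin T) fun θ => regReturn_le_optRegReturn M hlam θ).trans (le_of_eq ?_)
    exact pmfExp_const (hfin T) _
  have h2 : η / 2 * ∑ t ∈ Finset.range T, E t (fun θ => ‖regGrad M lam θ‖ ^ 2) ≤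
      η / 2 * (2 / η * (optRegReturn M lam - regReturn M lam θ₀) + T * c) := by
    refine (htel T).trans ?_
    have : η / 2 * (2 / η * (optRegReturn M lam - regReturn M lam θ₀) + T * c) =
      optRegReturn M lam - regReturn M lam θ₀ + T * (η / 2 * c) := by
      field_simp
    linarith
  exact le_of_mul_le_mul_left h2 (by positivity)

/-- A pointwise form of Markov's inequality. Below the threshold gradient domination applies; above
it the squared ratio of gradient to threshold is at least 1 and multiplies the trivial gap 2R/(1 -
γ). Both terms are nonnegative, so their sum covers both cases and is linear in ‖∇L_λ‖². -/
lemma optReturn_sub_le (M : MDP S A) (hρ : ∀ s, M.ρ s ≠ 0) {πstar : Policy S A}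
    (hopt : IsOptimalPolicy M πstar) {lam R : ℝ} (hlam : 0 < lam) (hr : ∀ s a, |M.r s a| ≤ R)
    (θ : Param S A) :
    optReturn M - softmaxReturn M θ ≤ lam * mismatch M πstar / (1 - M.γ) +
      2 * R / (1 - M.γ) / (lam / (2 * Fintype.card S * Fintype.card A)) ^ 2 *
        ‖regGrad M lam θ‖ ^ 2 := by
  have hg : 0 < 1 - M.γ := sub_pos.2 M.γ_lt_one
  have hR : 0 ≤ R := (abs_nonneg _).trans (hr (Classical.arbitrary S) (Classical.arbitrary A))
  have h1 : optReturn M ≤ policyReturn M πstar := ciSup_le fun θ => hopt _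
  have hD : 0 ≤ mismatch M πstar := zero_le_one.trans (one_le_mismatch M hρ πstar)
  have hS : (0 : ℝ) < Fintype.card S := by exact_mod_cast Fintype.card_pos
  have hN : (0 : ℝ) < Fintype.card A := by exact_mod_cast Fintype.card_pos
  have hτ : 0 < lam / (2 * Fintype.card S * Fintype.card A) := by positivity
  rcases le_or_gt ‖regGrad M lam θ‖ (lam / (2 * Fintype.card S * Fintype.card A)) with h | h
  · have h2 := policyReturn_sub_le_of_norm_regGrad_le M hρ πstar hlam θ h
    have h3 : policyReturn M πstar - softmaxReturn M θ ≤ lam * mismatch M πstar / (1 - M.γ) := by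
      rw [le_div_iff₀ hg]
      linarith
    have : 0 ≤ 2 * R / (1 - M.γ) / (lam / (2 * Fintype.card S * Fintype.card A)) ^ 2 *
        ‖regGrad M lam θ‖ ^ 2 := by positivity
    linarith
  · have h2 := (abs_le.1 (abs_policyReturn_le M πstar hr)).2
    have h3 := (abs_le.1 (abs_policyReturn_le M (softmaxPolicy θ) hr)).1
    have h4 : 2 * R / (1 - M.γ) ≤
        2 * R / (1 - M.γ) / (lam / (2 * Fintype.card S * Fintype.card A)) ^ 2 *
        ‖regGrad M lam θ‖ ^ 2 := by
      rw [div_mul_eq_mul_div _ (_ ^ 2), le_div_iff₀ (by positivity)]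
      exact mul_le_mul_of_nonneg_left (pow_le_pow_left₀ hτ.le h.le 2) (by positivity)
    have h5 : 0 ≤ lam * mismatch M πstar / (1 - M.γ) := by positivity
    have h6 : 2 * R / (1 - M.γ) = R / (1 - M.γ) + R / (1 - M.γ) := by ring
    rw [softmaxReturn]
    linarith

lemma expectedReturn_eq (M : MDP S A) (e : Estimator) (lam η : ℝ) (m H : ℕ) (θ₀ : Param S A)
    (t : ℕ) :
    expectedReturn M e lam η m H θ₀ t =
      pmfExp (iterateLaw M e lam η m H θ₀ t) (softmaxReturn M) := rfl

/-- The average regret is bounded as soon as the pointwise regret is. -/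
lemma averageRegret_le (M : MDP S A) (e : Estimator) (lam η : ℝ) (m H : ℕ) (θ₀ : Param S A)
    {T : ℕ} (hT : 1 ≤ T) {a c : ℝ} {f : Param S A → ℝ}
    (h : ∀ θ, optReturn M - softmaxReturn M θ ≤ a + c * f θ) :
    averageRegret M e lam η m H θ₀ T ≤
      a + c * ((1 / (T : ℝ)) * ∑ t ∈ Finset.range T, pmfExp (iterateLaw M e lam η m H θ₀ t) f) := by
  have hfin := finite_support_iterateLaw M e lam η m H θ₀
  have hT0 : (T : ℝ) ≠ 0 := by positivity
  have h1 : ∀ t, optReturn M - (a + c * pmfExp (iterateLaw M e lam η m H θ₀ t) f) ≤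
      expectedReturn M e lam η m H θ₀ t := by
    intro t
    have h2 := pmfExp_mono (hfin t) (f := fun θ => (optReturn M - a) + (-c) * f θ)
      (g := softmaxReturn M) fun θ => by linarith [h θ]
    rw [pmfExp_add (hfin t), pmfExp_const (hfin t), pmfExp_const_mul] at h2
    rw [expectedReturn_eq]
    linarith
  have h3 := Finset.sum_le_sum fun t (_ : t ∈ Finset.range T) => h1 t
  rw [Finset.sum_sub_distrib, Finset.sum_add_distrib, ← Finset.mul_sum] at h3
  simp only [Finset.sum_const, Finset.card_range, nsmul_eq_mul] at h3
  have h4 := mul_le_mul_of_nonneg_left h3 (by positivity : 0 ≤ 1 / (T : ℝ))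
  rw [averageRegret]
  have h5 : ∀ x : ℝ, 1 / (T : ℝ) * (T * optReturn M - (T * a + c * x)) =
    optReturn M - (a + c * (1 / T * x)) := fun x => by field_simp
  rw [h5] at h4
  linarith

lemma norm_regGrad_sub_meanEstimate_le (M : MDP S A) {R : ℝ} (hr : ∀ s a, |M.r s a| ≤ R) (lam : ℝ)
    (H : ℕ) (θ : Param S A) :
    ‖regGrad M lam θ - meanEstimate M lam H θ‖ ≤
      R * (M.γ ^ H * (1 / (1 - M.γ) ^ 2 + H / (1 - M.γ))) := by
  have hR : 0 ≤ R := (abs_nonneg _).trans (hr (Classical.arbitrary S) (Classical.arbitrary A))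
  rw [regGrad, meanEstimate, add_sub_add_right_eq_sub]
  exact norm_discountedGrad_sub_truncatedGrad_le M hR (fun x => hr x.1 x.2) θ H

end Descent

/-! ### Truncation error and arithmetic of the parameter sizes -/

section Parameters

/-- With x = (1 - γ)H one has γ^H ≤ e^(-x). Half of this decay absorbs the factor 1 + x; the other
half is at most ((1 - γ)ε/2)^4 because x ≥ 8ℓ. This is the origin of the constant 8. -/
lemma truncation_error_sq_le {γ ε R : ℝ} {H : ℕ} (h0 : 0 ≤ γ) (h1 : γ < 1) (hε : 0 < ε)
    (hε1 : ε < 1) (hH : 8 * Real.log (2 / ((1 - γ) * ε)) / (1 - γ) ≤ H) :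
    (R * (γ ^ H * (1 / (1 - γ) ^ 2 + H / (1 - γ)))) ^ 2 ≤ R ^ 2 * ((1 - γ) ^ 3 * ε ^ 3) := by
  have hg : 0 < 1 - γ := sub_pos.2 h1
  set g := 1 - γ with hgdef
  have hg1 : g ≤ 1 := by linarith
  set x : ℝ := g * H with hx
  have hxl : 8 * Real.log (2 / (g * ε)) ≤ x := by
    rw [div_le_iff₀ hg] at hH
    linarith
  have h2 : γ ^ H ≤ Real.exp (-x) := by
    have h3 : γ ≤ Real.exp (-g) := by
      have := Real.add_one_le_exp (-g)
      linarith
    refine (pow_le_pow_left₀ h0 h3 H).trans (le_of_eq ?_)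
    rw [← Real.exp_nat_mul, hx]
    congr 1
    ring
  have hx0 : 0 ≤ x := by positivity
  have h4 : 1 + x ≤ 2 * Real.exp (x / 2) := by
    have := Real.add_one_le_exp (x / 2)
    linarith
  have h5 : Real.exp (-x / 2) ≤ (g * ε / 2) ^ 4 := by
    have h6 : (g * ε / 2) ^ 4 = Real.exp (-(4 * Real.log (2 / (g * ε)))) := by
      rw [show -(4 * Real.log (2 / (g * ε))) = (4 : ℕ) * Real.log (g * ε / 2) by
        rw [← inv_div (g * ε) 2, Real.log_inv]; push_cast; ring, Real.exp_nat_mul,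
        Real.exp_log (by positivity)]
    rw [h6]
    refine Real.exp_le_exp.2 ?_
    linarith
  have h7 : γ ^ H * (1 + x) ≤ 2 * (g * ε / 2) ^ 4 := by
    calc γ ^ H * (1 + x) ≤ Real.exp (-x) * (2 * Real.exp (x / 2)) :=
          mul_le_mul h2 h4 (by positivity) (Real.exp_pos _).le
      _ = 2 * Real.exp (-x / 2) := by
          rw [mul_left_comm, ← Real.exp_add]
          congr 2
          ring
      _ ≤ _ := by linarith
  have hgε : 0 < g * ε := mul_pos hg hε
  have h8 : γ ^ H * (1 / g ^ 2 + H / g) ≤ g ^ 2 * ε ^ 2 := by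
    have h9 : γ ^ H * (1 / g ^ 2 + H / g) = γ ^ H * (1 + x) / g ^ 2 := by
      rw [hx]
      field_simp
    rw [h9, div_le_iff₀ (by positivity)]
    refine h7.trans ?_
    have h10 : ε ^ 4 ≤ ε ^ 2 := pow_le_pow_of_le_one hε.le hε1.le (by norm_num)
    have h11 : 2 * (g * ε / 2) ^ 4 = g ^ 4 * ε ^ 4 / 8 := by ring
    have h12 : 0 ≤ g ^ 4 * ε ^ 4 := by positivity
    have h13 := mul_le_mul_of_nonneg_left h10 (by positivity : 0 ≤ g ^ 4)
    rw [h11]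
    nlinarith
  rw [mul_pow]
  refine mul_le_mul_of_nonneg_left ?_ (sq_nonneg R)
  calc _ ≤ (g ^ 2 * ε ^ 2) ^ 2 := pow_le_pow_left₀ (by positivity) h8 2
    _ = (g * ε) ^ 4 := by ring
    _ ≤ (g * ε) ^ 3 := pow_le_pow_of_le_one hgε.le
        (mul_le_one₀ hg1 hε.le hε1.le) (by norm_num)
    _ = _ := mul_pow _ _ _

lemma exists_iteration_number {X H : ℝ} {m : ℕ} (hX : 0 ≤ X) (hm : 1 ≤ m) (hH : 0 ≤ H) :
    ∃ T : ℕ, 1 ≤ T ∧ X ≤ (T : ℝ) * m ∧ (T : ℝ) * m * H ≤ X * H + 2 * (m * H) := by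
  have hm0 : (0 : ℝ) < m := by positivity
  have h1 := Nat.le_ceil (X / m)
  have h2 := (Nat.ceil_lt_add_one (a := X / m) (by positivity)).le
  rw [div_le_iff₀ hm0] at h1
  have h3 : (X / m + 1) * m = X + m := by field_simp
  have h4 := mul_le_mul_of_nonneg_right h2 hm0.le
  rw [h3] at h4
  -- The extra 1 secures T ≥ 1 even when X = 0; with the rounding it accounts for 2m samples.
  refine ⟨⌈X / m⌉₊ + 1, by omega, ?_, ?_⟩
  · push_cast
    linarith
  · push_cast
    calc ((⌈X / m⌉₊ : ℝ) + 1) * m * H ≤ (X + 2 * m) * H :=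
          mul_le_mul_of_nonneg_right (by linarith) hH
      _ = _ := by ring

/-- Bounds on the batch size, the step size and the sample size. -/
lemma parameter_sizes {g ε κ l R L ν δ Δ η H K : ℝ} {m : ℕ} (hg : 0 < g) (hg1 : g ≤ 1) (hε : 0 < ε)
    (hε1 : ε < 1) (hκ : 1 ≤ κ) (hl : 1 / 2 ≤ l) (hR : 0 < R) (hRL : R ≤ L)
    (hL : L ≤ (2 * R + 1) / g ^ 2) (hRν : R ^ 2 / g ^ 3 ≤ ν)
    (hν : ν ≤ 4 * (R ^ 2 + 1) * (κ * l) / g ^ 3) (hδ : 0 ≤ δ) (hδΔ : δ ≤ Δ)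
    (hη : η = g ^ 3 * ε ^ 3 * m / (2 * L * ν)) (hm : 1 ≤ m)
    (hm2 : (m : ℝ) ≤ max 1 (2 * ν / (g ^ 3 * ε ^ 3))) (hH : 0 ≤ H) (hH2 : H ≤ κ * l / g)
    (hK : 100 * (2 * R + 1) * (R ^ 2 + 1) + 1 / R + 1 / R ^ 3 ≤ K) :
    2 * R ^ 2 / (g ^ 6 * ε ^ 3) ≤ 2 * ν / (g ^ 3 * ε ^ 3) ∧
    2 * ν / (g ^ 3 * ε ^ 3) ≤ K * κ * l / (g ^ 6 * ε ^ 3) ∧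
    g ^ 8 * ε ^ 3 / (K * κ * l) ≤ η ∧ η ≤ K ∧
    8 * δ * L * ν / (g ^ 6 * ε ^ 6) * H ≤ K * κ ^ 2 * l ^ 2 * Δ / (g ^ 12 * ε ^ 6) ∧
    ∃ T : ℕ, 1 ≤ T ∧ 8 * δ * L * ν / (g ^ 6 * ε ^ 6) ≤ (T : ℝ) * (m : ℝ) ∧
      (T : ℝ) * (m : ℝ) * H ≤ K * κ ^ 2 * l ^ 2 * (1 + Δ) / (g ^ 12 * ε ^ 6) := by
  have hm0 : (1 : ℝ) ≤ m := by exact_mod_cast hm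
  have hLpos : 0 < L := hR.trans_le hRL
  have hνpos : 0 < ν := lt_of_lt_of_le (by positivity) hRν
  have hl0 : 0 < l := by linarith
  have hκ0 : 0 < κ := by linarith
  have hκl : 1 / 2 ≤ κ * l := hl.trans (le_mul_of_one_le_left hl0.le hκ)
  have hΔ : 0 ≤ Δ := hδ.trans hδΔ
  set Q := (2 * R + 1) * (R ^ 2 + 1) with hQ
  have hQ1 : R ^ 2 + 1 ≤ Q := by nlinarith [mul_pos hR (by positivity : 0 < R ^ 2 + 1)]
  have hQ0 : 1 ≤ Q := by nlinarith [sq_nonneg R]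
  have hR1 : 0 < 1 / R := by positivity
  have hR3 : 0 < 1 / R ^ 3 := by positivity
  have hKQ : 100 * Q ≤ K := by rw [hQ]; linarith
  have hK0 : 0 < K := by linarith
  have hRν' : R ^ 2 ≤ ν := by
    refine le_trans ?_ hRν
    rw [le_div_iff₀ (by positivity)]
    exact mul_le_of_le_one_right (sq_nonneg R) (pow_le_one₀ hg.le hg1)
  have hν' : ν * g ^ 3 ≤ 4 * (R ^ 2 + 1) * (κ * l) := by rwa [le_div_iff₀ (by positivity)] at hν
  have hL' : L * g ^ 2 ≤ 2 * R + 1 := by rwa [le_div_iff₀ (by positivity)] at hL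
  have hH' : H * g ≤ κ * l := by rwa [le_div_iff₀ hg] at hH2
  have hLν : L * ν * g ^ 5 ≤ 4 * Q * (κ * l) := by
    calc L * ν * g ^ 5 = (L * g ^ 2) * (ν * g ^ 3) := by ring
      _ ≤ (2 * R + 1) * (4 * (R ^ 2 + 1) * (κ * l)) :=
          mul_le_mul hL' hν' (by positivity) (by positivity)
      _ = _ := by rw [hQ]; ring
  have hLνH : L * ν * H * g ^ 6 ≤ 4 * Q * (κ * l) ^ 2 := by
    calc L * ν * H * g ^ 6 = (L * ν * g ^ 5) * (H * g) := by ring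
      _ ≤ (4 * Q * (κ * l)) * (κ * l) := mul_le_mul hLν hH' (by positivity) (by positivity)
      _ = _ := by ring
  have hb : 2 * ν / (g ^ 3 * ε ^ 3) ≤ 8 * Q * (κ * l) / (g ^ 6 * ε ^ 3) := by
    rw [div_le_div_iff₀ (by positivity) (by positivity)]
    have h1 : ν * g ^ 3 ≤ 4 * Q * (κ * l) := hν'.trans
      (mul_le_mul_of_nonneg_right (by linarith) (by positivity))
    have h2 := mul_le_mul_of_nonneg_right h1 (by positivity : 0 ≤ 2 * g ^ 3 * ε ^ 3)
    calc _ = ν * g ^ 3 * (2 * g ^ 3 * ε ^ 3) := by ring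
      _ ≤ _ := h2
      _ = _ := by ring
  have hd : 8 * δ * L * ν / (g ^ 6 * ε ^ 6) * H ≤
      32 * Q * (κ * l) ^ 2 * Δ / (g ^ 12 * ε ^ 6) := by
    rw [div_mul_eq_mul_div, div_le_div_iff₀ (by positivity) (by positivity)]
    calc 8 * δ * L * ν * H * (g ^ 12 * ε ^ 6)
        = 8 * δ * (L * ν * H * g ^ 6) * (g ^ 6 * ε ^ 6) := by ring
      _ ≤ 8 * Δ * (4 * Q * (κ * l) ^ 2) * (g ^ 6 * ε ^ 6) := by gcongr
      _ = _ := by ring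
  refine ⟨?_, ?_, ?_, ?_, ?_, ?_⟩
  · rw [div_le_iff₀ (by positivity)] at hRν
    rw [div_le_div_iff₀ (by positivity) (by positivity)]
    have h2 := mul_le_mul_of_nonneg_right hRν (by positivity : 0 ≤ 2 * g ^ 3 * ε ^ 3)
    calc _ = R ^ 2 * (2 * g ^ 3 * ε ^ 3) := by ring
      _ ≤ _ := h2
      _ = _ := by ring
  · refine hb.trans ?_
    rw [mul_assoc K]
    gcongr
    linarith
  · rw [hη, div_le_div_iff₀ (by positivity) (by positivity)]
    calc g ^ 8 * ε ^ 3 * (2 * L * ν) = 2 * (L * ν * g ^ 5) * (g ^ 3 * ε ^ 3) := by ring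
      _ ≤ 2 * (4 * Q * (κ * l)) * (g ^ 3 * ε ^ 3) := by gcongr
      _ = (g ^ 3 * ε ^ 3) * 1 * (8 * Q * (κ * l)) := by ring
      _ ≤ (g ^ 3 * ε ^ 3) * m * (K * (κ * l)) := by
          gcongr
          linarith
      _ = _ := by ring
  · have hgε : g ^ 3 * ε ^ 3 ≤ 1 :=
      mul_le_one₀ (pow_le_one₀ hg.le hg1) (by positivity) (pow_le_one₀ hε.le hε1.le)
    -- If m ≤ 1, the lower bounds on L and ν give η ≤ 1/R³; otherwise the batch bound gives η ≤ 1/L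
    -- ≤ 1/R. Hence the two inverse powers of R in K.
    rcases le_max_iff.1 hm2 with h | h
    · calc η = g ^ 3 * ε ^ 3 * m / (2 * L * ν) := hη
        _ ≤ 1 * 1 / (1 * R * R ^ 2) := by gcongr; norm_num
        _ = 1 / R ^ 3 := by ring_nf
        _ ≤ K := by linarith
    · rw [le_div_iff₀ (by positivity)] at h
      calc η = g ^ 3 * ε ^ 3 * m / (2 * L * ν) := hη
        _ ≤ 2 * ν / (2 * L * ν) := div_le_div_of_nonneg_right (by linarith) (by positivity)
        _ = 1 / L := by field_simp
        _ ≤ 1 / R := by gcongr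
        _ ≤ K := by linarith
  · refine hd.trans ?_
    rw [show K * κ ^ 2 * l ^ 2 * Δ = K * (κ * l) ^ 2 * Δ by ring]
    gcongr
    linarith
  · have h3 : (m : ℝ) ≤ 8 * Q * (κ * l) / (g ^ 6 * ε ^ 3) := by
      refine hm2.trans (max_le ?_ hb)
      rw [le_div_iff₀ (by positivity), one_mul]
      have h1 : g ^ 6 * ε ^ 3 ≤ 1 :=
        mul_le_one₀ (pow_le_one₀ hg.le hg1) (by positivity) (pow_le_one₀ hε.le hε1.le)
      nlinarith [mul_le_mul hQ0 hκl (by norm_num) (by linarith)]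
    -- Rounding T up costs only order g⁻⁷ε⁻³ samples, well inside the leading g⁻¹²ε⁻⁶.
    have h4 : (m : ℝ) * H ≤ 8 * Q * (κ * l) ^ 2 / (g ^ 12 * ε ^ 6) := by
      have e1 : g ^ 12 ≤ g ^ 7 := pow_le_pow_of_le_one hg.le hg1 (by norm_num)
      have e2 : ε ^ 6 ≤ ε ^ 3 := pow_le_pow_of_le_one hε.le hε1.le (by norm_num)
      calc (m : ℝ) * H ≤ 8 * Q * (κ * l) / (g ^ 6 * ε ^ 3) * (κ * l / g) :=
            mul_le_mul h3 hH2 hH (by positivity)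
        _ = 8 * Q * (κ * l) ^ 2 / (g ^ 7 * ε ^ 3) := by
            rw [div_mul_div_comm]
            ring
        _ ≤ _ := div_le_div_of_nonneg_left (by positivity) (by positivity)
            (mul_le_mul e1 e2 (by positivity) (by positivity))
    obtain ⟨T, hT1, hT2, hT3⟩ := exists_iteration_number (H := H)
      (X := 8 * δ * L * ν / (g ^ 6 * ε ^ 6)) (by positivity) hm hH
    refine ⟨T, hT1, hT2, hT3.trans ?_⟩
    calc _ ≤ 32 * Q * (κ * l) ^ 2 * Δ / (g ^ 12 * ε ^ 6) +
          2 * (8 * Q * (κ * l) ^ 2 / (g ^ 12 * ε ^ 6)) :=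
          add_le_add hd (mul_le_mul_of_nonneg_left h4 zero_le_two)
      _ = (32 * Q * Δ + 16 * Q) * (κ * l) ^ 2 / (g ^ 12 * ε ^ 6) := by ring
      _ ≤ (K * (1 + Δ)) * (κ * l) ^ 2 / (g ^ 12 * ε ^ 6) := by
          refine div_le_div_of_nonneg_right (mul_le_mul_of_nonneg_right ?_ (sq_nonneg _))
            (by positivity)
          linarith [mul_le_mul_of_nonneg_right hKQ hΔ, mul_nonneg (zero_le_one.trans hQ0) hΔ]
      _ = _ := by ring

end Parameters

/-! ### Convergence with the prescribed step size -/

section Convergence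

variable {S A : Type*} [Fintype S] [MeasurableSpace S] [MeasurableSingletonClass S]
  [Fintype A] [MeasurableSpace A] [MeasurableSingletonClass A] [Nonempty S] [Nonempty A]

lemma varConst_eq (e : Estimator) (H : ℕ) (γ R lam : ℝ) :
    varConst S A e H γ R lam = 2 * (1 - 1 / (Fintype.card A : ℝ)) *
      (pathVar e H γ R + lam ^ 2 / (Fintype.card S : ℝ)) := by
  cases e <;> rfl

/-- The prefactor 2(1 - 1/|A|) is at least 1 exactly because |A| ≥ 2. -/
lemma pathVar_le_varConst (hA : 2 ≤ Fintype.card A) (e : Estimator) (H : ℕ) {γ R : ℝ}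
    (hV : 0 ≤ pathVar e H γ R) (lam : ℝ) : pathVar e H γ R ≤ varConst S A e H γ R lam := by
  have hN : (2 : ℝ) ≤ Fintype.card A := by exact_mod_cast hA
  have h1 : 1 / (Fintype.card A : ℝ) ≤ 1 / 2 := one_div_le_one_div_of_le two_pos hN
  have h2 : 0 ≤ lam ^ 2 / (Fintype.card S : ℝ) := by positivity
  rw [varConst_eq]
  nlinarith

/-- An equality for GPOMDP; for REINFORCE the missing power of 1/(1 - γ) comes from H. -/
lemma le_pathVar (e : Estimator) {H : ℕ} {γ : ℝ} (hγ : γ < 1) (R : ℝ) (hH : 1 / (1 - γ) ≤ H) :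
    R ^ 2 / (1 - γ) ^ 3 ≤ pathVar e H γ R := by
  have hg : 0 < 1 - γ := sub_pos.2 hγ
  cases e with
  | reinforce =>
    rw [pathVar]
    calc R ^ 2 / (1 - γ) ^ 3 = 1 / (1 - γ) * (R ^ 2 / (1 - γ) ^ 2) := by field_simp
      _ ≤ H * (R ^ 2 / (1 - γ) ^ 2) := mul_le_mul_of_nonneg_right hH (by positivity)
      _ = _ := by ring
  | gpomdp => rfl

lemma varConst_le (e : Estimator) {H : ℕ} {γ : ℝ} (hγ0 : 0 ≤ γ) (hγ : γ < 1) (R : ℝ)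
    {lam x : ℝ} (hlam : 0 ≤ lam) (hlam1 : lam ≤ 1) (hx : 1 / 2 ≤ x) (hH : H ≤ x / (1 - γ)) :
    varConst S A e H γ R lam ≤ 4 * (R ^ 2 + 1) * x / (1 - γ) ^ 3 := by
  have hg : 0 < 1 - γ := sub_pos.2 hγ
  have hg1 : 1 - γ ≤ 1 := by linarith
  have hg3 : (1 - γ) ^ 3 ≤ 1 := pow_le_one₀ hg.le hg1
  have hV : pathVar e H γ R ≤ 2 * R ^ 2 * x / (1 - γ) ^ 3 := by
    cases e with
    | reinforce =>
      rw [pathVar]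
      calc H * R ^ 2 / (1 - γ) ^ 2 ≤ x / (1 - γ) * R ^ 2 / (1 - γ) ^ 2 := by gcongr
        _ = 1 * R ^ 2 * x / (1 - γ) ^ 3 := by field_simp
        _ ≤ _ := by gcongr; norm_num
    | gpomdp =>
      rw [pathVar]
      refine div_le_div_of_nonneg_right ?_ (by positivity)
      nlinarith [sq_nonneg R]
  have hV0 : 0 ≤ pathVar e H γ R := by cases e <;> rw [pathVar] <;> positivity
  have hS : (1 : ℝ) ≤ Fintype.card S := by exact_mod_cast Fintype.card_pos
  have h1 : lam ^ 2 / (Fintype.card S : ℝ) ≤ 2 * x / (1 - γ) ^ 3 := by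
    calc lam ^ 2 / (Fintype.card S : ℝ) ≤ 1 :=
          div_le_one_of_le₀ ((pow_le_one₀ hlam hlam1).trans hS) (by positivity)
      _ ≤ 2 * x / (1 - γ) ^ 3 := by
          rw [le_div_iff₀ (by positivity)]
          linarith
  have h0 : 0 ≤ lam ^ 2 / (Fintype.card S : ℝ) := by positivity
  have hN : 0 ≤ 1 / (Fintype.card A : ℝ) := by positivity
  rw [varConst_eq]
  calc _ ≤ 2 * 1 * (pathVar e H γ R + lam ^ 2 / (Fintype.card S : ℝ)) := by
        gcongr
        linarith
    _ ≤ 2 * 1 * (2 * R ^ 2 * x / (1 - γ) ^ 3 + 2 * x / (1 - γ) ^ 3) := by gcongr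
    _ = _ := by ring

lemma smoothConst_bounds (hA : 2 ≤ Fintype.card A) {γ R lam : ℝ} (hγ0 : 0 ≤ γ) (hγ : γ < 1)
    (hR : 0 < R) (hlam : 0 ≤ lam) (hlam1 : lam ≤ 1) :
    R ≤ smoothConst S A γ R lam ∧ smoothConst S A γ R lam ≤ (2 * R + 1) / (1 - γ) ^ 2 ∧
      R / (1 - γ) ^ 2 + lam / (2 * Fintype.card S) ≤ smoothConst S A γ R lam := by
  have hg : 0 < 1 - γ := sub_pos.2 hγ
  have hg2 : (1 - γ) ^ 2 ≤ 1 := pow_le_one₀ hg.le (by linarith)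
  have hN : (2 : ℝ) ≤ Fintype.card A := by exact_mod_cast hA
  have hS : (1 : ℝ) ≤ Fintype.card S := by exact_mod_cast Fintype.card_pos
  have h1 : 1 / (Fintype.card A : ℝ) ≤ 1 / 2 := one_div_le_one_div_of_le two_pos hN
  have h2 : 0 ≤ 1 / (Fintype.card A : ℝ) := by positivity
  have h3 : 0 ≤ lam / (Fintype.card S : ℝ) := by positivity
  have h4 : R ≤ R / (1 - γ) ^ 2 := by
    rw [le_div_iff₀ (by positivity)]
    exact mul_le_of_le_one_right hR.le hg2
  have h5 : 0 < R / (1 - γ) ^ 2 := by positivity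
  have h6 : lam / (Fintype.card S : ℝ) ≤ 1 / (1 - γ) ^ 2 := by
    refine (div_le_one_of_le₀ (hlam1.trans hS) (by positivity)).trans ?_
    rw [le_div_iff₀ (by positivity)]
    linarith
  have h7 : lam / (2 * (Fintype.card S : ℝ)) = lam / (Fintype.card S : ℝ) / 2 := by
    field_simp
  have h8 : (2 * R + 1) / (1 - γ) ^ 2 = R / (1 - γ) ^ 2 * 2 + 1 / (1 - γ) ^ 2 := by ring
  have h9 : R / (1 - γ) ^ 2 * 1 ≤ R / (1 - γ) ^ 2 * (2 - 1 / (Fintype.card A : ℝ)) :=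
    mul_le_mul_of_nonneg_left (by linarith) h5.le
  have h10 : R / (1 - γ) ^ 2 * (2 - 1 / (Fintype.card A : ℝ)) ≤ R / (1 - γ) ^ 2 * 2 :=
    mul_le_mul_of_nonneg_left (by linarith) h5.le
  rw [smoothConst, h7, h8]
  refine ⟨by linarith, by linarith, by linarith⟩

/-- Vanilla policy gradient with a step size at most the inverse of the smoothness constant. -/
lemma averageRegret_le_of_step_size (M : MDP S A) (hA : 2 ≤ Fintype.card A)
    (hρ : ∀ s, M.ρ s ≠ 0) {πstar : Policy S A} (hopt : IsOptimalPolicy M πstar) {R : ℝ}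
    (hR : 0 < R) (hr : ∀ s a, |M.r s a| ≤ R) (e : Estimator) (θ₀ : Param S A) {ε : ℝ} {m H : ℕ}
    {lam L ν η : ℝ} (hε : 0 < ε) (hε1 : ε < 1)
    (hlam : lam = (1 - M.γ) * ε / (2 * mismatch M πstar))
    (hL : L = smoothConst S A M.γ R lam) (hν : ν = varConst S A e H M.γ R lam) (hνpos : 0 < ν)
    (hη : η = (1 - M.γ) ^ 3 * ε ^ 3 * m / (2 * L * ν)) (hm : 1 ≤ m)
    (hm2 : (m : ℝ) ≤ 2 * ν / ((1 - M.γ) ^ 3 * ε ^ 3))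
    (hH : 8 * Real.log (2 / ((1 - M.γ) * ε)) / (1 - M.γ) ≤ H) {T : ℕ} (hT : 1 ≤ T)
    (hTm : 8 * (optRegReturn M lam - regReturn M lam θ₀) * L * ν / ((1 - M.γ) ^ 6 * ε ^ 6) ≤
      (T : ℝ) * m) :
    averageRegret M e lam η m H θ₀ T ≤ ε / 2 + 32 * R * Fintype.card S ^ 2 *
      Fintype.card A ^ 2 * mismatch M πstar ^ 2 * (1 + R ^ 2) * ε := by
  set g := 1 - M.γ with hgdef
  set D := mismatch M πstar with hD
  have hg : 0 < g := sub_pos.2 M.γ_lt_one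
  have hg1 : g ≤ 1 := by linarith [M.γ_nonneg]
  have hD1 : 1 ≤ D := one_le_mismatch M hρ πstar
  have hS : (0 : ℝ) < Fintype.card S := by exact_mod_cast Fintype.card_pos
  have hN : (0 : ℝ) < Fintype.card A := by exact_mod_cast Fintype.card_pos
  have hlam0 : 0 < lam := by rw [hlam]; positivity
  have hlam1 : lam ≤ 1 := by
    rw [hlam, div_le_one (by positivity)]
    nlinarith
  obtain ⟨hRL, -, hL'⟩ := smoothConst_bounds (S := S) (A := A) hA M.γ_nonneg M.γ_lt_one hR
    hlam0.le hlam1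
  rw [← hL] at hRL hL'
  rw [← hgdef] at hL'
  have hL0 : 0 < L := hR.trans_le hRL
  have hm0 : (0 : ℝ) < m := by positivity
  have hT0 : (0 : ℝ) < T := by positivity
  have hη0 : 0 < η := by rw [hη]; positivity
  -- Since ηL = g³ε³m/(2ν), this is precisely the upper bound on the batch size.
  have hηL : η * L ≤ 1 := by
    rw [le_div_iff₀ (by positivity)] at hm2
    rw [hη, div_mul_eq_mul_div, div_le_one (by positivity)]
    nlinarith
  have hV0 : 0 ≤ pathVar e H M.γ R := by
    cases e <;> rw [pathVar, ← hgdef] <;> positivity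
  have hVν : pathVar e H M.γ R ≤ ν := hν ▸ pathVar_le_varConst hA e H hV0 lam
  set β := R * (M.γ ^ H * (1 / g ^ 2 + H / g)) with hβ
  have hβ2 : β ^ 2 ≤ R ^ 2 * (g ^ 3 * ε ^ 3) :=
    truncation_error_sq_le M.γ_nonneg M.γ_lt_one hε hε1 hH
  have hL'η : η * (R / g ^ 2 + lam / (2 * Fintype.card S)) ≤ η * L :=
    mul_le_mul_of_nonneg_left hL' hη0.le
  have hgrad := sum_pmfExp_norm_regGrad_sq_le M e hm H hlam0.le hη0 hr (hL'η.trans hηL)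
    (norm_regGrad_sub_meanEstimate_le M hr lam H) θ₀ T
  rw [← hgdef, ← hβ] at hgrad
  set δ := optRegReturn M lam - regReturn M lam θ₀
  -- The step size is proportional to m, so the batch size cancels: ηLν/m = g³ε³/2.
  have hnoise : η * (R / g ^ 2 + lam / (2 * Fintype.card S)) * (pathVar e H M.γ R / m) ≤
      g ^ 3 * ε ^ 3 / 2 := by
    calc _ ≤ η * L * (ν / m) := by gcongr
      _ = g ^ 3 * ε ^ 3 / 2 := by
        rw [hη]
        field_simp
  have hopt1 : 2 / η * δ ≤ T * (g ^ 3 * ε ^ 3 / 2) := by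
    rw [div_le_iff₀ (by positivity)] at hTm
    have h1 : 2 / η * δ = 8 * δ * L * ν / (2 * (g ^ 3 * ε ^ 3 * m)) := by
      rw [hη]
      field_simp
      ring
    rw [h1, div_le_iff₀ (by positivity)]
    calc _ ≤ _ := hTm
      _ = _ := by ring
  have havg : 1 / (T : ℝ) * ∑ t ∈ Finset.range T,
      pmfExp (iterateLaw M e lam η m H θ₀ t) (fun θ => ‖regGrad M lam θ‖ ^ 2) ≤
      (1 + R ^ 2) * (g ^ 3 * ε ^ 3) := by
    rw [one_div_mul_eq_div, div_le_iff₀ hT0]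
    refine hgrad.trans ?_
    have := mul_le_mul_of_nonneg_left (add_le_add hβ2 hnoise) hT0.le
    linarith
  refine (averageRegret_le M e lam η m H θ₀ hT
    fun θ => optReturn_sub_le M hρ hopt hlam0 hr θ).trans ?_
  rw [← hgdef, ← hD]
  have h2 : lam * D / g = ε / 2 := by
    rw [hlam]
    field_simp
  -- The threshold equals gε/(4D|S||A|), so the prefactor is of order 1/(g³ε²): the gradient
  -- accuracy g³ε³ cancels every power of g and leaves one ε.
  have h3 : 2 * R / g / (lam / (2 * Fintype.card S * Fintype.card A)) ^ 2 *
      ((1 + R ^ 2) * (g ^ 3 * ε ^ 3)) =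
      32 * R * Fintype.card S ^ 2 * Fintype.card A ^ 2 * D ^ 2 * (1 + R ^ 2) * ε := by
    rw [hlam]
    field_simp
    ring
  rw [h2, ← h3]
  gcongr

/-- The trivial bound on the average regret. -/
lemma averageRegret_le_trivial (M : MDP S A) {R : ℝ} (hr : ∀ s a, |M.r s a| ≤ R) (e : Estimator)
    (lam η : ℝ) (m H : ℕ) (θ₀ : Param S A) {T : ℕ} (hT : 1 ≤ T) :
    averageRegret M e lam η m H θ₀ T ≤ 2 * R / (1 - M.γ) := by
  have h : ∀ θ : Param S A, optReturn M - softmaxReturn M θ ≤ 2 * R / (1 - M.γ) + 0 * 0 := by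
    intro θ
    have h1 : optReturn M ≤ R / (1 - M.γ) := ciSup_le fun ϑ =>
      (abs_le.1 (abs_policyReturn_le M _ hr)).2
    have h2 := (abs_le.1 (abs_policyReturn_le M (softmaxPolicy θ) hr)).1
    have h3 : 2 * R / (1 - M.γ) = R / (1 - M.γ) + R / (1 - M.γ) := by ring
    rw [softmaxReturn]
    linarith
  simpa using averageRegret_le M e lam η m H θ₀ hT (f := fun _ => 0) h

end Convergence
end

end PolicyGradient

/-! ### Assembly of the theorem -/

theorem mainTheorem10 :
    ∃ c : ℝ, 0 < c ∧
    ∀ (nS nA : ℕ) (Rmax D : ℝ), 1 ≤ nS → 2 ≤ nA → 0 < Rmax →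
    ∃ K : ℝ, 0 < K ∧
    ∀ (S A : Type*)
      [Fintype S] [Nonempty S] [MeasurableSpace S] [MeasurableSingletonClass S]
      [Fintype A] [Nonempty A] [MeasurableSpace A] [MeasurableSingletonClass A]
      (M : PolicyGradient.MDP S A) (πstar : PolicyGradient.Policy S A),
      Fintype.card S = nS → Fintype.card A = nA →
      (∀ s a, |M.r s a| ≤ Rmax) → (∀ s, M.ρ s ≠ 0) →
      PolicyGradient.IsOptimalPolicy M πstar → PolicyGradient.mismatch M πstar ≤ D →
    ∀ (e : PolicyGradient.Estimator) (θ₀ : PolicyGradient.Param S A) (ε : ℝ) (m H : ℕ)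
      (logFactor lam L ν η δ₀ Δ₀ : ℝ),
      0 < ε → ε < 1 →
      logFactor = Real.log (2 / ((1 - M.γ) * ε)) →
      lam = (1 - M.γ) * ε / (2 * PolicyGradient.mismatch M πstar) →
      L = PolicyGradient.smoothConst S A M.γ Rmax lam →
      ν = PolicyGradient.varConst S A e H M.γ Rmax lam →
      η = (1 - M.γ) ^ 3 * ε ^ 3 * (m : ℝ) / (2 * L * ν) →
      δ₀ = PolicyGradient.optRegReturn M lam - PolicyGradient.regReturn M lam θ₀ →
      Δ₀ = PolicyGradient.optReturn M - PolicyGradient.softmaxReturn M θ₀ +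
        PolicyGradient.barrier θ₀ →
      1 ≤ m → (m : ℝ) ≤ max 1 (2 * ν / ((1 - M.γ) ^ 3 * ε ^ 3)) →
      c * logFactor / (1 - M.γ) ≤ (H : ℝ) →
      -- average regret
      (∀ T : ℕ, 1 ≤ T →
        8 * δ₀ * L * ν / ((1 - M.γ) ^ 6 * ε ^ 6) ≤ (T : ℝ) * (m : ℝ) →
        PolicyGradient.averageRegret M e lam η m H θ₀ T ≤ K * ε) ∧
      -- sizes of the parameters and total number of samples
      (∀ κ : ℝ, 1 ≤ κ → (H : ℝ) ≤ κ * logFactor / (1 - M.γ) →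
        2 * Rmax ^ 2 / ((1 - M.γ) ^ 6 * ε ^ 3) ≤ 2 * ν / ((1 - M.γ) ^ 3 * ε ^ 3) ∧
        2 * ν / ((1 - M.γ) ^ 3 * ε ^ 3) ≤ K * κ * logFactor / ((1 - M.γ) ^ 6 * ε ^ 3) ∧
        (1 - M.γ) ^ 8 * ε ^ 3 / (K * κ * logFactor) ≤ η ∧ η ≤ K ∧
        8 * δ₀ * L * ν / ((1 - M.γ) ^ 6 * ε ^ 6) * (H : ℝ) ≤
          K * κ ^ 2 * logFactor ^ 2 * Δ₀ / ((1 - M.γ) ^ 12 * ε ^ 6) ∧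
        ∃ T : ℕ, 1 ≤ T ∧ 8 * δ₀ * L * ν / ((1 - M.γ) ^ 6 * ε ^ 6) ≤ (T : ℝ) * (m : ℝ) ∧
          (T : ℝ) * (m : ℝ) * (H : ℝ) ≤
            K * κ ^ 2 * logFactor ^ 2 * (1 + Δ₀) / ((1 - M.γ) ^ 12 * ε ^ 6)) := by
  refine ⟨8, by norm_num, fun nS nA R D hnS hnA hR => ?_⟩
  -- The first two summands cover the regret in the regular batch range. The last group is what
  -- `parameter_sizes` needs; its 1/R also covers the exceptional batch size.
  refine ⟨1 + 32 * R * nS ^ 2 * nA ^ 2 * D ^ 2 * (1 + R ^ 2) +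
    (100 * (2 * R + 1) * (R ^ 2 + 1) + 1 / R + 1 / R ^ 3), by positivity, ?_⟩
  intro S A _ _ _ _ _ _ _ _ M πstar hcS hcA hr hρ hopt hD e θ₀ ε m H logFactor lam L ν η δ₀ Δ₀
    hε hε1 hlog hlam hL hν hη hδ₀ hΔ₀ hm hm2 hH
  set K := 1 + 32 * R * nS ^ 2 * nA ^ 2 * D ^ 2 * (1 + R ^ 2) +
    (100 * (2 * R + 1) * (R ^ 2 + 1) + 1 / R + 1 / R ^ 3) with hK
  have hA2 : 2 ≤ Fintype.card A := hcA ▸ hnA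
  have hγ0 := M.γ_nonneg
  have hγ1 := M.γ_lt_one
  have hg : 0 < 1 - M.γ := sub_pos.2 hγ1
  have hg1 : 1 - M.γ ≤ 1 := by linarith
  have hD1 := PolicyGradient.one_le_mismatch M hρ πstar
  have hgε1 : (1 - M.γ) * ε ≤ 1 := mul_le_one₀ hg1 hε.le hε1.le
  have hlam0 : 0 < lam := by rw [hlam]; positivity
  have hlam1 : lam ≤ 1 := by
    rw [hlam, div_le_one (by positivity)]
    linarith
  -- Since (1 - γ)ε ≤ 1, the logarithm is at least log 2. Hence 8ℓ ≥ 1, which yields H ≥ 1/(1 - γ).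
  have hl : 1 / 2 ≤ logFactor := by
    have h1 : Real.log 2 ≤ logFactor := by
      rw [hlog]
      refine Real.log_le_log two_pos ?_
      rw [le_div_iff₀ (by positivity)]
      linarith
    linarith [Real.log_two_gt_d9]
  have hH1 : 1 / (1 - M.γ) ≤ H :=
    (div_le_div_of_nonneg_right (by linarith) hg.le).trans hH
  have hV := PolicyGradient.le_pathVar e hγ1 R hH1
  have hV0 : 0 < PolicyGradient.pathVar e H M.γ R := lt_of_lt_of_le (by positivity) hV
  have hRν : R ^ 2 / (1 - M.γ) ^ 3 ≤ ν :=
    hV.trans (hν ▸ PolicyGradient.pathVar_le_varConst hA2 e H hV0.le lam)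
  have hν0 : 0 < ν := lt_of_lt_of_le (by positivity) hRν
  have hX : 0 ≤ 32 * R * nS ^ 2 * nA ^ 2 * D ^ 2 * (1 + R ^ 2) := by positivity
  have hR1 : 0 < 1 / R := by positivity
  have hR3 : 0 < 1 / R ^ 3 := by positivity
  have hY : 0 < 100 * (2 * R + 1) * (R ^ 2 + 1) := by positivity
  constructor
  · intro T hT hTm
    rcases le_or_gt (m : ℝ) (2 * ν / ((1 - M.γ) ^ 3 * ε ^ 3)) with h | h
    · refine (PolicyGradient.averageRegret_le_of_step_size M hA2 hρ hopt hR hr e θ₀ hε hε1 hlam hL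
        hν hν0 hη hm h (hlog ▸ hH) hT (hδ₀ ▸ hTm)).trans ?_
      rw [hcS, hcA]
      have h1 : 32 * R * nS ^ 2 * nA ^ 2 * PolicyGradient.mismatch M πstar ^ 2 * (1 + R ^ 2) ≤
          32 * R * nS ^ 2 * nA ^ 2 * D ^ 2 * (1 + R ^ 2) := by gcongr
      have h2 : 1 / 2 + 32 * R * nS ^ 2 * nA ^ 2 * PolicyGradient.mismatch M πstar ^ 2 *
          (1 + R ^ 2) ≤ K := by rw [hK]; linarith
      calc _ = (1 / 2 + 32 * R * nS ^ 2 * nA ^ 2 * PolicyGradient.mismatch M πstar ^ 2 *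
          (1 + R ^ 2)) * ε := by ring
        _ ≤ K * ε := mul_le_mul_of_nonneg_right h2 hε.le
    -- Here m ≤ 1 and 2ν < g³ε³. As R² ≤ ν, this gives 2R² ≤ gε, so the trivial bound 2R/g is at
    -- most ε/R.
    · refine (PolicyGradient.averageRegret_le_trivial M hr e lam η m H θ₀ hT).trans ?_
      have hm1 : (m : ℝ) ≤ 1 := by
        rcases le_max_iff.1 hm2 with h1 | h1
        · exact h1
        · exact absurd h1 (not_le.2 h)
      have h1 : 2 * ν < (1 - M.γ) ^ 3 * ε ^ 3 := by
        have := h.trans_le hm1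
        rwa [div_lt_one (by positivity)] at this
      have h2 : R ^ 2 ≤ ν := by
        refine le_trans ?_ hRν
        rw [le_div_iff₀ (by positivity)]
        exact mul_le_of_le_one_right (sq_nonneg R) (pow_le_one₀ hg.le hg1)
      have h3 : (1 - M.γ) ^ 3 * ε ^ 3 ≤ (1 - M.γ) * ε := by
        rw [← mul_pow]
        exact pow_le_of_le_one (by positivity) hgε1 (by norm_num)
      have h4 : 2 * R / (1 - M.γ) ≤ 1 / R * ε := by
        rw [div_mul_eq_mul_div, one_mul, div_le_div_iff₀ hg hR]
        nlinarith
      refine h4.trans (mul_le_mul_of_nonneg_right ?_ hε.le)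
      rw [hK]
      linarith
  · intro κ hκ hHκ
    obtain ⟨hRL, hLle, -⟩ := PolicyGradient.smoothConst_bounds (S := S) (A := A) hA2 hγ0 hγ1 hR
      hlam0.le hlam1
    rw [← hL] at hRL hLle
    have hνle := PolicyGradient.varConst_le (S := S) (A := A) e hγ0 hγ1 R hlam0.le hlam1
      (hl.trans (le_mul_of_one_le_left (by linarith) hκ)) hHκ
    rw [← hν] at hνle
    have hδ : 0 ≤ δ₀ := by
      rw [hδ₀]
      linarith [PolicyGradient.regReturn_le_optRegReturn M hlam0.le θ₀]
    -- Replaces the λ-dependent gap by one free of λ, using L_λ^* ≤ J^* and λ ≤ 1.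
    have hδΔ : δ₀ ≤ Δ₀ := by
      have h1 := PolicyGradient.optRegReturn_le_optReturn M hlam0.le
      have h2 := mul_le_mul_of_nonneg_right hlam1 (PolicyGradient.barrier_nonneg θ₀)
      rw [hδ₀, hΔ₀, PolicyGradient.regReturn]
      linarith
    exact PolicyGradient.parameter_sizes hg hg1 hε hε1 hκ hl hR hRL hLle hRν hνle hδ hδΔ hη hm hm2
      H.cast_nonneg hHκ (by rw [hK]; linarith)
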